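/- Let $F$ be a non-archimedean local field with residue field of cardinality $q$, let $W_F$ be its Weil group, $\mathrm{ord}: W_F \to \mathbb{Z}$ the homomorphism with kernel the inertia subgroup and value $1$ on a Frobenius element $\mathrm{Fr}$, and $|w| = q^{\mathrm{ord}(w)}$. Let $\widehat G_2$ be the complex group of type $G_2$, which is the dual group of the split group $G_2$ over $F$, with maximal torus $\widehat T$ and simple roots $\hat\gamma_1$ (long) and $\hat\gamma_2$ (short), and let $\widehat m: \mathbb{C}^\times\times\mathbb{C}^\times \to \widehat T$ be the isomorphism with $\hat\gamma_1(\widehat m(x,y)) = x^{-1}y^2$ and $\hat\gamma_2(\widehat m(x,y)) = xy^{-1}$. For a positive root $\hat\gamma$ let $\iota_{\hat\gamma}: \mathrm{SL}_2(\mathbb{C})\to\widehat G_2$ be the homomorphism that maps $\mathrm{diag}(t,t^{-1})$ to $\hat\gamma^\vee(t)$ and the upper (lower) unitriangular matrices to the root subgroup of $\hat\gamma$ (of $-\hat\gamma$), defined by root vectors $X_{\hat\gamma}$ chosen so that $\iota_{\hat\gamma_1}$ and $\iota_{\hat\gamma_1+2\hat\gamma_2}$ have commuting images, let $\varphi_{A_2},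 \varphi_{\mathrm{reg}}: \mathrm{SL}_2(\mathbb{C})\to \widehat G_2$ be the homomorphisms with differentials mapping $\left(\begin{smallmatrix}0&1\\0&0\end{smallmatrix}\right)$ to $X_{\hat\gamma_1}+X_{\hat\gamma_1+3\hat\gamma_2}$ and to $X_{\hat\gamma_1}+X_{\hat\gamma_2}$ respectively, and such that $\mathrm{diag}(t,t^{-1})$ is mapped to $\widehat m(t^2,t^2)$ and $\widehat m(t^6,t^4)$ respectively. A Langlands parameter (for the split group $G_2$ over $F$) is a homomorphism $\phi: W_F\times \mathrm{SL}_2(\mathbb{C})\to\widehat G_2$ that is continuous with semisimple values on $W_F$ and algebraic on $\mathrm{SL}_2(\mathbb{C})$; it is unramified if it is trivial on the inertia subgroup. An Arthur parameter is a homomorphism $\psi: W_F\times \mathrm{SL}_2(\mathbb{C})\times\mathrm{SL}_2(\mathbb{C})\to\widehat G_2$ that is continuous and bounded with semisimple values on $W_F$ and algebraic on both factors $\mathrm{SL}_2(\mathbb{C})$. The parameter $\phi$ is of Arthur type if there is an Arthur parameter $\psi$ with $\phi(w,x)=\psi(w,x,\mathrm{diag}(|w|^{1/2},|w|^{-1/2}))$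 for all $w$ and $x$. Fix a primitive cube root of unity $\theta_3$. For $z\in\mathbb{C}^\times\times\mathbb{C}^\times$ let $R(z)$ be the set of all roots $\hat\gamma$ with $\hat\gamma(\widehat m(z))=q$, and for a homomorphism $\iota: \mathrm{SL}_2(\mathbb{C})\to\widehat G_2$ whose image commutes with $\widehat m(z)$ write $[z;\iota]$ for the parameter $(w,x)\mapsto \widehat m(z)^{\mathrm{ord}(w)}\iota(x)$. In the following list $u,u_1,u_2$ are complex numbers of absolute value $1$, $a,a_1,a_2$ are real numbers, and $\theta\in\{1,\theta_3,\theta_3^2\}$; the last entry is a condition. - $0$: $[(u_1q^{a_1},u_2q^{a_2});1]$ with $R(u_1q^{a_1},u_2q^{a_2})=\emptyset$: $a_1=a_2=0$. - $1a$: $[(q,uq^a);1]$; $1b$: $[(1,uq^{a-1/2});\iota_{\hat\gamma_1+2\hat\gamma_2}]$; both with $R(q,uq^a)=\{\hat\gamma_1+2\hat\gamma_2\}$: $a=1/2$ (in both cases). - $2a$: $[(uq^a,u^{-1}q^{1-a});1]$; $2b$: $[(uq^{a-1/2},u^{-1}q^{1/2-a});\iota_{2\hat\gamma_1+3\hat\gamma_2}]$;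 both with $R(uq^a,u^{-1}q^{1-a})=\{2\hat\gamma_1+3\hat\gamma_2\}$: $a=1/2$ (in both cases). - $3a$: $[(\theta q^{1/3},\theta^2q^{2/3});1]$: never; $3b$: $[(\theta q^{1/3},\theta^2q^{1/6});\iota_{\hat\gamma_1}]$: never. - $4a$: $[(q,-q);1]$: always; $4b$: $[(q,-q^{1/2});\iota_{\hat\gamma_1}]$: always; $4c$: $[(1,-q^{1/2});\iota_{\hat\gamma_1+2\hat\gamma_2}]$: always; $4d$: $[(1,-1);\iota_{\hat\gamma_1}\iota_{\hat\gamma_1+2\hat\gamma_2}]$: always. - $5a$: $[(q^2,q);1]$: never; $5b$: $[(q^{3/2},q^{3/2});\iota_{\hat\gamma_2}]$: never. - $6a$: $[(\theta_3q,\theta_3^2q);1]$: always; $6b$: $[(\theta_3q,\theta_3^2q^{1/2});\iota_{\hat\gamma_1}]$: never; $6c$: $[(\theta_3q^{1/2},\theta_3^2q);\iota_{\hat\gamma_1+3\hat\gamma_2}]$: never; $6d$: $[(\theta_3,\theta_3^2);\varphi_{A_2}]$: always. - $7a$: $[(q^3,q^2);1]$: always; $7b$: $[(q^3,q^{3/2});\iota_{\hat\gamma_1}]$: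 never; $7c$: $[(q^{5/2},q^{5/2});\iota_{\hat\gamma_2}]$: never; $7d$: $[(1,1);\varphi_{\mathrm{reg}}]$: always. - $8a$: $[(q,q);1]$: always; $8b$: $[(q,q^{1/2});\iota_{\hat\gamma_1}]$: always; $8c$: $[(1,q^{1/2});\iota_{\hat\gamma_1+2\hat\gamma_2}]$: always; $8d$: $[(1,1);\iota_{\hat\gamma_1}\iota_{\hat\gamma_1+2\hat\gamma_2}]$: always. Every unramified Langlands parameter is $\widehat G_2$-conjugate to a member of this list; and a Langlands parameter that is $\widehat G_2$-conjugate to a member of this list is of Arthur type if and only if the condition given for that member holds. -/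

import Mathlib

/-!
Unramified Langlands parameters of the split group `G₂` over a non-archimedean local field, and
Arthur parameters.  Since `G₂` is split, a parameter with values in the `L`-group
`Ĝ₂ × W_F` over `W_F` is the same as a homomorphism with values in the complex group `Ĝ₂`.
-/

open Matrix
open scoped NormedField Valued

namespace G2Arthur

noncomputable section

/-! ### The complex group of type `G₂`, as automorphisms of the trace zero split octonions -/

/-- Coordinates on the trace zero split octonions in Zorn's vector matrix form: `X : Fin 7 → ℂ`
stands for the vector matrix with diagonal entries `X 3, - X 3` and with off-diagonal vectors
`uPart X` and `vPart X`.  The numbering is chosen so that the maximal torus acts with weights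
`x, y, x/y, 1, y/x, 1/y, 1/x` in this order. -/
def uPart (X : Fin 7 → ℂ) : Fin 3 → ℂ := ![X 0, X 4, X 5]

/-- The second off-diagonal vector of a trace zero Zorn vector matrix. -/
def vPart (X : Fin 7 → ℂ) : Fin 3 → ℂ := ![X 6, X 2, X 1]

/-- The commutator `X Y - Y X` of trace zero split octonions, where
`(a, u; v, b) (a', u'; v', b') =
  (a a' + u ⬝ v', a u' + b' u - v × v'; a' v + b v' + u × u', b b' + v ⬝ u')`. -/
def bracket (X Y : Fin 7 → ℂ) : Fin 7 → ℂ :=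
  let a := uPart X ⬝ᵥ vPart Y - uPart Y ⬝ᵥ vPart X
  let u := (2 : ℂ) • (X 3 • uPart Y - Y 3 • uPart X - crossProduct (vPart X) (vPart Y))
  let v := (2 : ℂ) • (Y 3 • vPart X - X 3 • vPart Y + crossProduct (uPart X) (uPart Y))
  ![u 0, v 2, v 1, a, u 1, u 2, v 0]

/-- The matrix respects the commutator of trace zero split octonions. -/
def PreservesBracket (g : Matrix (Fin 7) (Fin 7) ℂ) : Prop :=
  ∀ X Y, g *ᵥ bracket X Y = bracket (g *ᵥ X) (g *ᵥ Y)

theorem PreservesBracket.one : PreservesBracket 1 := fun X Y => by simp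

theorem PreservesBracket.mul {g h : Matrix (Fin 7) (Fin 7) ℂ} (hg : PreservesBracket g)
    (hh : PreservesBracket h) : PreservesBracket (g * h) := fun X Y => by
  rw [← Matrix.mulVec_mulVec, hh, hg, Matrix.mulVec_mulVec, Matrix.mulVec_mulVec]

/-- The complex group `Ĝ₂`: the automorphism group of the algebra of trace zero split octonions
over `ℂ` (equivalently, of the split octonions), as a group of matrices. -/
def G2 : Subgroup (GL (Fin 7) ℂ) where
  carrier := {g | PreservesBracket (g : Matrix (Fin 7) (Fin 7) ℂ)}
  one_mem' := PreservesBracket.one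
  mul_mem' := fun {g h} hg hh => PreservesBracket.mul hg hh
  inv_mem' := fun {g} hg X Y => by
    have key : ∀ Z, (g : Matrix (Fin 7) (Fin 7) ℂ) *ᵥ
        (((g⁻¹ : GL (Fin 7) ℂ) : Matrix (Fin 7) (Fin 7) ℂ) *ᵥ Z) = Z := fun Z => by
      rw [Matrix.mulVec_mulVec, ← Units.val_mul, mul_inv_cancel, Units.val_one, Matrix.one_mulVec]
    have key' : ∀ Z, ((g⁻¹ : GL (Fin 7) ℂ) : Matrix (Fin 7) (Fin 7) ℂ) *ᵥ
        ((g : Matrix (Fin 7) (Fin 7) ℂ) *ᵥ Z) = Z := fun Z => by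
      rw [Matrix.mulVec_mulVec, ← Units.val_mul, inv_mul_cancel, Units.val_one, Matrix.one_mulVec]
    have h := hg (((g⁻¹ : GL (Fin 7) ℂ) : Matrix (Fin 7) (Fin 7) ℂ) *ᵥ X)
      (((g⁻¹ : GL (Fin 7) ℂ) : Matrix (Fin 7) (Fin 7) ℂ) *ᵥ Y)
    rw [key, key] at h
    rw [← h, key']

/-- The matrix of an element of `Ĝ₂`. -/
def mat (g : G2) : Matrix (Fin 7) (Fin 7) ℂ := ((g : GL (Fin 7) ℂ) : Matrix (Fin 7) (Fin 7) ℂ)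

theorem mat_mul (g h : G2) : mat (g * h) = mat g * mat h := rfl

theorem mat_injective : Function.Injective mat := fun _ _ h => Subtype.ext (Units.ext h)

/-- An element of `Ĝ₂` is semisimple if its matrix is diagonalizable. -/
def IsSemisimpleElt (g : G2) : Prop :=
  ∃ P : GL (Fin 7) ℂ, ((P * (g : GL (Fin 7) ℂ) * P⁻¹ : GL (Fin 7) ℂ) :
    Matrix (Fin 7) (Fin 7) ℂ).IsDiag

/-! ### The maximal torus and the roots -/

/-- The weights of the torus element `m̂(x, y)` on the trace zero split octonions. -/
def torusWeights (z : ℂˣ × ℂˣ) : Fin 7 → ℂ :=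
  ![z.1, z.2, z.1 * (z.2⁻¹ : ℂˣ), 1, z.2 * (z.1⁻¹ : ℂˣ), (z.2⁻¹ : ℂˣ), (z.1⁻¹ : ℂˣ)]

theorem torusWeights_mul (z w : ℂˣ × ℂˣ) :
    torusWeights (z * w) = fun i => torusWeights z i * torusWeights w i := by
  ext i
  fin_cases i <;> simp [torusWeights] <;> ring

theorem torus_preserves (z : ℂˣ × ℂˣ) : PreservesBracket (diagonal (torusWeights z)) := by
  intro X Y
  have h1 := z.1.ne_zero
  have h2 := z.2.ne_zero
  ext i
  fin_cases i <;>
    simp [bracket, uPart, vPart, torusWeights, Matrix.mulVec_diagonal, cross_apply] <;>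
    field_simp

/-- The isomorphism `m̂` of `ℂˣ × ℂˣ` with the maximal torus `T̂` of `Ĝ₂`. -/
def mHat : ℂˣ × ℂˣ →* G2 :=
  (MonoidHom.toHomUnits
    { toFun := fun z => (diagonal (torusWeights z) : Matrix (Fin 7) (Fin 7) ℂ)
      map_one' := by
        rw [← Matrix.diagonal_one]; congr 1; ext i; fin_cases i <;> simp [torusWeights]
      map_mul' := fun z w => by
        rw [torusWeights_mul, Matrix.diagonal_mul_diagonal] }).codRestrict G2
    (fun z => torus_preserves z)

theorem mat_mHat (z : ℂˣ × ℂˣ) : mat (mHat z) = diagonal (torusWeights z) := rfl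

/-- The roots of `Ĝ₂`; the pair `(i, j)` stands for `i γ̂₁ + j γ̂₂`, with `γ̂₁` the long and `γ̂₂`
the short simple root. -/
def roots : Finset (ℤ × ℤ) :=
  {(1, 0), (0, 1), (1, 1), (1, 2), (1, 3), (2, 3),
    (-1, 0), (0, -1), (-1, -1), (-1, -2), (-1, -3), (-2, -3)}

/-- The value at `m̂(x, y)` of the character `i γ̂₁ + j γ̂₂` of the torus, where
`γ̂₁(m̂(x, y)) = x⁻¹ y²` and `γ̂₂(m̂(x, y)) = x y⁻¹`. -/
def rootValue (γ : ℤ × ℤ) (z : ℂˣ × ℂˣ) : ℂˣ :=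
  (z.1⁻¹ * z.2 ^ 2) ^ γ.1 * (z.1 * z.2⁻¹) ^ γ.2

/-! ### Algebraic homomorphisms from `SL₂(ℂ)` -/

/-- The ring of regular functions on `SL₂(ℂ)`, generated by the matrix entries. -/
def regularFunctions : Subalgebra ℂ (SpecialLinearGroup (Fin 2) ℂ → ℂ) :=
  Algebra.adjoin ℂ (Set.range fun p : Fin 2 × Fin 2 =>
    fun x : SpecialLinearGroup (Fin 2) ℂ => x.1 p.1 p.2)

/-- A homomorphism `SL₂(ℂ) → Ĝ₂` is algebraic if its matrix entries are regular functions. -/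
def IsAlgebraicHom (ρ : SpecialLinearGroup (Fin 2) ℂ →* G2) : Prop :=
  ∀ i j, (fun x => mat (ρ x) i j) ∈ regularFunctions

theorem regular_entry (i j : Fin 2) :
    (fun x : SpecialLinearGroup (Fin 2) ℂ => x.1 i j) ∈ regularFunctions :=
  Algebra.subset_adjoin ⟨(i, j), rfl⟩

theorem regular_const (c : ℂ) :
    (fun _ : SpecialLinearGroup (Fin 2) ℂ => c) ∈ regularFunctions :=
  regularFunctions.algebraMap_mem c

theorem regular_add {f g : SpecialLinearGroup (Fin 2) ℂ → ℂ} (hf : f ∈ regularFunctions)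
    (hg : g ∈ regularFunctions) : (fun x => f x + g x) ∈ regularFunctions :=
  regularFunctions.add_mem hf hg

theorem regular_neg {f : SpecialLinearGroup (Fin 2) ℂ → ℂ} (hf : f ∈ regularFunctions) :
    (fun x => - f x) ∈ regularFunctions :=
  regularFunctions.neg_mem hf

theorem regular_mul {f g : SpecialLinearGroup (Fin 2) ℂ → ℂ} (hf : f ∈ regularFunctions)
    (hg : g ∈ regularFunctions) : (fun x => f x * g x) ∈ regularFunctions :=
  regularFunctions.mul_mem hf hg

theorem regular_pow {f : SpecialLinearGroup (Fin 2) ℂ → ℂ} (hf : f ∈ regularFunctions) (n : ℕ) :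
    (fun x => f x ^ n) ∈ regularFunctions :=
  regularFunctions.pow_mem hf n

theorem regular_sum {ι : Type} (s : Finset ι) (f : ι → SpecialLinearGroup (Fin 2) ℂ → ℂ)
    (hf : ∀ k ∈ s, f k ∈ regularFunctions) :
    (fun x => ∑ k ∈ s, f k x) ∈ regularFunctions := by
  have h := regularFunctions.sum_mem hf
  have e : (∑ k ∈ s, f k) = fun x => ∑ k ∈ s, f k x := by
    ext x; simp
  rwa [e] at h

/-- `SL₂` over a field is generated by upper and lower unitriangular matrices. -/
theorem sl2_induction {M : Matrix (Fin 2) (Fin 2) ℂ → Matrix (Fin 7) (Fin 7) ℂ}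
    (hmul : ∀ A B, M (A * B) = M A * M B)
    (hup : ∀ t, PreservesBracket (M !![1, t; 0, 1]))
    (hlow : ∀ t, PreservesBracket (M !![1, 0; t, 1]))
    (A : Matrix (Fin 2) (Fin 2) ℂ) (hA : A.det = 1) : PreservesBracket (M A) := by
  have main : ∀ B : Matrix (Fin 2) (Fin 2) ℂ, B.det = 1 → B 1 0 ≠ 0 →
      PreservesBracket (M B) := by
    intro B hB hc
    have e : B = !![1, (B 0 0 - 1) / B 1 0; 0, 1] * !![1, 0; B 1 0, 1] *
        !![1, (B 1 1 - 1) / B 1 0; 0, 1] := by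
      rw [Matrix.det_fin_two] at hB
      ext i j
      fin_cases i <;> fin_cases j <;> simp [Matrix.mul_apply, Fin.sum_univ_two] <;>
        field_simp <;> first | linear_combination hB | linear_combination -hB | ring
    rw [e, hmul, hmul]
    exact ((hup _).mul (hlow _)).mul (hup _)
  by_cases hc : A 1 0 = 0
  · have hd : A 1 1 ≠ 0 := by
      intro h
      rw [Matrix.det_fin_two, hc, h] at hA
      simp at hA
    have e : A = (A * !![1, 0; 1, 1]) * !![1, 0; -1, 1] := by
      rw [Matrix.mul_assoc]
      have : (!![1, 0; 1, 1] * !![1, 0; -1, 1] : Matrix (Fin 2) (Fin 2) ℂ) = 1 := by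
        ext i j; fin_cases i <;> fin_cases j <;> simp [Matrix.mul_apply, Fin.sum_univ_two]
      rw [this, Matrix.mul_one]
    rw [e, hmul]
    refine (main _ ?_ ?_).mul (hlow _)
    · rw [Matrix.det_mul, hA]; simp [Matrix.det_fin_two]
    · simpa [Matrix.mul_apply, Fin.sum_univ_two, hc] using hd
  · exact main A hA hc

/-- A multiplicative matrix-valued function that maps the unitriangular matrices to `Ĝ₂` gives a
homomorphism `SL₂(ℂ) → Ĝ₂`. -/
def homOfMatrix (M : Matrix (Fin 2) (Fin 2) ℂ → Matrix (Fin 7) (Fin 7) ℂ) (hone : M 1 = 1)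
    (hmul : ∀ A B, M (A * B) = M A * M B)
    (hup : ∀ t, PreservesBracket (M !![1, t; 0, 1]))
    (hlow : ∀ t, PreservesBracket (M !![1, 0; t, 1])) :
    SpecialLinearGroup (Fin 2) ℂ →* G2 :=
  (MonoidHom.toHomUnits
    { toFun := fun x : SpecialLinearGroup (Fin 2) ℂ => M x.1
      map_one' := hone
      map_mul' := fun x y => hmul x.1 y.1 }).codRestrict G2
    (fun x => sl2_induction hmul hup hlow x.1 x.2)

theorem eq_of_mulVec {M N : Matrix (Fin 7) (Fin 7) ℂ} (h : ∀ X, M *ᵥ X = N *ᵥ X) : M = N :=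
  Matrix.mulVec_injective (funext h)

/-! ### The homomorphisms `ι_γ̂ : SL₂(ℂ) → Ĝ₂` attached to positive roots

In each case `ι_γ̂` maps `diag(t, t⁻¹)` to `γ̂^∨(t)` and the upper (lower) unitriangular subgroup to
the root subgroup of `γ̂` (of `-γ̂`). -/

/-- The matrix of `ι_γ̂₁`. -/
def M10 (A : Matrix (Fin 2) (Fin 2) ℂ) : Matrix (Fin 7) (Fin 7) ℂ :=
  !![1, 0, 0, 0, 0, 0, 0;
     0, A 0 0, -A 0 1, 0, 0, 0, 0;
     0, -A 1 0, A 1 1, 0, 0, 0, 0;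
     0, 0, 0, 1, 0, 0, 0;
     0, 0, 0, 0, A 0 0, A 0 1, 0;
     0, 0, 0, 0, A 1 0, A 1 1, 0;
     0, 0, 0, 0, 0, 0, 1]

/-- The matrix of `ι_{γ̂₁ + 3 γ̂₂}`. -/
def M13 (A : Matrix (Fin 2) (Fin 2) ℂ) : Matrix (Fin 7) (Fin 7) ℂ :=
  !![A 0 0, 0, 0, 0, A 0 1, 0, 0;
     0, 1, 0, 0, 0, 0, 0;
     0, 0, A 0 0, 0, 0, 0, -A 0 1;
     0, 0, 0, 1, 0, 0, 0;
     A 1 0, 0, 0, 0, A 1 1, 0, 0;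
     0, 0, 0, 0, 0, 1, 0;
     0, 0, -A 1 0, 0, 0, 0, A 1 1]

/-- The matrix of `ι_{2 γ̂₁ + 3 γ̂₂}`. -/
def M23 (A : Matrix (Fin 2) (Fin 2) ℂ) : Matrix (Fin 7) (Fin 7) ℂ :=
  !![A 0 0, 0, 0, 0, 0, A 0 1, 0;
     0, A 0 0, 0, 0, 0, 0, -A 0 1;
     0, 0, 1, 0, 0, 0, 0;
     0, 0, 0, 1, 0, 0, 0;
     0, 0, 0, 0, 1, 0, 0;
     A 1 0, 0, 0, 0, 0, A 1 1, 0;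
     0, -A 1 0, 0, 0, 0, 0, A 1 1]

/-- The matrix of `ι_γ̂₂`. -/
def M01 (A : Matrix (Fin 2) (Fin 2) ℂ) : Matrix (Fin 7) (Fin 7) ℂ :=
  !![A 0 0, A 0 1, 0, 0, 0, 0, 0;
     A 1 0, A 1 1, 0, 0, 0, 0, 0;
     0, 0, A 0 0 ^ 2, 2 * A 0 0 * A 0 1, -A 0 1 ^ 2, 0, 0;
     0, 0, A 0 0 * A 1 0, A 0 0 * A 1 1 + A 0 1 * A 1 0, -(A 0 1 * A 1 1), 0, 0;
     0, 0, -A 1 0 ^ 2, -(2 * A 1 0 * A 1 1), A 1 1 ^ 2, 0, 0;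
     0, 0, 0, 0, 0, A 0 0, -A 0 1;
     0, 0, 0, 0, 0, -A 1 0, A 1 1]

/-- The matrix of `ι_{γ̂₁ + 2 γ̂₂}`. -/
def M12 (A : Matrix (Fin 2) (Fin 2) ℂ) : Matrix (Fin 7) (Fin 7) ℂ :=
  !![A 0 0 ^ 2, 0, 0, 2 * A 0 0 * A 0 1, 0, 0, -A 0 1 ^ 2;
     0, A 0 0, 0, 0, A 0 1, 0, 0;
     0, 0, A 0 0, 0, 0, -A 0 1, 0;
     A 0 0 * A 1 0, 0, 0, A 0 0 * A 1 1 + A 0 1 * A 1 0, 0, 0, -(A 0 1 * A 1 1);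
     0, A 1 0, 0, 0, A 1 1, 0, 0;
     0, 0, -A 1 0, 0, 0, A 1 1, 0;
     -A 1 0 ^ 2, 0, 0, -(2 * A 1 0 * A 1 1), 0, 0, A 1 1 ^ 2]

/-- The matrix of the homomorphism `SL₂(ℂ) → Ĝ₂` (through the subgroup `SL₃(ℂ)` of the long
roots) whose differential maps the nilpotent `(0, 1; 0, 0)` to `X_γ̂₁ + X_{γ̂₁ + 3 γ̂₂}`. -/
def MA2 (A : Matrix (Fin 2) (Fin 2) ℂ) : Matrix (Fin 7) (Fin 7) ℂ :=
  !![A 0 0 ^ 2, 0, 0, 0, A 0 0 * A 0 1, A 0 1 ^ 2 / 2, 0;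
     0, A 0 0 ^ 2, -(A 0 0 * A 0 1), 0, 0, 0, A 0 1 ^ 2 / 2;
     0, -(2 * A 0 0 * A 1 0), A 0 0 * A 1 1 + A 0 1 * A 1 0, 0, 0, 0, -(A 0 1 * A 1 1);
     0, 0, 0, 1, 0, 0, 0;
     2 * A 0 0 * A 1 0, 0, 0, 0, A 0 0 * A 1 1 + A 0 1 * A 1 0, A 0 1 * A 1 1, 0;
     2 * A 1 0 ^ 2, 0, 0, 0, 2 * A 1 0 * A 1 1, A 1 1 ^ 2, 0;
     0, 2 * A 1 0 ^ 2, -(2 * A 1 0 * A 1 1), 0, 0, 0, A 1 1 ^ 2]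

/-- The commutator in coordinates. -/
theorem bracket_eq (X Y : Fin 7 → ℂ) : bracket X Y =
    ![2 * (X 3 * Y 0 - Y 3 * X 0 - (X 2 * Y 1 - X 1 * Y 2)),
      2 * (Y 3 * X 1 - X 3 * Y 1 + (X 0 * Y 4 - X 4 * Y 0)),
      2 * (Y 3 * X 2 - X 3 * Y 2 + (X 5 * Y 0 - X 0 * Y 5)),
      X 0 * Y 6 + X 4 * Y 2 + X 5 * Y 1 - (Y 0 * X 6 + Y 4 * X 2 + Y 5 * X 1),
      2 * (X 3 * Y 4 - Y 3 * X 4 - (X 1 * Y 6 - X 6 * Y 1)),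
      2 * (X 3 * Y 5 - Y 3 * X 5 - (X 6 * Y 2 - X 2 * Y 6)),
      2 * (Y 3 * X 6 - X 3 * Y 6 + (X 4 * Y 5 - X 5 * Y 4))] := by
  ext i
  fin_cases i <;> simp [bracket, uPart, vPart, cross_apply, dotProduct, Fin.sum_univ_succ] <;> ring

theorem M10_mulVec (A : Matrix (Fin 2) (Fin 2) ℂ) (X : Fin 7 → ℂ) : M10 A *ᵥ X =
      ![X 0,
        A 0 0 * X 1 - A 0 1 * X 2,
        -A 1 0 * X 1 + A 1 1 * X 2,
        X 3,
        A 0 0 * X 4 + A 0 1 * X 5,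
        A 1 0 * X 4 + A 1 1 * X 5,
        X 6] := by
  ext i
  fin_cases i <;> simp [M10, Matrix.mulVec, dotProduct, Fin.sum_univ_succ] <;> ring

theorem M10_one : M10 1 = 1 := by
  refine eq_of_mulVec fun X => ?_
  rw [M10_mulVec, Matrix.one_mulVec]
  ext i
  fin_cases i <;> simp

theorem M10_mul (A B : Matrix (Fin 2) (Fin 2) ℂ) : M10 (A * B) = M10 A * M10 B := by
  refine eq_of_mulVec fun X => ?_
  rw [← Matrix.mulVec_mulVec]
  simp only [M10_mulVec, Matrix.mul_apply, Fin.sum_univ_two]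
  ext i
  fin_cases i <;> simp <;> ring

theorem M10_up (t : ℂ) : PreservesBracket (M10 !![1, t; 0, 1]) := by
  intro X Y
  rw [M10_mulVec, M10_mulVec, M10_mulVec, bracket_eq, bracket_eq]
  ext i
  fin_cases i <;> simp <;> ring

theorem M10_low (t : ℂ) : PreservesBracket (M10 !![1, 0; t, 1]) := by
  intro X Y
  rw [M10_mulVec, M10_mulVec, M10_mulVec, bracket_eq, bracket_eq]
  ext i
  fin_cases i <;> simp <;> ring

theorem M10_reg (i j : Fin 7) :
    (fun x : SpecialLinearGroup (Fin 2) ℂ => M10 x.1 i j) ∈ regularFunctions := by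
  fin_cases i <;> fin_cases j <;> simp only [M10] <;>
    repeat first
      | exact regular_const _
      | exact regular_entry _ _
      | apply regular_neg
      | apply regular_pow
      | apply regular_add
      | apply regular_mul

theorem M10_comm {z : ℂˣ × ℂˣ} (h : z.1 = z.2 ^ 2) (A : Matrix (Fin 2) (Fin 2) ℂ) :
    diagonal (torusWeights z) * M10 A = M10 A * diagonal (torusWeights z) := by
  obtain ⟨x, y⟩ := z
  obtain rfl : x = y ^ 2 := h
  refine eq_of_mulVec fun X => ?_
  rw [← Matrix.mulVec_mulVec, ← Matrix.mulVec_mulVec, M10_mulVec, M10_mulVec]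
  ext i
  fin_cases i <;> simp [torusWeights, Matrix.mulVec_diagonal] <;> field_simp

theorem M13_mulVec (A : Matrix (Fin 2) (Fin 2) ℂ) (X : Fin 7 → ℂ) : M13 A *ᵥ X =
      ![A 0 0 * X 0 + A 0 1 * X 4,
        X 1,
        A 0 0 * X 2 - A 0 1 * X 6,
        X 3,
        A 1 0 * X 0 + A 1 1 * X 4,
        X 5,
        -A 1 0 * X 2 + A 1 1 * X 6] := by
  ext i
  fin_cases i <;> simp [M13, Matrix.mulVec, dotProduct, Fin.sum_univ_succ] <;> ring

theorem M13_one : M13 1 = 1 := by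
  refine eq_of_mulVec fun X => ?_
  rw [M13_mulVec, Matrix.one_mulVec]
  ext i
  fin_cases i <;> simp

theorem M13_mul (A B : Matrix (Fin 2) (Fin 2) ℂ) : M13 (A * B) = M13 A * M13 B := by
  refine eq_of_mulVec fun X => ?_
  rw [← Matrix.mulVec_mulVec]
  simp only [M13_mulVec, Matrix.mul_apply, Fin.sum_univ_two]
  ext i
  fin_cases i <;> simp <;> ring

theorem M13_up (t : ℂ) : PreservesBracket (M13 !![1, t; 0, 1]) := by
  intro X Y
  rw [M13_mulVec, M13_mulVec, M13_mulVec, bracket_eq, bracket_eq]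
  ext i
  fin_cases i <;> simp <;> ring

theorem M13_low (t : ℂ) : PreservesBracket (M13 !![1, 0; t, 1]) := by
  intro X Y
  rw [M13_mulVec, M13_mulVec, M13_mulVec, bracket_eq, bracket_eq]
  ext i
  fin_cases i <;> simp <;> ring

theorem M13_reg (i j : Fin 7) :
    (fun x : SpecialLinearGroup (Fin 2) ℂ => M13 x.1 i j) ∈ regularFunctions := by
  fin_cases i <;> fin_cases j <;> simp only [M13] <;>
    repeat first
      | exact regular_const _
      | exact regular_entry _ _
      | apply regular_neg
      | apply regular_pow
      | apply regular_add
      | apply regular_mul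

theorem M13_comm {z : ℂˣ × ℂˣ} (h : z.2 = z.1 ^ 2) (A : Matrix (Fin 2) (Fin 2) ℂ) :
    diagonal (torusWeights z) * M13 A = M13 A * diagonal (torusWeights z) := by
  obtain ⟨x, y⟩ := z
  obtain rfl : y = x ^ 2 := h
  refine eq_of_mulVec fun X => ?_
  rw [← Matrix.mulVec_mulVec, ← Matrix.mulVec_mulVec, M13_mulVec, M13_mulVec]
  ext i
  fin_cases i <;> simp [torusWeights, Matrix.mulVec_diagonal] <;> field_simp

theorem M23_mulVec (A : Matrix (Fin 2) (Fin 2) ℂ) (X : Fin 7 → ℂ) : M23 A *ᵥ X =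
      ![A 0 0 * X 0 + A 0 1 * X 5,
        A 0 0 * X 1 - A 0 1 * X 6,
        X 2,
        X 3,
        X 4,
        A 1 0 * X 0 + A 1 1 * X 5,
        -A 1 0 * X 1 + A 1 1 * X 6] := by
  ext i
  fin_cases i <;> simp [M23, Matrix.mulVec, dotProduct, Fin.sum_univ_succ] <;> ring

theorem M23_one : M23 1 = 1 := by
  refine eq_of_mulVec fun X => ?_
  rw [M23_mulVec, Matrix.one_mulVec]
  ext i
  fin_cases i <;> simp

theorem M23_mul (A B : Matrix (Fin 2) (Fin 2) ℂ) : M23 (A * B) = M23 A * M23 B := by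
  refine eq_of_mulVec fun X => ?_
  rw [← Matrix.mulVec_mulVec]
  simp only [M23_mulVec, Matrix.mul_apply, Fin.sum_univ_two]
  ext i
  fin_cases i <;> simp <;> ring

theorem M23_up (t : ℂ) : PreservesBracket (M23 !![1, t; 0, 1]) := by
  intro X Y
  rw [M23_mulVec, M23_mulVec, M23_mulVec, bracket_eq, bracket_eq]
  ext i
  fin_cases i <;> simp <;> ring

theorem M23_low (t : ℂ) : PreservesBracket (M23 !![1, 0; t, 1]) := by
  intro X Y
  rw [M23_mulVec, M23_mulVec, M23_mulVec, bracket_eq, bracket_eq]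
  ext i
  fin_cases i <;> simp <;> ring

theorem M23_reg (i j : Fin 7) :
    (fun x : SpecialLinearGroup (Fin 2) ℂ => M23 x.1 i j) ∈ regularFunctions := by
  fin_cases i <;> fin_cases j <;> simp only [M23] <;>
    repeat first
      | exact regular_const _
      | exact regular_entry _ _
      | apply regular_neg
      | apply regular_pow
      | apply regular_add
      | apply regular_mul

theorem M23_comm {z : ℂˣ × ℂˣ} (h : z.2 = z.1⁻¹) (A : Matrix (Fin 2) (Fin 2) ℂ) :
    diagonal (torusWeights z) * M23 A = M23 A * diagonal (torusWeights z) := by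
  obtain ⟨x, y⟩ := z
  obtain rfl : y = x⁻¹ := h
  refine eq_of_mulVec fun X => ?_
  rw [← Matrix.mulVec_mulVec, ← Matrix.mulVec_mulVec, M23_mulVec, M23_mulVec]
  ext i
  fin_cases i <;> simp [torusWeights, Matrix.mulVec_diagonal] <;> field_simp

theorem M01_mulVec (A : Matrix (Fin 2) (Fin 2) ℂ) (X : Fin 7 → ℂ) : M01 A *ᵥ X =
      ![A 0 0 * X 0 + A 0 1 * X 1,
        A 1 0 * X 0 + A 1 1 * X 1,
        A 0 0 ^ 2 * X 2 + 2 * A 0 0 * A 0 1 * X 3 - A 0 1 ^ 2 * X 4,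
        A 0 0 * A 1 0 * X 2 + (A 0 0 * A 1 1 + A 0 1 * A 1 0) * X 3 - (A 0 1 * A 1 1) * X 4,
        -A 1 0 ^ 2 * X 2 - (2 * A 1 0 * A 1 1) * X 3 + A 1 1 ^ 2 * X 4,
        A 0 0 * X 5 - A 0 1 * X 6,
        -A 1 0 * X 5 + A 1 1 * X 6] := by
  ext i
  fin_cases i <;> simp [M01, Matrix.mulVec, dotProduct, Fin.sum_univ_succ] <;> ring

theorem M01_one : M01 1 = 1 := by
  refine eq_of_mulVec fun X => ?_
  rw [M01_mulVec, Matrix.one_mulVec]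
  ext i
  fin_cases i <;> simp

theorem M01_mul (A B : Matrix (Fin 2) (Fin 2) ℂ) : M01 (A * B) = M01 A * M01 B := by
  refine eq_of_mulVec fun X => ?_
  rw [← Matrix.mulVec_mulVec]
  simp only [M01_mulVec, Matrix.mul_apply, Fin.sum_univ_two]
  ext i
  fin_cases i <;> simp <;> ring

theorem M01_up (t : ℂ) : PreservesBracket (M01 !![1, t; 0, 1]) := by
  intro X Y
  rw [M01_mulVec, M01_mulVec, M01_mulVec, bracket_eq, bracket_eq]
  ext i
  fin_cases i <;> simp <;> ring

theorem M01_low (t : ℂ) : PreservesBracket (M01 !![1, 0; t, 1]) := by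
  intro X Y
  rw [M01_mulVec, M01_mulVec, M01_mulVec, bracket_eq, bracket_eq]
  ext i
  fin_cases i <;> simp <;> ring

theorem M01_reg (i j : Fin 7) :
    (fun x : SpecialLinearGroup (Fin 2) ℂ => M01 x.1 i j) ∈ regularFunctions := by
  fin_cases i <;> fin_cases j <;> simp only [M01] <;>
    repeat first
      | exact regular_const _
      | exact regular_entry _ _
      | apply regular_neg
      | apply regular_pow
      | apply regular_add
      | apply regular_mul

theorem M01_comm {z : ℂˣ × ℂˣ} (h : z.1 = z.2) (A : Matrix (Fin 2) (Fin 2) ℂ) :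
    diagonal (torusWeights z) * M01 A = M01 A * diagonal (torusWeights z) := by
  obtain ⟨x, y⟩ := z
  obtain rfl : x = y := h
  refine eq_of_mulVec fun X => ?_
  rw [← Matrix.mulVec_mulVec, ← Matrix.mulVec_mulVec, M01_mulVec, M01_mulVec]
  ext i
  fin_cases i <;> simp [torusWeights, Matrix.mulVec_diagonal] <;> field_simp

theorem M12_mulVec (A : Matrix (Fin 2) (Fin 2) ℂ) (X : Fin 7 → ℂ) : M12 A *ᵥ X =
      ![A 0 0 ^ 2 * X 0 + 2 * A 0 0 * A 0 1 * X 3 - A 0 1 ^ 2 * X 6,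
        A 0 0 * X 1 + A 0 1 * X 4,
        A 0 0 * X 2 - A 0 1 * X 5,
        A 0 0 * A 1 0 * X 0 + (A 0 0 * A 1 1 + A 0 1 * A 1 0) * X 3 - (A 0 1 * A 1 1) * X 6,
        A 1 0 * X 1 + A 1 1 * X 4,
        -A 1 0 * X 2 + A 1 1 * X 5,
        -A 1 0 ^ 2 * X 0 - (2 * A 1 0 * A 1 1) * X 3 + A 1 1 ^ 2 * X 6] := by
  ext i
  fin_cases i <;> simp [M12, Matrix.mulVec, dotProduct, Fin.sum_univ_succ] <;> ring

theorem M12_one : M12 1 = 1 := by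
  refine eq_of_mulVec fun X => ?_
  rw [M12_mulVec, Matrix.one_mulVec]
  ext i
  fin_cases i <;> simp

theorem M12_mul (A B : Matrix (Fin 2) (Fin 2) ℂ) : M12 (A * B) = M12 A * M12 B := by
  refine eq_of_mulVec fun X => ?_
  rw [← Matrix.mulVec_mulVec]
  simp only [M12_mulVec, Matrix.mul_apply, Fin.sum_univ_two]
  ext i
  fin_cases i <;> simp <;> ring

theorem M12_up (t : ℂ) : PreservesBracket (M12 !![1, t; 0, 1]) := by
  intro X Y
  rw [M12_mulVec, M12_mulVec, M12_mulVec, bracket_eq, bracket_eq]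
  ext i
  fin_cases i <;> simp <;> ring

theorem M12_low (t : ℂ) : PreservesBracket (M12 !![1, 0; t, 1]) := by
  intro X Y
  rw [M12_mulVec, M12_mulVec, M12_mulVec, bracket_eq, bracket_eq]
  ext i
  fin_cases i <;> simp <;> ring

theorem M12_reg (i j : Fin 7) :
    (fun x : SpecialLinearGroup (Fin 2) ℂ => M12 x.1 i j) ∈ regularFunctions := by
  fin_cases i <;> fin_cases j <;> simp only [M12] <;>
    repeat first
      | exact regular_const _
      | exact regular_entry _ _
      | apply regular_neg
      | apply regular_pow
      | apply regular_add
      | apply regular_mul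

theorem M12_comm {z : ℂˣ × ℂˣ} (h : z.1 = 1) (A : Matrix (Fin 2) (Fin 2) ℂ) :
    diagonal (torusWeights z) * M12 A = M12 A * diagonal (torusWeights z) := by
  obtain ⟨x, y⟩ := z
  obtain rfl : x = 1 := h
  refine eq_of_mulVec fun X => ?_
  rw [← Matrix.mulVec_mulVec, ← Matrix.mulVec_mulVec, M12_mulVec, M12_mulVec]
  ext i
  fin_cases i <;> simp [torusWeights, Matrix.mulVec_diagonal] <;> field_simp

theorem MA2_mulVec (A : Matrix (Fin 2) (Fin 2) ℂ) (X : Fin 7 → ℂ) : MA2 A *ᵥ X =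
      ![A 0 0 ^ 2 * X 0 + A 0 0 * A 0 1 * X 4 + A 0 1 ^ 2 / 2 * X 5,
        A 0 0 ^ 2 * X 1 - (A 0 0 * A 0 1) * X 2 + A 0 1 ^ 2 / 2 * X 6,
        -(2 * A 0 0 * A 1 0) * X 1 + (A 0 0 * A 1 1 + A 0 1 * A 1 0) * X 2 - (A 0 1 * A 1 1) * X 6,
        X 3,
        2 * A 0 0 * A 1 0 * X 0 + (A 0 0 * A 1 1 + A 0 1 * A 1 0) * X 4 + A 0 1 * A 1 1 * X 5,
        2 * A 1 0 ^ 2 * X 0 + 2 * A 1 0 * A 1 1 * X 4 + A 1 1 ^ 2 * X 5,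
        2 * A 1 0 ^ 2 * X 1 - (2 * A 1 0 * A 1 1) * X 2 + A 1 1 ^ 2 * X 6] := by
  ext i
  fin_cases i <;> simp [MA2, Matrix.mulVec, dotProduct, Fin.sum_univ_succ] <;> ring

theorem MA2_one : MA2 1 = 1 := by
  refine eq_of_mulVec fun X => ?_
  rw [MA2_mulVec, Matrix.one_mulVec]
  ext i
  fin_cases i <;> simp

theorem MA2_mul (A B : Matrix (Fin 2) (Fin 2) ℂ) : MA2 (A * B) = MA2 A * MA2 B := by
  refine eq_of_mulVec fun X => ?_
  rw [← Matrix.mulVec_mulVec]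
  simp only [MA2_mulVec, Matrix.mul_apply, Fin.sum_univ_two]
  ext i
  fin_cases i <;> simp <;> ring

theorem MA2_up (t : ℂ) : PreservesBracket (MA2 !![1, t; 0, 1]) := by
  intro X Y
  rw [MA2_mulVec, MA2_mulVec, MA2_mulVec, bracket_eq, bracket_eq]
  ext i
  fin_cases i <;> simp <;> ring

theorem MA2_low (t : ℂ) : PreservesBracket (MA2 !![1, 0; t, 1]) := by
  intro X Y
  rw [MA2_mulVec, MA2_mulVec, MA2_mulVec, bracket_eq, bracket_eq]
  ext i
  fin_cases i <;> simp <;> ring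

theorem MA2_reg (i j : Fin 7) :
    (fun x : SpecialLinearGroup (Fin 2) ℂ => MA2 x.1 i j) ∈ regularFunctions := by
  fin_cases i <;> fin_cases j <;> simp only [MA2] <;>
    repeat first
      | exact regular_const _
      | exact regular_entry _ _
      | apply regular_neg
      | apply regular_pow
      | apply regular_add
      | apply regular_mul

theorem MA2_comm {z : ℂˣ × ℂˣ} (h : z.2 = z.1 ^ 2) (h3 : z.1 ^ 3 = 1)
    (A : Matrix (Fin 2) (Fin 2) ℂ) :
    diagonal (torusWeights z) * MA2 A = MA2 A * diagonal (torusWeights z) := by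
  obtain ⟨x, y⟩ := z
  have h4 : (x : ℂ) ^ 3 = 1 := by simpa using congrArg Units.val h3
  obtain rfl : y = x ^ 2 := h
  refine eq_of_mulVec fun X => ?_
  rw [← Matrix.mulVec_mulVec, ← Matrix.mulVec_mulVec, MA2_mulVec, MA2_mulVec]
  ext i
  fin_cases i <;> simp [torusWeights, Matrix.mulVec_diagonal] <;> field_simp <;>
    simp only [h4] <;> ring

/-! ### The principal homomorphism -/

/-- Normalization factors for a basis of binary sextic forms. -/
def scl : Fin 7 → ℂ := ![1, 1, -1 / 2, -1 / 3, 1 / 12, 1 / 60, -1 / 360]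

/-- The matrix, with respect to the basis `scl j * X ^ (6 - j) * Y ^ j`, of the action of a `2 × 2`
matrix on binary sextic forms.  On `SL₂(ℂ)` this is the principal homomorphism to `Ĝ₂`, whose
differential maps the nilpotent `(0, 1; 0, 0)` to `X_γ̂₁ + X_γ̂₂`. -/
def symSix (A : Matrix (Fin 2) (Fin 2) ℂ) : Matrix (Fin 7) (Fin 7) ℂ :=
  Matrix.of fun j i => scl i / scl j *
    ∑ k ∈ Finset.range (j.val + 1), ((6 - i.val).choose (j.val - k) * i.val.choose k : ℕ) *
      (A 0 0 ^ (6 - i.val - (j.val - k)) * A 1 0 ^ (j.val - k) * A 0 1 ^ (i.val - k) *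
        A 1 1 ^ k)

/-- The row vector of the monomials, normalized. -/
def sexticBasis (X Y : ℂ) : Fin 7 → ℂ := fun j => scl j * (X ^ (6 - j.val) * Y ^ j.val)

set_option maxHeartbeats 4000000 in
theorem sexticBasis_vecMul_symSix (A : Matrix (Fin 2) (Fin 2) ℂ) (X Y : ℂ) :
    sexticBasis X Y ᵥ* symSix A =
      sexticBasis (X * A 0 0 + Y * A 1 0) (X * A 0 1 + Y * A 1 1) := by
  ext i
  fin_cases i <;>
    simp [symSix, scl, sexticBasis, Matrix.vecMul, dotProduct, Fin.sum_univ_succ,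
      Finset.sum_range_succ, Nat.choose] <;> ring

theorem ext_of_sexticBasis {M N : Matrix (Fin 7) (Fin 7) ℂ}
    (h : ∀ X Y, sexticBasis X Y ᵥ* M = sexticBasis X Y ᵥ* N) : M = N := by
  have hs : ∀ j, scl j ≠ 0 := by intro j; fin_cases j <;> simp [scl]
  ext i j
  let p : Polynomial ℂ := ∑ k : Fin 7, Polynomial.C (scl k * (M k j - N k j)) * Polynomial.X ^ k.val
  have hp : p = 0 := by
    apply Polynomial.funext
    intro y
    have := congrFun (h 1 y) j
    simp only [Matrix.vecMul, dotProduct, sexticBasis, one_pow, one_mul] at this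
    simp only [p, Polynomial.eval_finsetSum, Polynomial.eval_mul, Polynomial.eval_C,
      Polynomial.eval_pow, Polynomial.eval_X, Polynomial.eval_zero]
    rw [← sub_eq_zero, ← Finset.sum_sub_distrib] at this
    rw [← this]
    exact Finset.sum_congr rfl fun k _ => by ring
  have hc := congrArg (fun q => Polynomial.coeff q i.val) hp
  simp only [p, Polynomial.finsetSum_coeff, Polynomial.coeff_C_mul, Polynomial.coeff_X_pow,
    Polynomial.coeff_zero] at hc
  rw [Finset.sum_eq_single i] at hc
  · simpa [hs i, sub_eq_zero] using hc
  · intro k _ hk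
    rw [if_neg (fun hh => hk (Fin.ext hh.symm)), mul_zero]
  · simp

theorem symSix_mul (A B : Matrix (Fin 2) (Fin 2) ℂ) : symSix (A * B) = symSix A * symSix B := by
  apply ext_of_sexticBasis
  intro X Y
  rw [← Matrix.vecMul_vecMul, sexticBasis_vecMul_symSix, sexticBasis_vecMul_symSix,
    sexticBasis_vecMul_symSix]
  simp only [Matrix.mul_apply, Fin.sum_univ_two]
  congr 1 <;> ring

theorem symSix_one : symSix 1 = 1 := by
  apply ext_of_sexticBasis
  intro X Y
  rw [sexticBasis_vecMul_symSix, Matrix.vecMul_one]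
  simp

theorem symSix_upper (t : ℂ) : symSix !![1, t; 0, 1] =
  !![1, t, -(t ^ 2 / 2), -(t ^ 3 / 3), t ^ 4 / 12, t ^ 5 / 60, -(t ^ 6 / 360);
     0, 1, -t, -t ^ 2, t ^ 3 / 3, t ^ 4 / 12, -(t ^ 5 / 60);
     0, 0, 1, 2 * t, -t ^ 2, -(t ^ 3 / 3), t ^ 4 / 12;
     0, 0, 0, 1, -t, -(t ^ 2 / 2), t ^ 3 / 6;
     0, 0, 0, 0, 1, t, -(t ^ 2 / 2);
     0, 0, 0, 0, 0, 1, -t;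
     0, 0, 0, 0, 0, 0, 1] := by
  apply ext_of_sexticBasis
  intro X Y
  rw [sexticBasis_vecMul_symSix]
  ext i
  fin_cases i <;> simp [scl, sexticBasis, Matrix.vecMul, dotProduct, Fin.sum_univ_succ] <;> ring

theorem symSix_lower (t : ℂ) : symSix !![1, 0; t, 1] =
  !![1, 0, 0, 0, 0, 0, 0;
     6 * t, 1, 0, 0, 0, 0, 0;
     -(30 * t ^ 2), -(10 * t), 1, 0, 0, 0, 0;
     -(60 * t ^ 3), -(30 * t ^ 2), 6 * t, 1, 0, 0, 0;
     180 * t ^ 4, 120 * t ^ 3, -(36 * t ^ 2), -(12 * t), 1, 0, 0;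
     360 * t ^ 5, 300 * t ^ 4, -(120 * t ^ 3), -(60 * t ^ 2), 10 * t, 1, 0;
     -(360 * t ^ 6), -(360 * t ^ 5), 180 * t ^ 4, 120 * t ^ 3, -(30 * t ^ 2), -(6 * t), 1] := by
  apply ext_of_sexticBasis
  intro X Y
  rw [sexticBasis_vecMul_symSix]
  ext i
  fin_cases i <;> simp [scl, sexticBasis, Matrix.vecMul, dotProduct, Fin.sum_univ_succ] <;> ring

theorem symSix_up (t : ℂ) : PreservesBracket (symSix !![1, t; 0, 1]) := by
  rw [symSix_upper]
  intro X Y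
  rw [bracket_eq, bracket_eq]
  ext i
  fin_cases i <;> simp [Matrix.mulVec, dotProduct, Fin.sum_univ_succ] <;> ring

theorem symSix_low (t : ℂ) : PreservesBracket (symSix !![1, 0; t, 1]) := by
  rw [symSix_lower]
  intro X Y
  rw [bracket_eq, bracket_eq]
  ext i
  fin_cases i <;> simp [Matrix.mulVec, dotProduct, Fin.sum_univ_succ] <;> ring

theorem symSix_reg (i j : Fin 7) :
    (fun x : SpecialLinearGroup (Fin 2) ℂ => symSix x.1 i j) ∈ regularFunctions := by
  unfold symSix
  exact regular_mul (regular_const _) (regular_sum _ _ fun k _ => regular_mul (regular_const _)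
    (regular_mul (regular_mul (regular_mul (regular_pow (regular_entry _ _) _)
      (regular_pow (regular_entry _ _) _)) (regular_pow (regular_entry _ _) _))
      (regular_pow (regular_entry _ _) _)))

theorem M10_M12_comm (A B : Matrix (Fin 2) (Fin 2) ℂ) : M10 A * M12 B = M12 B * M10 A := by
  refine eq_of_mulVec fun X => ?_
  rw [← Matrix.mulVec_mulVec, ← Matrix.mulVec_mulVec, M10_mulVec, M10_mulVec, M12_mulVec,
    M12_mulVec]
  ext i
  fin_cases i <;> simp <;> ring

/-! ### The homomorphisms `SL₂(ℂ) → Ĝ₂` -/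

/-- `ι_γ̂₁`. -/
def iota10 : SpecialLinearGroup (Fin 2) ℂ →* G2 := homOfMatrix M10 M10_one M10_mul M10_up M10_low

/-- `ι_{γ̂₁ + 3 γ̂₂}`. -/
def iota13 : SpecialLinearGroup (Fin 2) ℂ →* G2 := homOfMatrix M13 M13_one M13_mul M13_up M13_low

/-- `ι_{2 γ̂₁ + 3 γ̂₂}`. -/
def iota23 : SpecialLinearGroup (Fin 2) ℂ →* G2 := homOfMatrix M23 M23_one M23_mul M23_up M23_low

/-- `ι_γ̂₂`. -/
def iota01 : SpecialLinearGroup (Fin 2) ℂ →* G2 := homOfMatrix M01 M01_one M01_mul M01_up M01_low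

/-- `ι_{γ̂₁ + 2 γ̂₂}`. -/
def iota12 : SpecialLinearGroup (Fin 2) ℂ →* G2 := homOfMatrix M12 M12_one M12_mul M12_up M12_low

/-- The principal homomorphism into the subgroup `SL₃(ℂ)` of the long roots. -/
def iotaA2 : SpecialLinearGroup (Fin 2) ℂ →* G2 := homOfMatrix MA2 MA2_one MA2_mul MA2_up MA2_low

/-- The principal homomorphism into `Ĝ₂`. -/
def iotaReg : SpecialLinearGroup (Fin 2) ℂ →* G2 := homOfMatrix symSix symSix_one symSix_mul symSix_up symSix_low

/-- The product `x ↦ ι_γ̂₁(x) ι_{γ̂₁ + 2 γ̂₂}(x)` of the homomorphisms of two orthogonal roots. -/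
def iotaD2 : SpecialLinearGroup (Fin 2) ℂ →* G2 where
  toFun x := iota10 x * iota12 x
  map_one' := by simp
  map_mul' x y := by
    have h : iota10 y * iota12 x = iota12 x * iota10 y :=
      mat_injective (M10_M12_comm y.1 x.1)
    rw [map_mul, map_mul, mul_assoc, ← mul_assoc (iota10 y), h]
    simp only [mul_assoc]

theorem iotaD2_algebraic : IsAlgebraicHom iotaD2 := fun i j => by
  have e : (fun x => mat (iotaD2 x) i j) = fun x : SpecialLinearGroup (Fin 2) ℂ =>
      ∑ k, M10 x.1 i k * M12 x.1 k j := by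
    ext x
    exact Matrix.mul_apply
  rw [e]
  exact regular_sum _ _ fun k _ => regular_mul (M10_reg i k) (M12_reg k j)

theorem trivial_algebraic : IsAlgebraicHom 1 := fun i j => regular_const (mat 1 i j)

/-! ### The Weil group of a non-archimedean local field -/

section Weil

variable (F : Type*) [NontriviallyNormedField F] [IsUltrametricDist F]

/-- The cardinality of the residue field of `F`. -/
def resCard : ℕ := Nat.card 𝓀[F]

theorem resCard_pos [LocallyCompactSpace F] : 0 < resCard F := by
  have : ProperSpace F := ProperSpace.of_locallyCompactSpace F
  have hc : CompactSpace 𝒪[F] := by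
    have e : {x : F | x ∈ 𝒪[F]} = Metric.closedBall 0 1 := by
      ext x
      simp [Valued.integer.mem_iff]
    have h : IsCompact {x : F | x ∈ 𝒪[F]} := e ▸ isCompact_closedBall 0 1
    exact isCompact_iff_compactSpace.1 h
  have : (Valued.v : Valuation F NNReal).RankOne :=
    inferInstanceAs (NormedField.valuation (K := F)).RankOne
  have hf : Finite 𝓀[F] :=
    (Valued.integer.compactSpace_iff_completeSpace_and_isDiscreteValuationRing_and_finite_residueField.1
      hc).2.2
  exact Nat.card_pos

/-- `σ` acts on the residue field of the separable closure of `F` as `x ↦ x ^ (q ^ n)`, where the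
integer `n` may be negative. -/
def ActsAsFrobPow (σ : Gal(SeparableClosure F/F)) (n : ℤ) : Prop :=
  ∃ a b : ℕ, (a : ℤ) - b = n ∧ ∀ x : SeparableClosure F,
    spectralNorm F (SeparableClosure F) x ≤ 1 →
      spectralNorm F (SeparableClosure F)
        ((σ x) ^ (resCard F ^ b) - x ^ (resCard F ^ a)) < 1

variable {F}

theorem spectralNorm_pow_sub_pow_lt_one {x y : SeparableClosure F}
    (hx : spectralNorm F (SeparableClosure F) x ≤ 1)
    (hy : spectralNorm F (SeparableClosure F) y ≤ 1)
    (h : spectralNorm F (SeparableClosure F) (x - y) < 1) (k : ℕ) :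
    spectralNorm F (SeparableClosure F) (x ^ k - y ^ k) < 1 := by
  have hpow : ∀ n : ℕ, spectralNorm F (SeparableClosure F) (y ^ n) ≤ 1 := by
    intro n
    rcases Nat.eq_zero_or_pos n with rfl | hn
    · rw [pow_zero, spectralNorm_one]
    · rw [isPowMul_spectralNorm y hn]
      exact pow_le_one₀ (spectralNorm_nonneg _) hy
  have alg : ∀ z : SeparableClosure F, IsAlgebraic F z := Algebra.IsAlgebraic.isAlgebraic
  induction k with
  | zero => simp [spectralNorm_zero]
  | succ k ih =>
    have e : x ^ (k + 1) - y ^ (k + 1) = x * (x ^ k - y ^ k) + (x - y) * y ^ k := by ring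
    rw [e]
    refine (isNonarchimedean_spectralNorm _ _).trans_lt (max_lt ?_ ?_)
    · exact (spectralNorm_mul (alg _) (alg _)).trans_lt
        ((mul_le_of_le_one_left (spectralNorm_nonneg _) hx).trans_lt ih)
    · exact (spectralNorm_mul (alg _) (alg _)).trans_lt
        ((mul_le_of_le_one_right (spectralNorm_nonneg _) (hpow k)).trans_lt h)

theorem spectralNorm_pow_le_one {x : SeparableClosure F}
    (hx : spectralNorm F (SeparableClosure F) x ≤ 1) (n : ℕ) :
    spectralNorm F (SeparableClosure F) (x ^ n) ≤ 1 := by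
  rcases Nat.eq_zero_or_pos n with rfl | hn
  · rw [pow_zero, spectralNorm_one]
  · rw [isPowMul_spectralNorm x hn]
    exact pow_le_one₀ (spectralNorm_nonneg _) hx

theorem ActsAsFrobPow.one : ActsAsFrobPow F 1 0 :=
  ⟨0, 0, by simp, fun x _ => by simp [spectralNorm_zero]⟩

theorem ActsAsFrobPow.mul {σ τ : Gal(SeparableClosure F/F)} {m n : ℤ}
    (hσ : ActsAsFrobPow F σ m) (hτ : ActsAsFrobPow F τ n) : ActsAsFrobPow F (σ * τ) (m + n) := by
  obtain ⟨a, b, rfl, h⟩ := hσ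
  obtain ⟨c, d, rfl, k⟩ := hτ
  refine ⟨a + c, b + d, by push_cast; ring, fun x hx => ?_⟩
  have hτx : spectralNorm F (SeparableClosure F) (τ x) ≤ 1 := by
    rwa [← spectralNorm_eq_of_equiv]
  have hστx : spectralNorm F (SeparableClosure F) (σ (τ x)) ≤ 1 := by
    rwa [← spectralNorm_eq_of_equiv]
  have h1 := spectralNorm_pow_sub_pow_lt_one (spectralNorm_pow_le_one hστx _)
    (spectralNorm_pow_le_one hτx _) (h _ hτx) (resCard F ^ d)
  have h2 := spectralNorm_pow_sub_pow_lt_one (spectralNorm_pow_le_one hτx _)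
    (spectralNorm_pow_le_one hx _) (k _ hx) (resCard F ^ a)
  have e : ((σ * τ) x) ^ (resCard F ^ (b + d)) - x ^ (resCard F ^ (a + c)) =
      (((σ (τ x)) ^ (resCard F ^ b)) ^ (resCard F ^ d) -
        ((τ x) ^ (resCard F ^ a)) ^ (resCard F ^ d)) +
      (((τ x) ^ (resCard F ^ d)) ^ (resCard F ^ a) -
        (x ^ (resCard F ^ c)) ^ (resCard F ^ a)) := by
    rw [AlgEquiv.mul_apply]
    simp only [← pow_mul, ← pow_add]
    rw [add_comm a d, add_comm a c, pow_add (resCard F) d a, mul_comm (resCard F ^ d),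
      sub_add_sub_cancel]
  rw [e]
  exact (isNonarchimedean_spectralNorm _ _).trans_lt (max_lt h1 h2)

theorem ActsAsFrobPow.inv {σ : Gal(SeparableClosure F/F)} {n : ℤ} (hσ : ActsAsFrobPow F σ n) :
    ActsAsFrobPow F σ⁻¹ (-n) := by
  obtain ⟨a, b, rfl, h⟩ := hσ
  refine ⟨b, a, by ring, fun x hx => ?_⟩
  have h' := h (σ⁻¹ x) (by rwa [← spectralNorm_eq_of_equiv])
  have e : σ (σ⁻¹ x) = x := by rw [← AlgEquiv.mul_apply, mul_inv_cancel, AlgEquiv.one_apply]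
  rw [e, ← neg_sub, spectralNorm_neg (Algebra.IsAlgebraic.isAlgebraic _)] at h'
  exact h'

variable (F)

/-- The Weil group `W_F`: the group of all `(σ, n)` with `σ` in the absolute Galois group and `n` an
integer such that `σ` acts on the residue field as the `n`-th power of the Frobenius.  As `n` is
determined by `σ`, this is the usual subgroup of the Galois group; its topology, from the Krull
topology and the discrete topology of `ℤ`, is the one in which the inertia subgroup, with the Krull
topology, is open. -/
def WeilGroup : Subgroup (Gal(SeparableClosure F/F) × Multiplicative ℤ) where
  carrier := {w | ActsAsFrobPow F w.1 w.2.toAdd}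
  one_mem' := ActsAsFrobPow.one
  mul_mem' := fun hv hw => ActsAsFrobPow.mul hv hw
  inv_mem' := fun hw => ActsAsFrobPow.inv hw

/-- The valuation `ord : W_F → ℤ`, equal to `1` on Frobenius elements and with kernel the inertia
subgroup. -/
def weilOrd : WeilGroup F →* Multiplicative ℤ :=
  (MonoidHom.snd _ _).comp (WeilGroup F).subtype

variable {F}

/-- The exponent of `w` as an integer. -/
def ord (w : WeilGroup F) : ℤ := (weilOrd F w).toAdd

/-- The norm `|w| = q ^ ord w` on the Weil group. -/
def weilNorm (w : WeilGroup F) : ℝ := (resCard F : ℝ) ^ ord w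

variable [LocallyCompactSpace F]

theorem weilNorm_pos (w : WeilGroup F) : 0 < weilNorm w :=
  zpow_pos (Nat.cast_pos.2 (resCard_pos F)) _

/-- The element `diag(|w|^{1/2}, |w|^{-1/2})` of `SL₂(ℂ)`. -/
def normDiag (w : WeilGroup F) : SpecialLinearGroup (Fin 2) ℂ :=
  ⟨diagonal ![((weilNorm w ^ (1 / 2 : ℝ) : ℝ) : ℂ), ((weilNorm w ^ (-1 / 2 : ℝ) : ℝ) : ℂ)], by
    rw [Matrix.det_diagonal, Fin.prod_univ_two]
    simp only [Matrix.cons_val_zero, Matrix.cons_val_one]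
    rw [← Complex.ofReal_mul, ← Real.rpow_add (weilNorm_pos w)]
    norm_num⟩

variable (F) in
/-- The complex number `u q^a` with polar part `u` and absolute value `q ^ a`. -/
def qpolar (u : Circle) (a : ℝ) : ℂˣ :=
  Circle.toUnits u * Units.mk0 (((resCard F : ℝ) ^ a : ℝ) : ℂ)
    (Complex.ofReal_ne_zero.2 (Real.rpow_pos_of_pos (Nat.cast_pos.2 (resCard_pos F)) a).ne')

theorem qpolar_mul (u v : Circle) (a b : ℝ) :
    qpolar F u a * qpolar F v b = qpolar F (u * v) (a + b) := by
  ext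
  simp only [qpolar, Units.val_mul, Units.val_mk0, map_mul]
  rw [Real.rpow_add (Nat.cast_pos.2 (resCard_pos F)), Complex.ofReal_mul]
  ring

theorem qpolar_one : qpolar F 1 0 = 1 := by
  ext
  simp [qpolar]

theorem qpolar_pow (u : Circle) (a : ℝ) (n : ℕ) :
    qpolar F u a ^ n = qpolar F (u ^ n) (n * a) := by
  induction n with
  | zero => simp [qpolar_one]
  | succ n ih =>
    rw [pow_succ, ih, qpolar_mul, pow_succ]
    congr 1
    push_cast
    ring

end Weil

/-! ### Langlands parameters and Arthur parameters -/

section Parameters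

/-- A Langlands parameter of the split group `G₂` over `F`: a homomorphism
`W_F × SL₂(ℂ) → Ĝ₂` that is continuous and semisimple on `W_F` and algebraic on `SL₂(ℂ)`. -/
structure LanglandsParameter (F : Type*) [NontriviallyNormedField F] [IsUltrametricDist F] where
  /-- the underlying homomorphism -/
  toHom : WeilGroup F × SpecialLinearGroup (Fin 2) ℂ →* G2
  continuous_weil : Continuous fun w : WeilGroup F => toHom (w, 1)
  semisimple : ∀ w : WeilGroup F, IsSemisimpleElt (toHom (w, 1))
  algebraic : IsAlgebraicHom (toHom.comp (MonoidHom.inr _ _))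

/-- An Arthur parameter of the split group `G₂` over `F`: a homomorphism
`W_F × SL₂(ℂ) × SL₂(ℂ) → Ĝ₂` that is continuous, semisimple and bounded on `W_F` and algebraic on
both factors `SL₂(ℂ)`. -/
structure ArthurParameter (F : Type*) [NontriviallyNormedField F] [IsUltrametricDist F] where
  /-- the underlying homomorphism -/
  toHom : WeilGroup F × SpecialLinearGroup (Fin 2) ℂ × SpecialLinearGroup (Fin 2) ℂ →* G2
  continuous_weil : Continuous fun w : WeilGroup F => toHom (w, 1, 1)
  semisimple : ∀ w : WeilGroup F, IsSemisimpleElt (toHom (w, 1, 1))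
  bounded : ∃ C : ℝ, ∀ (w : WeilGroup F) (i j : Fin 7), ‖mat (toHom (w, 1, 1)) i j‖ ≤ C
  algebraic_left : IsAlgebraicHom
    (toHom.comp ((MonoidHom.inr _ _).comp (MonoidHom.inl _ _)))
  algebraic_right : IsAlgebraicHom
    (toHom.comp ((MonoidHom.inr _ _).comp (MonoidHom.inr _ _)))

variable {F : Type*} [NontriviallyNormedField F] [IsUltrametricDist F]

/-- A Langlands parameter is unramified if it is trivial on the inertia subgroup. -/
def LanglandsParameter.IsUnramified (φ : LanglandsParameter F) : Prop :=
  ∀ w : WeilGroup F, ord w = 0 → φ.toHom (w, 1) = 1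

/-- Two Langlands parameters are equivalent if they are conjugate under `Ĝ₂`. -/
def LanglandsParameter.IsConj (φ φ' : LanglandsParameter F) : Prop :=
  ∃ g : G2, ∀ p, φ'.toHom p = g * φ.toHom p * g⁻¹

/-- A Langlands parameter `φ` is of Arthur type if there is an Arthur parameter `ψ` with
`φ(w, x) = ψ(w, x, diag(|w|^{1/2}, |w|^{-1/2}))`. -/
def LanglandsParameter.IsArthurType [LocallyCompactSpace F] (φ : LanglandsParameter F) : Prop :=
  ∃ ψ : ArthurParameter F, ∀ (w : WeilGroup F) (x : SpecialLinearGroup (Fin 2) ℂ),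
    φ.toHom (w, x) = ψ.toHom (w, x, normDiag w)

theorem continuous_weilOrd : Continuous (weilOrd F) :=
  continuous_snd.comp continuous_subtype_val

theorem ord_one : ord (1 : WeilGroup F) = 0 := rfl

theorem ord_mul (v w : WeilGroup F) : ord (v * w) = ord v + ord w := rfl

theorem mHat_semisimple (z : ℂˣ × ℂˣ) : IsSemisimpleElt (mHat z) :=
  ⟨1, by
    rw [one_mul, inv_one, mul_one]
    exact Matrix.isDiag_diagonal (torusWeights z)⟩

/-- The Langlands parameter `φ(w, x) = m̂(z)^{ord w} ι(x)`, where `m̂(z)` commutes with the image of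
`ι`.  For `z = (u₁ q^a₁, u₂ q^a₂)` it is
`φ(w, x) = m̂(u₁^{ord w}, u₂^{ord w}) m̂(|w|^a₁, |w|^a₂) ι(x)`. -/
def ofTorus (z : ℂˣ × ℂˣ) (ι : SpecialLinearGroup (Fin 2) ℂ →* G2) (hι : IsAlgebraicHom ι)
    (hz : ∀ x, Commute (mHat z) (ι x)) : LanglandsParameter F where
  toHom :=
    { toFun := fun p => mHat z ^ ord p.1 * ι p.2
      map_one' := by
        rw [Prod.fst_one, Prod.snd_one, ord_one, zpow_zero, map_one, one_mul]
      map_mul' := fun p p' => by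
        rw [Prod.fst_mul, Prod.snd_mul, ord_mul, _root_.zpow_add, map_mul, mul_assoc, mul_assoc,
          ← mul_assoc (ι p.2), ← ((hz p.2).zpow_left (ord p'.1)).eq, mul_assoc] }
  continuous_weil := by
    have h : Continuous fun n : Multiplicative ℤ => mHat z ^ n.toAdd * ι 1 :=
      continuous_of_discreteTopology
    exact h.comp continuous_weilOrd
  semisimple w := by
    have h : IsSemisimpleElt (mHat z ^ ord w * ι 1) := by
      rw [map_one, mul_one, ← map_zpow]
      exact mHat_semisimple _
    exact h
  algebraic := fun i j => by
    have e : (fun x => mat (ι x) i j) =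
        fun x => mat (mHat z ^ ord (1 : WeilGroup F) * ι x) i j := by
      ext x
      rw [ord_one, zpow_zero, one_mul]
    have h := hι i j
    rw [e] at h
    exact h

theorem commute_of_mat {z : ℂˣ × ℂˣ} {g : G2}
    (h : diagonal (torusWeights z) * mat g = mat g * diagonal (torusWeights z)) :
    Commute (mHat z) g :=
  mat_injective h

variable [LocallyCompactSpace F]

/-! ### The list of unramified parameters -/

/-- The set of all (positive or negative) roots `γ̂` with `γ̂(m̂(z)) = q`. -/
def qRoots (F : Type*) [NontriviallyNormedField F] [IsUltrametricDist F] (z : ℂˣ × ℂˣ) :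
    Set (ℤ × ℤ) :=
  {γ | γ ∈ roots ∧ (rootValue γ z : ℂ) = resCard F}

/-- The indices of the unramified parameters in the list, with the data on which they depend.  In
the cases `0`, `1`, `2` the image `λ(Fr)` of a Frobenius element under the infinitesimal parameter
is `m̂(u₁ q^a₁, u₂ q^a₂)`, `m̂(q, u q^a)`, `m̂(u q^a, u⁻¹ q^(1 - a))`, and the case is determined by
the set of all roots that take the value `q` at `λ(Fr)`: this set is empty, `{γ̂₁ + 2 γ̂₂}`,
`{2 γ̂₁ + 3 γ̂₂}` respectively. -/
inductive ParamIndex (F : Type*) [NontriviallyNormedField F] [IsUltrametricDist F]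
    [LocallyCompactSpace F] : Type
  | i0 (u₁ u₂ : Circle) (a₁ a₂ : ℝ) (h : qRoots F (qpolar F u₁ a₁, qpolar F u₂ a₂) = ∅)
  | i1a (u : Circle) (a : ℝ) (h : qRoots F (qpolar F 1 1, qpolar F u a) = {(1, 2)})
  | i1b (u : Circle) (a : ℝ) (h : qRoots F (qpolar F 1 1, qpolar F u a) = {(1, 2)})
  | i2a (u : Circle) (a : ℝ) (h : qRoots F (qpolar F u a, qpolar F u⁻¹ (1 - a)) = {(2, 3)})
  | i2b (u : Circle) (a : ℝ) (h : qRoots F (qpolar F u a, qpolar F u⁻¹ (1 - a)) = {(2, 3)})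
  | i3a (n : Fin 3)
  | i3b (n : Fin 3)
  | i4a | i4b | i4c | i4d
  | i5a | i5b
  | i6a | i6b | i6c | i6d
  | i7a | i7b | i7c | i7d
  | i8a | i8b | i8c | i8d

theorem qpolar_eq {u v : Circle} {a b : ℝ} (h : u = v) (h' : a = b) :
    qpolar F u a = qpolar F v b := by
  rw [h, h']

theorem qpolar_inv (u : Circle) (a : ℝ) : (qpolar F u a)⁻¹ = qpolar F u⁻¹ (-a) := by
  rw [inv_eq_iff_mul_eq_one, qpolar_mul, mul_inv_cancel, add_neg_cancel, qpolar_one]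

/-- A parameter that is trivial on `SL₂(ℂ)`. -/
def param1 (z : ℂˣ × ℂˣ) : LanglandsParameter F :=
  ofTorus z 1 trivial_algebraic fun _ => Commute.one_right _

/-- The parameter `m̂(z)^{ord w} ι_γ̂₁(x)`. -/
def param10 (z : ℂˣ × ℂˣ) (h : z.1 = z.2 ^ 2) : LanglandsParameter F :=
  ofTorus z iota10 M10_reg fun x => commute_of_mat (M10_comm h x.1)

/-- The parameter `m̂(z)^{ord w} ι_{γ̂₁ + 3 γ̂₂}(x)`. -/
def param13 (z : ℂˣ × ℂˣ) (h : z.2 = z.1 ^ 2) : LanglandsParameter F :=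
  ofTorus z iota13 M13_reg fun x => commute_of_mat (M13_comm h x.1)

/-- The parameter `m̂(z)^{ord w} ι_{2 γ̂₁ + 3 γ̂₂}(x)`. -/
def param23 (z : ℂˣ × ℂˣ) (h : z.2 = z.1⁻¹) : LanglandsParameter F :=
  ofTorus z iota23 M23_reg fun x => commute_of_mat (M23_comm h x.1)

/-- The parameter `m̂(z)^{ord w} ι_γ̂₂(x)`. -/
def param01 (z : ℂˣ × ℂˣ) (h : z.1 = z.2) : LanglandsParameter F :=
  ofTorus z iota01 M01_reg fun x => commute_of_mat (M01_comm h x.1)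

/-- The parameter `m̂(z)^{ord w} ι_{γ̂₁ + 2 γ̂₂}(x)`. -/
def param12 (z : ℂˣ × ℂˣ) (h : z.1 = 1) : LanglandsParameter F :=
  ofTorus z iota12 M12_reg fun x => commute_of_mat (M12_comm h x.1)

/-- The parameter `m̂(z)^{ord w} ι_γ̂₁(x) ι_{γ̂₁ + 2 γ̂₂}(x)`. -/
def paramD2 (z : ℂˣ × ℂˣ) (h : z.1 = z.2 ^ 2) (h' : z.1 = 1) : LanglandsParameter F :=
  ofTorus z iotaD2 iotaD2_algebraic fun x =>
    (commute_of_mat (g := iota10 x) (M10_comm h x.1)).mul_right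
      (commute_of_mat (g := iota12 x) (M12_comm h' x.1))

/-- The unramified parameters of the list; `θ₃` is a fixed primitive cube root of unity. -/
def ParamIndex.param (θ₃ : Circle) (hθ₃ : IsPrimitiveRoot θ₃ 3) :
    ParamIndex F → LanglandsParameter F
  | i0 u₁ u₂ a₁ a₂ _ => param1 (qpolar F u₁ a₁, qpolar F u₂ a₂)
  | i1a u a _ => param1 (qpolar F 1 1, qpolar F u a)
  | i1b u a _ => param12 (1, qpolar F u (a - 1 / 2)) rfl
  | i2a u a _ => param1 (qpolar F u a, qpolar F u⁻¹ (1 - a))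
  | i2b u a _ => param23 (qpolar F u (a - 1 / 2), qpolar F u⁻¹ (1 / 2 - a)) (by
      rw [qpolar_inv]; exact qpolar_eq rfl (by ring))
  | i3a n => param1 (qpolar F (θ₃ ^ n.val) (1 / 3), qpolar F ((θ₃ ^ n.val) ^ 2) (2 / 3))
  | i3b n => param10 (qpolar F (θ₃ ^ n.val) (1 / 3), qpolar F ((θ₃ ^ n.val) ^ 2) (1 / 6)) (by
      rw [qpolar_pow]
      refine qpolar_eq ?_ (by norm_num)
      rw [← pow_mul, ← pow_mul, show n.val * (2 * 2) = n.val + 3 * n.val by ring,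
        pow_add, pow_mul θ₃ 3, hθ₃.pow_eq_one, one_pow, mul_one])
  | i4a => param1 (qpolar F 1 1, qpolar F (-1) 1)
  | i4b => param10 (qpolar F 1 1, qpolar F (-1) (1 / 2)) (by
      rw [qpolar_pow]; exact qpolar_eq (by simp) (by norm_num))
  | i4c => param12 (1, qpolar F (-1) (1 / 2)) rfl
  | i4d => paramD2 (1, qpolar F (-1) 0) (by
      rw [qpolar_pow, ← qpolar_one (F := F)]; exact qpolar_eq (by simp) (by norm_num)) rfl
  | i5a => param1 (qpolar F 1 2, qpolar F 1 1)
  | i5b => param01 (qpolar F 1 (3 / 2), qpolar F 1 (3 / 2)) rfl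
  | i6a => param1 (qpolar F θ₃ 1, qpolar F (θ₃ ^ 2) 1)
  | i6b => param10 (qpolar F θ₃ 1, qpolar F (θ₃ ^ 2) (1 / 2)) (by
      rw [qpolar_pow]
      refine qpolar_eq ?_ (by norm_num)
      rw [← pow_mul, show 2 * 2 = 3 + 1 from rfl, pow_succ, hθ₃.pow_eq_one, one_mul])
  | i6c => param13 (qpolar F θ₃ (1 / 2), qpolar F (θ₃ ^ 2) 1) (by
      rw [qpolar_pow]; exact qpolar_eq rfl (by norm_num))
  | i6d => ofTorus (qpolar F θ₃ 0, qpolar F (θ₃ ^ 2) 0) iotaA2 MA2_reg fun x =>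
      commute_of_mat (MA2_comm
        (by rw [qpolar_pow]; exact qpolar_eq rfl (by norm_num))
        (by rw [qpolar_pow, hθ₃.pow_eq_one, mul_zero, qpolar_one]) x.1)
  | i7a => param1 (qpolar F 1 3, qpolar F 1 2)
  | i7b => param10 (qpolar F 1 3, qpolar F 1 (3 / 2)) (by
      rw [qpolar_pow]; exact qpolar_eq (by simp) (by norm_num))
  | i7c => param01 (qpolar F 1 (5 / 2), qpolar F 1 (5 / 2)) rfl
  | i7d => ofTorus 1 iotaReg symSix_reg fun x => by rw [map_one]; exact Commute.one_left _
  | i8a => param1 (qpolar F 1 1, qpolar F 1 1)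
  | i8b => param10 (qpolar F 1 1, qpolar F 1 (1 / 2)) (by
      rw [qpolar_pow]; exact qpolar_eq (by simp) (by norm_num))
  | i8c => param12 (1, qpolar F 1 (1 / 2)) rfl
  | i8d => paramD2 1 (one_pow 2).symm rfl

/-- The condition, on the data, for the parameter to be of Arthur type: the unramified parameter
`param r` is claimed to be of Arthur type exactly under this condition. -/
def ParamIndex.arthurCondition : ParamIndex F → Prop
  | i0 _ _ a₁ a₂ _ => a₁ = 0 ∧ a₂ = 0
  | i1a _ a _ => a = 1 / 2
  | i1b _ a _ => a = 1 / 2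
  | i2a _ a _ => a = 1 / 2
  | i2b _ a _ => a = 1 / 2
  | i3a _ => False
  | i3b _ => False
  | i4a => True
  | i4b => True
  | i4c => True
  | i4d => True
  | i5a => False
  | i5b => False
  | i6a => True
  | i6b => False
  | i6c => False
  | i6d => True
  | i7a => True
  | i7b => False
  | i7c => False
  | i7d => True
  | i8a => True
  | i8b => True
  | i8c => True
  | i8d => True

end Parameters

end

end G2Arthur

/-! An unramified parameter amounts to a commuting pair: the semisimple image s of a Frobenius
element (one exists by `exists_ord_eq_one`) and an algebraic homomorphism ρ from SL₂. The
classification of such pairs up to conjugacy, `exists_pairConj_of_commute`, uses only linear algebra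
on the seven-dimensional space.

The double commutator determines the norm form (`bracket_bracket`), so every element of the group is
orthogonal. A semisimple element fixes a vector of norm one, the group is transitive on such
vectors, and the part SL₃ of their stabilizer diagonalizes the element; this is `exists_conj_mHat`.
Applied to s ρ(diag(t₀, t₀⁻¹)) with t₀ large enough to separate weights, it puts s and the diagonal
torus of SL₂ into the maximal torus simultaneously (`exists_conj_torus`). Then ρ has a cocharacter
(a, b), which the Weyl group moves into a closed chamber. The differential of ρ is an sl₂-triple in
the fourteen-dimensional Lie algebra written out in `derivMat`, with entries only at roots of weight
±2. The sl₂ relations leave five cocharacters (`HasCocharacter.eq_of_chamber`), one for each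
nilpotent orbit, and conjugation by the torus normalizes the root vectors. For the cocharacter (2,
2) the raising operator is a binary cubic under the group of γ̂₂, and s decides whether the normal
form is `iotaD2` or `iotaA2`.

The remaining element of the torus is matched with the list by means of the roots with value q at
the infinitesimal Frobenius: either only the expected root occurs, or the pair is a Weyl conjugate
of one of finitely many exceptional members.

For Arthur type, sufficiency is a construction (`isArthurType_of_commute`): m̂(z) is a unitary torus
element times ι'(diag(q^{1/2}, q^{-1/2})) for some ι' commuting with ι and with the unitary part.
For necessity, boundedness forces the Frobenius to act with eigenvalues of absolute value one, so
the absolute values of the eigenvalues of m̂(z) are those contributed by the second SL₂. Hence for z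
= (u q^a, v q^b) its cocharacter is (2a, 2b), and its raising operator lies in root spaces with
value q at the infinitesimal Frobenius, value 1 at (u, v), and weight 0 for the first SL₂
(`LanglandsParameter.IsArthurType.exists_hasCocharacter`). Every excluded case violates integrality,
the list of five cocharacters, or one of these conditions on roots. -/

namespace G2Arthur

noncomputable section

/-! ### Existence of a Frobenius element in the Weil group -/

section Frob
variable (F : Type*) [NontriviallyNormedField F] [IsUltrametricDist F] [LocallyCompactSpace F]

theorem resField_finite : Finite 𝓀[F] :=
  Nat.finite_of_card_ne_zero (resCard_pos F).ne'

theorem one_lt_resCard : 1 < resCard F := by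
  have := resField_finite F
  exact Finite.one_lt_card

local notation "L" => SeparableClosure F
local notation "S" => integralClosure 𝒪[F] (SeparableClosure F)

variable {F}
omit [LocallyCompactSpace F] in
-- Both sides say that the minimal polynomial of x over F has coefficients in 𝒪[F]: for integrality
-- because 𝒪[F] is integrally closed, for the spectral norm by its definition through these
-- coefficients.
theorem mem_integralClosure_iff (x : L) : x ∈ S ↔ spectralNorm F L x ≤ 1 := by
  have hx : IsIntegral F x := Algebra.IsIntegral.isIntegral x
  have hc : (minpoly F x).Monic := minpoly.monic hx
  rw [spectralNorm, spectralValue_le_one_iff hc]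
  constructor
  · intro h n
    have h' : IsIntegral 𝒪[F] x := h
    rw [minpoly.isIntegrallyClosed_eq_field_fractions' F h', Polynomial.coeff_map]
    have := ((minpoly 𝒪[F] x).coeff n).2
    exact (Valued.integer.mem_iff).1 this
  · intro h
    have hl : minpoly F x ∈ Polynomial.lifts (algebraMap 𝒪[F] F) := by
      rw [Polynomial.lifts_iff_coeff_lifts]
      intro n
      exact ⟨⟨_, (Valued.integer.mem_iff).2 (h n)⟩, rfl⟩
    obtain ⟨p, hp, -, hm⟩ := Polynomial.lifts_and_natDegree_eq_and_monic hl hc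
    refine ⟨p, hm, ?_⟩
    have := minpoly.aeval F x
    rw [← hp, Polynomial.aeval_map_algebraMap] at this
    exact this

variable (F)

/-- The ideal of the elements of norm less than one. -/
def normIdeal : Ideal S where
  carrier := {x | spectralNorm F L (x : L) < 1}
  add_mem' := fun {a b} ha hb =>
    (isNonarchimedean_spectralNorm _ _).trans_lt (max_lt ha hb)
  zero_mem' := by simp [spectralNorm_zero]
  smul_mem' := fun c x hx => (spectralNorm_mul (Algebra.IsAlgebraic.isAlgebraic _)
    (Algebra.IsAlgebraic.isAlgebraic _)).trans_lt
      ((mul_le_of_le_one_left (spectralNorm_nonneg _) ((mem_integralClosure_iff _).1 c.2)).trans_lt hx)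

omit [LocallyCompactSpace F] in
theorem mem_normIdeal (x : S) : x ∈ normIdeal F ↔ spectralNorm F L (x : L) < 1 := Iff.rfl

instance : (normIdeal F).IsPrime := by
  have : ProperSpace F := ProperSpace.of_locallyCompactSpace F
  refine ⟨?_, ?_⟩
  · rw [Ne, Ideal.eq_top_iff_one, mem_normIdeal]
    simp [spectralNorm_one]
  · intro x y h
    by_contra! hn
    rw [mem_normIdeal, mem_normIdeal, not_lt, not_lt] at hn
    have h' : spectralNorm F L ((x : L) * y) < 1 := h
    rw [← spectralAlgNorm_def, spectralAlgNorm_mul, spectralAlgNorm_def, spectralAlgNorm_def] at h'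
    nlinarith [hn.1, hn.2]

instance : (normIdeal F).LiesOver (IsLocalRing.maximalIdeal 𝒪[F]) := by
  constructor
  ext x
  rw [Ideal.mem_comap, mem_normIdeal]
  have e : ((algebraMap 𝒪[F] S x : S) : L) = algebraMap F L x := rfl
  rw [e, spectralNorm_extends, IsLocalRing.mem_maximalIdeal, mem_nonunits_iff,
    Valued.integer.isUnit_iff_norm_eq_one]
  have := Valued.integer.norm_le_one x
  constructor
  · intro h; exact lt_of_le_of_ne this h
  · intro h; exact ne_of_lt h

/-- Galois theory puts a fixed element in F, and the spectral norm extends the norm of F, so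
integrality descends. -/
instance : Algebra.IsInvariant 𝒪[F] S Gal(L/F) := by
  constructor
  intro b hb
  obtain ⟨a, ha⟩ := (InfiniteGalois.mem_range_algebraMap_iff_fixed (k := F) (b : L)).2
    fun g => congrArg Subtype.val (hb g)
  refine ⟨⟨a, ?_⟩, Subtype.ext ha⟩
  have := (mem_integralClosure_iff _).1 b.2
  rw [← ha, spectralNorm_extends] at this
  exact (Valued.integer.mem_iff).2 this

open scoped Pointwise in
-- For a profinite group acting continuously on the discrete ring S, the stabilizer of a prime
-- surjects onto the automorphisms of the residue extension. A preimage of the residual Frobenius is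
-- taken.
theorem exists_arithFrob : ∃ σ : Gal(L/F), ActsAsFrobPow F σ 1 := by
  have hfin : Finite (𝒪[F] ⧸ IsLocalRing.maximalIdeal 𝒪[F]) := resField_finite F
  let Q := normIdeal F
  let P := IsLocalRing.maximalIdeal 𝒪[F]
  let _ : TopologicalSpace S := ⊥
  have : DiscreteTopology S := ⟨rfl⟩
  -- Orbit maps are locally constant, since the stabilizer of an element of the separable closure is
  -- open.
  have : ContinuousSMul Gal(L/F) S := by
    refine ⟨?_⟩
    rw [continuous_prod_of_discrete_right]
    intro b
    rw [continuous_discrete_rng]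
    intro c
    rw [isOpen_iff_forall_mem_open]
    intro g hg
    refine ⟨g • (MulAction.stabilizer Gal(L/F) (b : L) : Set Gal(L/F)), ?_,
      (stabilizer_isOpen_of_isIntegral (b : L)).leftCoset g,
      ⟨1, one_mem _, mul_one g⟩⟩
    rintro _ ⟨h, hh, rfl⟩
    rw [← (show g • b = c from hg)]
    refine Subtype.ext ?_
    exact congrArg g hh
  have hint := Algebra.IsInvariant.isIntegral_of_profinite (A := 𝒪[F]) (B := S) (G := Gal(L/F))
  let _ : Field (𝒪[F] ⧸ P) := Ideal.Quotient.field P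
  have hQ : Q.IsMaximal := Ideal.isMaximal_of_isIntegral_of_isMaximal_comap (R := 𝒪[F]) Q (by
     have h := Ideal.LiesOver.over (P := Q) (p := P)
     rw [Ideal.under_def] at h
     rw [← h]
     infer_instance)
  let _ : Field (S ⧸ Q) := Ideal.Quotient.field Q
  obtain ⟨p, hc⟩ := CharP.exists (𝒪[F] ⧸ P)
  cases nonempty_fintype (𝒪[F] ⧸ P)
  obtain ⟨k, hp, hk⟩ := FiniteField.card (𝒪[F] ⧸ P) p
  have := CharP.of_ringHom_of_ne_zero (algebraMap (𝒪[F] ⧸ P) (S ⧸ Q)) p hp.ne_zero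
  have : ExpChar (S ⧸ Q) p := .prime hp
  have : Algebra.IsIntegral (𝒪[F] ⧸ P) (S ⧸ Q) := inferInstance
  have : Algebra.IsAlgebraic (𝒪[F] ⧸ P) (S ⧸ Q) :=
    ⟨fun x => (Algebra.IsIntegral.isIntegral x).isAlgebraic⟩
  -- Perfectness makes the p^k-th power map bijective, hence an automorphism over the finite residue
  -- field of cardinality p^k.
  have : PerfectField (S ⧸ Q) := Algebra.IsAlgebraic.perfectField (𝒪[F] ⧸ P)
  let l : (S ⧸ Q) ≃ₐ[𝒪[F] ⧸ P] S ⧸ Q :=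
    { __ := iterateFrobeniusEquiv (S ⧸ Q) p k,
      commutes' r := by
        dsimp [iterateFrobenius_def]
        rw [← map_pow, ← hk, FiniteField.pow_card] }
  obtain ⟨σ, hσ⟩ := Ideal.Quotient.stabilizerHom_surjective_of_profinite (G := Gal(L/F)) P Q l
  refine ⟨σ, 1, 0, by simp, fun x hx => ?_⟩
  let y : S := ⟨x, (mem_integralClosure_iff _).2 hx⟩
  have h : Ideal.Quotient.mk Q (σ.1 • y) = Ideal.Quotient.mk Q y ^ (p ^ (k : ℕ)) :=
    DFunLike.congr_fun hσ (Ideal.Quotient.mk Q y)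
  rw [← map_pow] at h
  have h2 := Ideal.Quotient.eq.1 h
  have h3 : spectralNorm F L (σ.1 x - x ^ (p ^ (k : ℕ))) < 1 := h2
  have e : resCard F = p ^ (k : ℕ) := by
    rw [← hk, ← Nat.card_eq_fintype_card]; rfl
  rw [e, pow_zero, pow_one, pow_one]
  exact h3

theorem exists_ord_eq_one : ∃ w : WeilGroup F, ord w = 1 := by
  obtain ⟨σ, hσ⟩ := exists_arithFrob F
  exact ⟨⟨(σ, Multiplicative.ofAdd 1), hσ⟩, rfl⟩
end Frob

end

noncomputable section

/-! ### The quadratic form and transitivity -/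

/-- The norm form on trace zero split octonions. -/
def quad (X : Fin 7 → ℂ) : ℂ := X 3 ^ 2 + X 0 * X 6 + X 1 * X 5 + X 2 * X 4

/-- The polarization of the norm form. -/
def polar (X Y : Fin 7 → ℂ) : ℂ :=
  2 * X 3 * Y 3 + X 0 * Y 6 + X 6 * Y 0 + X 1 * Y 5 + X 5 * Y 1 + X 2 * Y 4 + X 4 * Y 2

/-- An octonion identity that expresses the norm form through the commutator alone. It makes
automorphisms of the commutator orthogonal and lets vanishing commutators be exploited. -/
theorem bracket_bracket (X Y : Fin 7 → ℂ) :
    bracket X (bracket X Y) = (4 * quad X) • Y - (2 * polar X Y) • X := by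
  rw [bracket_eq, bracket_eq]
  ext i
  fin_cases i <;> simp [quad, polar] <;> ring

theorem bracket_smul_left (c : ℂ) (X Y : Fin 7 → ℂ) : bracket (c • X) Y = c • bracket X Y := by
  rw [bracket_eq, bracket_eq]
  ext i
  fin_cases i <;> simp <;> ring

theorem bracket_smul_right (c : ℂ) (X Y : Fin 7 → ℂ) : bracket X (c • Y) = c • bracket X Y := by
  rw [bracket_eq, bracket_eq]
  ext i
  fin_cases i <;> simp <;> ring

theorem bracket_add_right (X Y Z : Fin 7 → ℂ) :
    bracket X (Y + Z) = bracket X Y + bracket X Z := by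
  rw [bracket_eq, bracket_eq, bracket_eq]
  ext i
  fin_cases i <;> simp <;> ring

theorem bracket_add_left (X Y Z : Fin 7 → ℂ) :
    bracket (X + Y) Z = bracket X Z + bracket Y Z := by
  rw [bracket_eq, bracket_eq, bracket_eq]
  ext i
  fin_cases i <;> simp <;> ring

theorem quad_smul (c : ℂ) (X : Fin 7 → ℂ) : quad (c • X) = c ^ 2 * quad X := by
  simp [quad]; ring

theorem quad_add (X Y : Fin 7 → ℂ) : quad (X + Y) = quad X + quad Y + polar X Y := by
  simp [quad, polar]; ring

/-- Right multiplication by the norm form, as a linear functional. -/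
def polarLin (X : Fin 7 → ℂ) : (Fin 7 → ℂ) →ₗ[ℂ] ℂ where
  toFun := polar X
  map_add' Y Z := by simp [polar]; ring
  map_smul' c Y := by simp [polar]; ring

theorem polar_comm (X Y : Fin 7 → ℂ) : polar X Y = polar Y X := by
  simp only [polar]; ring

theorem polar_smul_right (c : ℂ) (X Y : Fin 7 → ℂ) : polar X (c • Y) = c * polar X Y :=
  (polarLin X).map_smul c Y

theorem polar_smul_left (c : ℂ) (X Y : Fin 7 → ℂ) : polar (c • X) Y = c * polar X Y := by
  rw [polar_comm, polar_smul_right, polar_comm]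

theorem eq_zero_of_polar_eq_zero {X : Fin 7 → ℂ} (h : ∀ Y, polar X Y = 0) : X = 0 := by
  have h' := fun i => h (Pi.single i 1)
  ext i
  fin_cases i
  · simpa [polar] using h' 6
  · simpa [polar] using h' 5
  · simpa [polar] using h' 4
  · simpa [polar] using h' 3
  · simpa [polar] using h' 2
  · simpa [polar] using h' 1
  · simpa [polar] using h' 0

theorem mat_bracket (g : G2) (X Y : Fin 7 → ℂ) :
    mat g *ᵥ bracket X Y = bracket (mat g *ᵥ X) (mat g *ᵥ Y) := g.2 X Y

theorem mat_one : mat 1 = 1 := rfl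

theorem mat_inv_mulVec (g : G2) (X : Fin 7 → ℂ) : mat g⁻¹ *ᵥ (mat g *ᵥ X) = X := by
  rw [Matrix.mulVec_mulVec, ← mat_mul, inv_mul_cancel, mat_one, Matrix.one_mulVec]

theorem mat_mulVec_inv (g : G2) (X : Fin 7 → ℂ) : mat g *ᵥ (mat g⁻¹ *ᵥ X) = X := by
  simpa using mat_inv_mulVec g⁻¹ X

theorem mat_mulVec_injective (g : G2) : Function.Injective fun X => mat g *ᵥ X :=
  Function.LeftInverse.injective (mat_inv_mulVec g)

theorem exists_not_mem_span (X : Fin 7 → ℂ) : ∃ Y : Fin 7 → ℂ, ∀ c : ℂ, Y ≠ c • X := by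
  by_contra! h
  obtain ⟨a, ha⟩ := h (Pi.single 0 1)
  obtain ⟨b, hb⟩ := h (Pi.single 1 1)
  have h1 := congrFun ha 0
  have h2 := congrFun ha 1
  have h3 := congrFun hb 0
  have h4 := congrFun hb 1
  simp at h1 h2 h3 h4
  rcases h2 with h2 | h2
  · simp [h2] at h1
  · simp [h2] at h4

/-- Apply g to `bracket_bracket` and compare with the same identity for gX and gY. The difference of
the two norms times gY is a multiple of gX, which is impossible for Y outside the line of X unless
the norms agree. -/
theorem quad_mulVec (g : G2) (X : Fin 7 → ℂ) : quad (mat g *ᵥ X) = quad X := by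
  obtain ⟨Y, hY⟩ := exists_not_mem_span X
  by_contra hne
  have h := bracket_bracket (mat g *ᵥ X) (mat g *ᵥ Y)
  rw [← mat_bracket, ← mat_bracket, bracket_bracket, Matrix.mulVec_sub, Matrix.mulVec_smul,
    Matrix.mulVec_smul] at h
  have hd : 4 * quad (mat g *ᵥ X) - 4 * quad X ≠ 0 := by
    rw [← mul_sub]; exact mul_ne_zero (by norm_num) (sub_ne_zero.2 hne)
  refine hY ((4 * quad (mat g *ᵥ X) - 4 * quad X)⁻¹ *
    (2 * polar (mat g *ᵥ X) (mat g *ᵥ Y) - 2 * polar X Y)) (mat_mulVec_injective g ?_)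
  simp only [Matrix.mulVec_smul]
  rw [mul_smul, eq_inv_smul_iff₀ hd, sub_smul, sub_smul]
  rw [sub_eq_sub_iff_add_eq_add] at h ⊢
  rw [← h, add_comm]

theorem polar_mulVec (g : G2) (X Y : Fin 7 → ℂ) :
    polar (mat g *ᵥ X) (mat g *ᵥ Y) = polar X Y := by
  have h := quad_mulVec g (X + Y)
  rw [Matrix.mulVec_add, quad_add, quad_add, quad_mulVec, quad_mulVec] at h
  exact add_left_cancel h

/-- Upper unitriangular elements of `SL₂(ℂ)`. -/
def slUp (t : ℂ) : SpecialLinearGroup (Fin 2) ℂ := ⟨!![1, t; 0, 1], by simp [Matrix.det_fin_two]⟩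

/-- Lower unitriangular elements of `SL₂(ℂ)`. -/
def slLow (t : ℂ) : SpecialLinearGroup (Fin 2) ℂ := ⟨!![1, 0; t, 1], by simp [Matrix.det_fin_two]⟩

/-- The standard representative of the Weyl element of `SL₂(ℂ)`. -/
def slWeyl : SpecialLinearGroup (Fin 2) ℂ := ⟨!![0, 1; -1, 0], by simp [Matrix.det_fin_two]⟩

/-- Two vectors are in the same orbit of `Ĝ₂`. -/
def SameOrbit (X Y : Fin 7 → ℂ) : Prop := ∃ g : G2, mat g *ᵥ X = Y

theorem SameOrbit.trans {X Y Z : Fin 7 → ℂ} (h : SameOrbit X Y) (h' : SameOrbit Y Z) :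
    SameOrbit X Z := by
  obtain ⟨g, rfl⟩ := h
  obtain ⟨k, rfl⟩ := h'
  exact ⟨k * g, by rw [mat_mul, Matrix.mulVec_mulVec]⟩

theorem sameOrbit_iota10 (x : SpecialLinearGroup (Fin 2) ℂ) (X : Fin 7 → ℂ) :
    SameOrbit X (M10 x.1 *ᵥ X) := ⟨iota10 x, rfl⟩

theorem sameOrbit_iota13 (x : SpecialLinearGroup (Fin 2) ℂ) (X : Fin 7 → ℂ) :
    SameOrbit X (M13 x.1 *ᵥ X) := ⟨iota13 x, rfl⟩

theorem sameOrbit_iota23 (x : SpecialLinearGroup (Fin 2) ℂ) (X : Fin 7 → ℂ) :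
    SameOrbit X (M23 x.1 *ᵥ X) := ⟨iota23 x, rfl⟩

theorem sameOrbit_iota01 (x : SpecialLinearGroup (Fin 2) ℂ) (X : Fin 7 → ℂ) :
    SameOrbit X (M01 x.1 *ᵥ X) := ⟨iota01 x, rfl⟩

theorem sameOrbit_iota12 (x : SpecialLinearGroup (Fin 2) ℂ) (X : Fin 7 → ℂ) :
    SameOrbit X (M12 x.1 *ᵥ X) := ⟨iota12 x, rfl⟩

/-- The six nonzero weights are short roots and are permuted transitively by Weyl representatives.
If only the zero weight coordinate is nonzero, a unipotent element of `iota12` moves it into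
coordinate 0. -/
theorem exists_sameOrbit_zero_ne_zero {X : Fin 7 → ℂ} (hX : X ≠ 0) :
    ∃ Y, SameOrbit X Y ∧ Y 0 ≠ 0 := by
  by_cases h0 : X 0 ≠ 0
  · exact ⟨X, ⟨1, by rw [mat_one, Matrix.one_mulVec]⟩, h0⟩
  by_cases h1 : X 1 ≠ 0
  · exact ⟨_, sameOrbit_iota01 slWeyl X, by rw [M01_mulVec]; simpa [slWeyl] using h1⟩
  by_cases h4 : X 4 ≠ 0
  · exact ⟨_, sameOrbit_iota13 slWeyl X, by rw [M13_mulVec]; simpa [slWeyl] using h4⟩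
  by_cases h5 : X 5 ≠ 0
  · exact ⟨_, sameOrbit_iota23 slWeyl X, by rw [M23_mulVec]; simpa [slWeyl] using h5⟩
  by_cases h6 : X 6 ≠ 0
  · exact ⟨_, sameOrbit_iota12 slWeyl X, by rw [M12_mulVec]; simpa [slWeyl] using h6⟩
  by_cases h2 : X 2 ≠ 0
  · exact ⟨_, (sameOrbit_iota10 slWeyl X).trans (sameOrbit_iota01 slWeyl _), by
      rw [M01_mulVec, M10_mulVec]; simpa [slWeyl] using h2⟩
  push Not at h0 h1 h2 h4 h5 h6
  refine ⟨_, sameOrbit_iota12 (slUp 1) X, fun h => hX ?_⟩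
  rw [M12_mulVec] at h
  have h3 : X 3 = 0 := by simpa [slUp, h0, h6] using h
  ext i
  fin_cases i <;> assumption

/-- Lower unipotents clear the coordinates 1, 3, 4, 5 in this order, each step preserving the zeros
already produced. Coordinate 2 is first moved to position 1 by the Weyl element of γ̂₁ and then
cleared like coordinate 1. -/
theorem sameOrbit_of_zero_ne_zero {X : Fin 7 → ℂ} (hX : X 0 ≠ 0) :
    ∃ p r, SameOrbit X ![p, 0, 0, 0, 0, 0, r] := by
  obtain ⟨Y, hXY, hY, hY1⟩ : ∃ Y, SameOrbit X Y ∧ Y 0 ≠ 0 ∧ Y 1 = 0 :=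
    ⟨_, sameOrbit_iota01 (slLow (-X 1 / X 0)) X, by rw [M01_mulVec]; simpa [slLow] using hX, by
      rw [M01_mulVec]; simp [slLow]; field_simp; ring⟩
  obtain ⟨Z, hYZ, hZ, hZ1, hZ3⟩ : ∃ Z, SameOrbit Y Z ∧ Z 0 ≠ 0 ∧ Z 1 = 0 ∧ Z 3 = 0 :=
    ⟨_, sameOrbit_iota12 (slLow (-Y 3 / Y 0)) Y, by rw [M12_mulVec]; simpa [slLow] using hY, by
      rw [M12_mulVec]; simp [slLow, hY1], by rw [M12_mulVec]; simp [slLow]; field_simp; ring⟩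
  obtain ⟨W, hZW, hW, hW1, hW3, hW4⟩ :
      ∃ W, SameOrbit Z W ∧ W 0 ≠ 0 ∧ W 1 = 0 ∧ W 3 = 0 ∧ W 4 = 0 :=
    ⟨_, sameOrbit_iota13 (slLow (-Z 4 / Z 0)) Z, by rw [M13_mulVec]; simpa [slLow] using hZ, by
      rw [M13_mulVec]; simp [slLow, hZ1], by rw [M13_mulVec]; simp [slLow, hZ3], by
      rw [M13_mulVec]; simp [slLow]; field_simp; ring⟩
  obtain ⟨U, hWU, hU, hU1, hU3, hU4, hU5⟩ :
      ∃ U, SameOrbit W U ∧ U 0 ≠ 0 ∧ U 1 = 0 ∧ U 3 = 0 ∧ U 4 = 0 ∧ U 5 = 0 :=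
    ⟨_, sameOrbit_iota23 (slLow (-W 5 / W 0)) W, by rw [M23_mulVec]; simpa [slLow] using hW, by
      rw [M23_mulVec]; simp [slLow, hW1], by rw [M23_mulVec]; simp [slLow, hW3], by
      rw [M23_mulVec]; simp [slLow, hW4], by
      rw [M23_mulVec]; simp [slLow]; field_simp; ring⟩
  refine ⟨U 0, U 6, (((hXY.trans hYZ).trans hZW).trans hWU).trans
    ((sameOrbit_iota10 slWeyl U).trans ?_)⟩
  have h := sameOrbit_iota01 (slLow (U 2 / U 0)) (M10 slWeyl.1 *ᵥ U)
  convert! h using 1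
  rw [M01_mulVec, M10_mulVec]
  ext i
  fin_cases i <;> simp [slLow, slWeyl, hU1, hU3, hU4, hU5]
  field_simp
  ring

/-- `Ĝ₂` is transitive on the vectors of norm one. -/
theorem sameOrbit_single_three {X : Fin 7 → ℂ} (hX : quad X = 1) :
    SameOrbit X (Pi.single 3 1) := by
  have h0 : X ≠ 0 := by rintro rfl; simp [quad] at hX
  obtain ⟨Y, hXY, hY⟩ := exists_sameOrbit_zero_ne_zero h0
  obtain ⟨p, r, hYZ⟩ := sameOrbit_of_zero_ne_zero hY
  have h := hXY.trans hYZ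
  have hpr : p * r = 1 := by
    obtain ⟨g, hg⟩ := h
    rw [← quad_mulVec g, hg] at hX
    simpa [quad] using hX
  have hp : p ≠ 0 := left_ne_zero_of_mul_eq_one hpr
  obtain rfl : r = p⁻¹ := by field_simp; linear_combination hpr
  refine h.trans ?_
  -- On coordinates 0, 3, 6 `iota12` is the three-dimensional representation of SL₂. The matrix is
  -- solved from the requirement that coordinates 0 and 6 of the image of (p, 0, p⁻¹) vanish.
  have h' := sameOrbit_iota12 ⟨!![1, -p; 1 / (2 * p), 1 / 2], by
    rw [Matrix.det_fin_two]; simp; field_simp; norm_num⟩ ![p, 0, 0, 0, 0, 0, p⁻¹]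
  convert! h' using 1
  rw [M12_mulVec]
  ext i
  fin_cases i <;> simp <;> field_simp <;> norm_num

end

noncomputable section

/-! ### Semisimple elements are conjugate to elements of the torus -/

/-- The set of eigenvectors of a matrix. -/
def eigenvectors {n : ℕ} (m : Matrix (Fin n) (Fin n) ℂ) : Set (Fin n → ℂ) :=
  {X | ∃ μ : ℂ, m *ᵥ X = μ • X}

theorem IsSemisimpleElt.span_eigenvectors {g : G2} (h : IsSemisimpleElt g) :
    Submodule.span ℂ (eigenvectors (mat g)) = ⊤ := by
  obtain ⟨P, hP⟩ := h
  rw [eq_top_iff]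
  intro X _
  let p : Matrix (Fin 7) (Fin 7) ℂ := P
  let q : Matrix (Fin 7) (Fin 7) ℂ := (P⁻¹ : GL (Fin 7) ℂ)
  have hqp : q * p = 1 := by
    rw [← Units.val_mul, inv_mul_cancel, Units.val_one]
  have hd : p * mat g * q = diagonal (fun i => (p * mat g * q) i i) :=
    ((Matrix.isDiag_iff_diagonal_diag _).1 hP).symm
  set d := fun i => (p * mat g * q) i i
  have hgq : mat g * q = q * diagonal d := by
    rw [← hd, ← mul_assoc, ← mul_assoc, hqp, one_mul]
  have e : X = q *ᵥ (p *ᵥ X) := by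
    rw [Matrix.mulVec_mulVec, hqp, Matrix.one_mulVec]
  rw [e, ← Finset.univ_sum_single (p *ᵥ X), Matrix.mulVec_sum]
  refine Submodule.sum_mem _ fun i _ => Submodule.subset_span ⟨d i, ?_⟩
  rw [Matrix.mulVec_mulVec, hgq, ← Matrix.mulVec_mulVec, Matrix.diagonal_mulVec_single,
    ← Matrix.mulVec_smul]
  congr 1
  ext j
  simp [Pi.single_apply]

theorem mulVec_eq_of_span {m k : Matrix (Fin 7) (Fin 7) ℂ} {A : Set (Fin 7 → ℂ)}
    (hA : Submodule.span ℂ A = ⊤) (h : ∀ X ∈ A, m *ᵥ X = k *ᵥ X) : m = k := by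
  have : m.mulVecLin = k.mulVecLin := LinearMap.ext_on hA h
  exact eq_of_mulVec fun X => LinearMap.congr_fun this X

theorem exists_polar_ne_zero_of_span {A : Set (Fin 7 → ℂ)}
    (hA : Submodule.span ℂ A = ⊤) {X : Fin 7 → ℂ} (hX : X ≠ 0) : ∃ Y ∈ A, polar X Y ≠ 0 := by
  by_contra! h
  refine hX (eq_zero_of_polar_eq_zero fun Y => ?_)
  have : polarLin X = 0 := LinearMap.ext_on hA h
  exact LinearMap.congr_fun this Y

/-- Suppose 1 is not an eigenvalue. Eigenvectors X, Y that are not orthogonal have inverse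
eigenvalues, so their commutator would be fixed and hence vanishes. `bracket_bracket` then shows
that X is not isotropic, so its eigenvalue is a square root of 1, that is, -1. Thus g = -1, which
does not respect the commutator. -/
theorem exists_fixed_ne_zero {g : G2} (h : Submodule.span ℂ (eigenvectors (mat g)) = ⊤) :
    ∃ X, X ≠ 0 ∧ mat g *ᵥ X = X := by
  by_contra! hfix
  have key : ∀ X ∈ eigenvectors (mat g), mat g *ᵥ X = (-1 : Matrix (Fin 7) (Fin 7) ℂ) *ᵥ X := by
    rintro X ⟨μ, hμ⟩
    rw [Matrix.neg_mulVec, Matrix.one_mulVec]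
    by_cases hX : X = 0
    · rw [hX]; simp
    obtain ⟨Y, ⟨ν, hν⟩, hY⟩ := exists_polar_ne_zero_of_span h hX
    have h1 := polar_mulVec g X Y
    rw [hμ, hν, polar_smul_left, polar_smul_right, ← mul_assoc] at h1
    have hμν : μ * ν = 1 := mul_right_cancel₀ hY (by rw [h1, one_mul])
    have h2 : bracket X Y = 0 := by
      by_contra hne
      refine hfix _ hne ?_
      rw [mat_bracket, hμ, hν, bracket_smul_left, bracket_smul_right, smul_smul, hμν, one_smul]
    have h3 := bracket_bracket X Y
    have h0 : bracket X 0 = 0 := by simpa using bracket_smul_right 0 X 0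
    rw [h2, h0] at h3
    have hq : quad X ≠ 0 := by
      intro hq
      rw [hq, mul_zero, zero_smul, zero_sub, eq_comm, neg_eq_zero, smul_eq_zero] at h3
      rcases h3 with h3 | h3
      · exact hY (by simpa using h3)
      · exact hX h3
    have h4 := quad_mulVec g X
    rw [hμ, quad_smul] at h4
    have h5 : μ ^ 2 = 1 := mul_right_cancel₀ hq (by rw [h4, one_mul])
    rcases mul_self_eq_one_iff.1 (by rw [← sq]; exact h5 : μ * μ = 1) with h6 | h6
    · exact absurd (by rw [hμ, h6, one_smul]) (hfix X hX)
    · rw [hμ, h6, neg_smul, one_smul]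
  have hm := mulVec_eq_of_span h key
  have hb := mat_bracket g (Pi.single 3 1) (Pi.single 0 1)
  rw [hm] at hb
  rw [bracket_eq] at hb
  have h0 := congrFun hb 0
  simp [Matrix.neg_mulVec, bracket_eq] at h0
  norm_num at h0

/-- The fixed space is not isotropic: an eigenvector that is not orthogonal to a fixed vector is
itself fixed, and polarization gives a fixed vector of nonzero norm, which is rescaled. -/
theorem exists_fixed_quad_eq_one {g : G2} (h : Submodule.span ℂ (eigenvectors (mat g)) = ⊤) :
    ∃ X, quad X = 1 ∧ mat g *ᵥ X = X := by
  obtain ⟨X, hX, hgX⟩ := exists_fixed_ne_zero h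
  obtain ⟨Z, hZ, hgZ⟩ : ∃ Z, quad Z ≠ 0 ∧ mat g *ᵥ Z = Z := by
    by_contra! hq
    obtain ⟨Y, ⟨μ, hμ⟩, hY⟩ := exists_polar_ne_zero_of_span h hX
    have h1 := polar_mulVec g X Y
    rw [hμ, hgX, polar_smul_right] at h1
    have hμ1 : μ = 1 := mul_right_cancel₀ hY (by rw [h1, one_mul])
    rw [hμ1, one_smul] at hμ
    have hfix : ∀ W, mat g *ᵥ W = W → quad W = 0 := fun W hW => by
      by_contra hne
      exact hq W hne hW
    have h2 := hfix (X + Y) (by rw [Matrix.mulVec_add, hgX, hμ])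
    rw [quad_add, hfix X hgX, hfix Y hμ] at h2
    exact hY (by simpa using h2)
  obtain ⟨c, hc⟩ := IsAlgClosed.exists_pow_nat_eq (quad Z)⁻¹ two_pos
  refine ⟨c • Z, ?_, by rw [Matrix.mulVec_smul, hgZ]⟩
  rw [quad_smul, hc, inv_mul_cancel₀ hZ]

/-! The stabilizer of a vector of norm one is `SL₃(ℂ)`. -/

/-- The matrix of the embedding of `SL₃(ℂ)` in `Ĝ₂`. -/
def sl3Fun (C : Matrix (Fin 3) (Fin 3) ℂ) (X : Fin 7 → ℂ) : Fin 7 → ℂ :=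
  ![C 0 0 * X 0 + C 0 1 * X 4 + C 0 2 * X 5,
    (C 0 0 * C 1 1 - C 0 1 * C 1 0) * X 1 + (C 0 2 * C 1 0 - C 0 0 * C 1 2) * X 2
      + (C 0 1 * C 1 2 - C 0 2 * C 1 1) * X 6,
    (C 0 1 * C 2 0 - C 0 0 * C 2 1) * X 1 + (C 0 0 * C 2 2 - C 0 2 * C 2 0) * X 2
      + (C 0 2 * C 2 1 - C 0 1 * C 2 2) * X 6,
    X 3,
    C 1 0 * X 0 + C 1 1 * X 4 + C 1 2 * X 5,
    C 2 0 * X 0 + C 2 1 * X 4 + C 2 2 * X 5,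
    (C 1 0 * C 2 1 - C 1 1 * C 2 0) * X 1 + (C 1 2 * C 2 0 - C 1 0 * C 2 2) * X 2
      + (C 1 1 * C 2 2 - C 1 2 * C 2 1) * X 6]

/-- The first vector transforms by C and the second by the matrix of cofactors, which is the inverse
transpose when det C = 1. The determinant enters through the pairing of the two vectors and through
the cross product of two second vectors; the cross product of two first vectors is compatible for
every C. -/
theorem sl3Fun_bracket {C : Matrix (Fin 3) (Fin 3) ℂ} (hC : C.det = 1) (X Y : Fin 7 → ℂ) :
    sl3Fun C (bracket X Y) = bracket (sl3Fun C X) (sl3Fun C Y) := by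
  rw [Matrix.det_fin_three] at hC
  rw [bracket_eq, bracket_eq]
  ext i
  fin_cases i <;> simp [sl3Fun]
  · linear_combination (2 * (C 0 0 * (X 2 * Y 1 - X 1 * Y 2) + C 0 1 * (X 1 * Y 6 - X 6 * Y 1)
      + C 0 2 * (X 6 * Y 2 - X 2 * Y 6))) * hC
  · ring
  · ring
  · linear_combination (-(X 0 * Y 6 + X 4 * Y 2 + X 5 * Y 1
      - (Y 0 * X 6 + Y 4 * X 2 + Y 5 * X 1))) * hC
  · linear_combination (2 * (C 1 0 * (X 2 * Y 1 - X 1 * Y 2) + C 1 1 * (X 1 * Y 6 - X 6 * Y 1)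
      + C 1 2 * (X 6 * Y 2 - X 2 * Y 6))) * hC
  · linear_combination (2 * (C 2 0 * (X 2 * Y 1 - X 1 * Y 2) + C 2 1 * (X 1 * Y 6 - X 6 * Y 1)
      + C 2 2 * (X 6 * Y 2 - X 2 * Y 6))) * hC
  · ring

/-- The matrix of `sl3Fun C`. -/
def sl3Mat (C : Matrix (Fin 3) (Fin 3) ℂ) : Matrix (Fin 7) (Fin 7) ℂ :=
  LinearMap.toMatrix'
    { toFun := sl3Fun C
      map_add' := fun X Y => by ext i; fin_cases i <;> simp [sl3Fun] <;> ring
      map_smul' := fun c X => by ext i; fin_cases i <;> simp [sl3Fun] <;> ring }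

theorem sl3Mat_mulVec (C : Matrix (Fin 3) (Fin 3) ℂ) (X : Fin 7 → ℂ) :
    sl3Mat C *ᵥ X = sl3Fun C X := by
  rw [sl3Mat, LinearMap.toMatrix'_mulVec]
  rfl

theorem sl3Mat_mul (C D : Matrix (Fin 3) (Fin 3) ℂ) : sl3Mat (C * D) = sl3Mat C * sl3Mat D := by
  refine eq_of_mulVec fun X => ?_
  rw [← Matrix.mulVec_mulVec, sl3Mat_mulVec, sl3Mat_mulVec, sl3Mat_mulVec]
  ext i
  fin_cases i <;> simp [sl3Fun, Matrix.mul_apply, Fin.sum_univ_three] <;> ring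

theorem sl3Mat_one : sl3Mat 1 = 1 := by
  refine eq_of_mulVec fun X => ?_
  rw [sl3Mat_mulVec, Matrix.one_mulVec]
  ext i
  fin_cases i <;> simp [sl3Fun]

/-- The embedding of `SL₃(ℂ)` in `Ĝ₂`. -/
def sl3 (C : Matrix (Fin 3) (Fin 3) ℂ) (hC : C.det = 1) : G2 :=
  ⟨⟨sl3Mat C, sl3Mat C⁻¹,
    by rw [← sl3Mat_mul, Matrix.mul_nonsing_inv _ (by rw [hC]; exact isUnit_one), sl3Mat_one],
    by rw [← sl3Mat_mul, Matrix.nonsing_inv_mul _ (by rw [hC]; exact isUnit_one), sl3Mat_one]⟩,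
    fun X Y => by
      rw [sl3Mat_mulVec, sl3Mat_mulVec, sl3Mat_mulVec, sl3Fun_bracket hC]⟩

theorem mat_sl3 (C : Matrix (Fin 3) (Fin 3) ℂ) (hC : C.det = 1) : mat (sl3 C hC) = sl3Mat C := rfl

/-- The inclusion of the first off-diagonal vectors. -/
def ofU (u : Fin 3 → ℂ) : Fin 7 → ℂ := ![u 0, 0, 0, 0, u 1, u 2, 0]

/-- The commutator with the basis vector e of index 3 has eigenvalue 2 on the first vectors, -2 on
the second ones and 0 on e. So (ad(e)² + 2 ad(e))/8 is the projection to the first vectors, and it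
commutes with any g that fixes e. -/
theorem mulVec_ofU_uPart {g : G2} (hg : mat g *ᵥ Pi.single 3 1 = Pi.single 3 1) {X : Fin 7 → ℂ}
    {μ : ℂ} (h : mat g *ᵥ X = μ • X) : mat g *ᵥ ofU (uPart X) = μ • ofU (uPart X) := by
  let e : Fin 7 → ℂ := Pi.single 3 1
  have hp : ofU (uPart X) = (8 : ℂ)⁻¹ • (bracket e (bracket e X) + (2 : ℂ) • bracket e X) := by
    rw [bracket_eq, bracket_eq]
    ext i
    fin_cases i <;> simp [e, ofU, uPart] <;> ring
  have h1 : mat g *ᵥ bracket e X = μ • bracket e X := by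
    rw [mat_bracket, hg, h, bracket_smul_right]
  rw [hp, Matrix.mulVec_smul, Matrix.mulVec_add, Matrix.mulVec_smul, mat_bracket, h1, hg,
    bracket_smul_right, smul_comm μ, smul_add, smul_add, smul_add, smul_comm (2 : ℂ) μ]

/-- The linear map `uPart`. -/
def uPartLin : (Fin 7 → ℂ) →ₗ[ℂ] (Fin 3 → ℂ) where
  toFun := uPart
  map_add' X Y := by ext i; fin_cases i <;> simp [uPart]
  map_smul' c X := by ext i; fin_cases i <;> simp [uPart]

/-- The projections of the eigenvectors of g span the three-dimensional space of first vectors, so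
they contain an eigenbasis. After rescaling, this basis forms the columns of a matrix in SL₃. -/
theorem exists_conj_of_fixed {g : G2} (h : Submodule.span ℂ (eigenvectors (mat g)) = ⊤)
    (hg : mat g *ᵥ Pi.single 3 1 = Pi.single 3 1) :
    ∃ (k : G2) (μ : Fin 3 → ℂ), mat (k⁻¹ * g * k) *ᵥ Pi.single 3 1 = Pi.single 3 1 ∧
      ∀ u, mat (k⁻¹ * g * k) *ᵥ ofU u = ofU (fun i => μ i * u i) := by
  have hspan : Submodule.span ℂ (uPart '' eigenvectors (mat g)) = ⊤ := by
    have e := Submodule.map_span uPartLin (eigenvectors (mat g))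
    rw [h, Submodule.map_top, LinearMap.range_eq_top.2] at e
    · exact e.symm
    · intro u
      refine ⟨ofU u, ?_⟩
      ext i
      fin_cases i <;> simp [uPartLin, uPart, ofU]
  obtain ⟨f, hf, -, hli⟩ := Submodule.exists_fun_fin_finrank_span_eq ℂ (uPart '' eigenvectors (mat g))
  have hr : 3 = Module.finrank ℂ (Submodule.span ℂ (uPart '' eigenvectors (mat g))) := by
    rw [hspan, finrank_top]; simp
  let c : Fin 3 → Fin 3 → ℂ := f ∘ finCongr hr
  have hc : LinearIndependent ℂ c := hli.comp _ (finCongr hr).injective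
  have hmu : ∀ i, ∃ μ : ℂ, mat g *ᵥ ofU (c i) = μ • ofU (c i) := by
    intro i
    obtain ⟨X, ⟨μ, hX⟩, hXc⟩ := hf (finCongr hr i)
    refine ⟨μ, ?_⟩
    have : c i = uPart X := hXc.symm
    rw [this]
    exact mulVec_ofU_uPart hg hX
  choose μ hμ using hmu
  let d : ℂ := (Matrix.of c).det
  have hd : d ≠ 0 := by
    have := Matrix.linearIndependent_rows_iff_isUnit.1 (show LinearIndependent ℂ (Matrix.of c).row from hc)
    exact ((Matrix.isUnit_iff_isUnit_det _).1 this).ne_zero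
  -- Dividing one eigenvector by the determinant d is enough to reach determinant one.
  let s : Fin 3 → ℂ := ![d⁻¹, 1, 1]
  let C : Matrix (Fin 3) (Fin 3) ℂ := Matrix.of fun i j => s j * c j i
  have hC : C.det = 1 := by
    have : C = (diagonal s * Matrix.of c)ᵀ := by
      ext i j
      simp [C, Matrix.diagonal_mul]
    rw [this, Matrix.det_transpose, Matrix.det_mul, Matrix.det_diagonal, Fin.prod_univ_three]
    simpa [s] using inv_mul_cancel₀ hd
  have hk : ∀ u : Fin 3 → ℂ, mat (sl3 C hC) *ᵥ ofU u = ∑ j, (u j * s j) • ofU (c j) := by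
    intro u
    rw [mat_sl3, sl3Mat_mulVec, Fin.sum_univ_three]
    ext i
    fin_cases i <;> simp [sl3Fun, ofU, C] <;> ring
  have h3 : mat (sl3 C hC) *ᵥ Pi.single 3 1 = Pi.single 3 1 := by
    rw [mat_sl3, sl3Mat_mulVec]
    ext i
    fin_cases i <;> simp [sl3Fun]
  refine ⟨sl3 C hC, μ, ?_, fun u => ?_⟩
  · rw [mat_mul, mat_mul, ← Matrix.mulVec_mulVec, ← Matrix.mulVec_mulVec, h3, hg]
    nth_rewrite 1 [← h3]
    rw [mat_inv_mulVec]
  · rw [mat_mul, mat_mul, ← Matrix.mulVec_mulVec, ← Matrix.mulVec_mulVec, hk]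
    have : mat g *ᵥ ∑ j, (u j * s j) • ofU (c j) =
        mat (sl3 C hC) *ᵥ ofU (fun i => μ i * u i) := by
      rw [hk, Matrix.mulVec_sum]
      refine Finset.sum_congr rfl fun j _ => ?_
      rw [Matrix.mulVec_smul, hμ, smul_smul]
      congr 1
      ring
    rw [this, mat_inv_mulVec]

/-- The products of basis vectors express all diagonal entries by those of index 0 and 1. -/
theorem exists_mHat_eq {g : G2} {d : Fin 7 → ℂ} (h : mat g = diagonal d) : ∃ z, g = mHat z := by
  have key := fun i j => mat_bracket g (Pi.single i 1) (Pi.single j 1)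
  simp only [h, Matrix.diagonal_mulVec_single, mul_one] at key
  have hne : ∀ i, d i ≠ 0 := by
    intro i hi
    have := mat_mulVec_injective g (a₁ := Pi.single i 1) (a₂ := 0) (by
      simp [h, hi])
    simpa using congrFun this i
  have k3 := congrFun (key 3 0) 0
  have k06 := congrFun (key 0 6) 3
  have k15 := congrFun (key 5 1) 3
  have k24 := congrFun (key 4 2) 3
  have k04 := congrFun (key 0 4) 1
  simp [bracket_eq, Matrix.mulVec_diagonal] at k3 k06 k15 k24 k04
  have h3 : d 3 = 1 := mul_right_cancel₀ (hne 0) (by linear_combination -k3 / 2)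
  rw [h3] at k06 k15 k24
  refine ⟨(Units.mk0 _ (hne 0), Units.mk0 _ (hne 1)), mat_injective ?_⟩
  rw [h, mat_mHat]
  congr 1
  have h0 := hne 0
  have h1 := hne 1
  have h4 : d 4 = d 1 / d 0 := by field_simp; linear_combination -k04 / 2
  ext i
  fin_cases i <;> simp [torusWeights]
  · have h2 : d 2 = 1 / d 4 := by rw [k24, mul_div_cancel_left₀ _ (hne 4)]
    rw [h2, h4, one_div_div, div_eq_mul_inv]
  · exact h3
  · rw [h4, div_eq_mul_inv]
  · exact eq_inv_of_mul_eq_one_left k15.symm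
  · exact eq_inv_of_mul_eq_one_right k06.symm

theorem span_eigenvectors_conj {g : G2} (h : Submodule.span ℂ (eigenvectors (mat g)) = ⊤) (k : G2) :
    Submodule.span ℂ (eigenvectors (mat (k * g * k⁻¹))) = ⊤ := by
  have e := Submodule.map_span (mat k).mulVecLin (eigenvectors (mat g))
  rw [h, Submodule.map_top, LinearMap.range_eq_top.2] at e
  · rw [eq_top_iff, e]
    refine Submodule.span_mono ?_
    rintro _ ⟨X, ⟨μ, hμ⟩, rfl⟩
    refine ⟨μ, ?_⟩
    rw [Matrix.mulVecLin_apply, mat_mul, mat_mul, ← Matrix.mulVec_mulVec, ← Matrix.mulVec_mulVec,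
      mat_inv_mulVec, hμ, Matrix.mulVec_smul]
  · intro X
    exact ⟨mat k⁻¹ *ᵥ X, mat_mulVec_inv k X⟩

/-- A semisimple element of `Ĝ₂` is conjugate to an element of the torus. -/
theorem exists_conj_mHat {g : G2} (h : Submodule.span ℂ (eigenvectors (mat g)) = ⊤) :
    ∃ (k : G2) (z : ℂˣ × ℂˣ), k * g * k⁻¹ = mHat z := by
  obtain ⟨X, hX, hgX⟩ := exists_fixed_quad_eq_one h
  obtain ⟨l, hl⟩ := sameOrbit_single_three hX
  have hfix : mat (l * g * l⁻¹) *ᵥ Pi.single 3 1 = Pi.single 3 1 := by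
    rw [mat_mul, mat_mul, ← Matrix.mulVec_mulVec, ← Matrix.mulVec_mulVec, ← hl,
      mat_inv_mulVec, hgX]
  obtain ⟨k, μ, h3, hu⟩ := exists_conj_of_fixed (span_eigenvectors_conj h l) hfix
  -- Commutators of first vectors span the second vectors, so the eigenvalues there are products of
  -- two of the μ i.
  suffices hd : mat (k⁻¹ * (l * g * l⁻¹) * k) =
      diagonal ![μ 0, μ 0 * μ 1, μ 2 * μ 0, 1, μ 1, μ 2, μ 1 * μ 2] by
    obtain ⟨z, hz⟩ := exists_mHat_eq hd
    exact ⟨k⁻¹ * l, z, by rw [← hz]; group⟩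
  refine eq_of_mulVec fun Y => ?_
  let e : Fin 3 → Fin 7 → ℂ := fun i => ofU (Pi.single i 1)
  have hs : (Pi.single 3 1 : Fin 7 → ℂ) = ![0, 0, 0, 1, 0, 0, 0] := by
    ext i
    fin_cases i <;> simp
  have he : Y = ofU (uPart Y) + Y 3 • Pi.single 3 1 + (2 : ℂ)⁻¹ • (Y 1 • bracket (e 0) (e 1)
      + Y 2 • bracket (e 2) (e 0) + Y 6 • bracket (e 1) (e 2)) := by
    simp only [bracket_eq, hs]
    ext i
    fin_cases i <;> simp [e, ofU, uPart] <;> ring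
  conv_lhs => rw [he]
  simp only [Matrix.mulVec_add, Matrix.mulVec_smul, mat_bracket, e, hu, h3]
  simp only [bracket_eq, hs]
  ext i
  fin_cases i <;> simp [ofU, uPart, Matrix.mulVec_diagonal] <;> ring

end

noncomputable section

/-! ### Differentials of algebraic homomorphisms from `SL₂(ℂ)` -/

/-- Diagonal elements of `SL₂(ℂ)`. -/
def slDiag (t : ℂˣ) : SpecialLinearGroup (Fin 2) ℂ :=
  ⟨!![(t : ℂ), 0; 0, ((t⁻¹ : ℂˣ) : ℂ)], by simp [Matrix.det_fin_two]⟩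

theorem exists_polynomial_of_regular {ι : ℂ → SpecialLinearGroup (Fin 2) ℂ}
    (hι : ∀ i j, ∃ p : Polynomial ℂ, ∀ t, (ι t).1 i j = p.eval t)
    {f : SpecialLinearGroup (Fin 2) ℂ → ℂ} (hf : f ∈ regularFunctions) :
    ∃ p : Polynomial ℂ, ∀ t, f (ι t) = p.eval t := by
  induction hf using Algebra.adjoin_induction with
  | mem f hf =>
    obtain ⟨⟨i, j⟩, rfl⟩ := hf
    exact hι i j
  | algebraMap c => exact ⟨Polynomial.C c, fun t => by simp⟩
  | add f g _ _ hf hg =>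
    obtain ⟨p, hp⟩ := hf
    obtain ⟨r, hr⟩ := hg
    exact ⟨p + r, fun t => by simp [hp, hr]⟩
  | mul f g _ _ hf hg =>
    obtain ⟨p, hp⟩ := hf
    obtain ⟨r, hr⟩ := hg
    exact ⟨p * r, fun t => by simp [hp, hr]⟩

theorem exists_polynomial_slUp {f : SpecialLinearGroup (Fin 2) ℂ → ℂ}
    (hf : f ∈ regularFunctions) : ∃ p : Polynomial ℂ, ∀ t, f (slUp t) = p.eval t := by
  refine exists_polynomial_of_regular (fun i j => ?_) hf
  fin_cases i <;> fin_cases j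
  · exact ⟨1, fun t => by simp [slUp]⟩
  · exact ⟨Polynomial.X, fun t => by simp [slUp]⟩
  · exact ⟨0, fun t => by simp [slUp]⟩
  · exact ⟨1, fun t => by simp [slUp]⟩

theorem exists_polynomial_slLow {f : SpecialLinearGroup (Fin 2) ℂ → ℂ}
    (hf : f ∈ regularFunctions) : ∃ p : Polynomial ℂ, ∀ t, f (slLow t) = p.eval t := by
  refine exists_polynomial_of_regular (fun i j => ?_) hf
  fin_cases i <;> fin_cases j
  · exact ⟨1, fun t => by simp [slLow]⟩
  · exact ⟨0, fun t => by simp [slLow]⟩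
  · exact ⟨Polynomial.X, fun t => by simp [slLow]⟩
  · exact ⟨1, fun t => by simp [slLow]⟩

theorem exists_laurent_slDiag {f : SpecialLinearGroup (Fin 2) ℂ → ℂ}
    (hf : f ∈ regularFunctions) : ∃ p : ℤ →₀ ℂ,
      ∀ t : ℂˣ, f (slDiag t) = p.sum fun k c => c * ((t ^ k : ℂˣ) : ℂ) := by
  obtain ⟨p, hp⟩ : ∃ p : LaurentPolynomial ℂ,
      ∀ t, f (slDiag t) = p.eval₂ (RingHom.id ℂ) t := by
    induction hf using Algebra.adjoin_induction with
    | mem f hf =>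
      obtain ⟨⟨i, j⟩, rfl⟩ := hf
      fin_cases i <;> fin_cases j
      · exact ⟨LaurentPolynomial.T 1, fun t => by simp [slDiag]⟩
      · exact ⟨0, fun t => by simp [slDiag]⟩
      · exact ⟨0, fun t => by simp [slDiag]⟩
      · exact ⟨LaurentPolynomial.T (-1), fun t => by simp [slDiag]⟩
    | algebraMap c => exact ⟨LaurentPolynomial.C c, fun t => by simp⟩
    | add f g _ _ hf hg =>
      obtain ⟨p, hp⟩ := hf
      obtain ⟨r, hr⟩ := hg
      exact ⟨p + r, fun t => by simp [hp, hr]⟩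
    | mul f g _ _ hf hg =>
      obtain ⟨p, hp⟩ := hf
      obtain ⟨r, hr⟩ := hg
      exact ⟨p * r, fun t => by simp [hp, hr]⟩
  obtain ⟨c, hc⟩ : ∃ c : ℤ →₀ ℂ, ∀ t : ℂˣ, p.eval₂ (RingHom.id ℂ) t =
      c.sum fun k c => c * ((t ^ k : ℂˣ) : ℂ) := by
    clear hp
    induction p using LaurentPolynomial.induction_on' with
    | add p r hp hr =>
      obtain ⟨c, hc⟩ := hp
      obtain ⟨d, hd⟩ := hr
      refine ⟨c + d, fun t => ?_⟩
      rw [map_add, hc, hd, Finsupp.sum_add_index' (by simp) (fun _ _ _ => add_mul _ _ _)]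
    | C_mul_T n a =>
      refine ⟨Finsupp.single n a, fun t => ?_⟩
      rw [Finsupp.sum_single_index (by simp), map_mul, LaurentPolynomial.eval₂_C,
        LaurentPolynomial.eval₂_T, RingHom.id_apply]
  exact ⟨c, fun t => by rw [hp, hc]⟩

/-- A matrix valued function has a derivative if its entries do. -/
def HasMatDeriv (P : ℂ → Matrix (Fin 7) (Fin 7) ℂ) (P' : Matrix (Fin 7) (Fin 7) ℂ) (t : ℂ) : Prop :=
  ∀ i j, HasDerivAt (fun s => P s i j) (P' i j) t

theorem HasMatDeriv.mul {P Q : ℂ → Matrix (Fin 7) (Fin 7) ℂ} {P' Q' : Matrix (Fin 7) (Fin 7) ℂ}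
    {t : ℂ} (hP : HasMatDeriv P P' t) (hQ : HasMatDeriv Q Q' t) :
    HasMatDeriv (fun s => P s * Q s) (P' * Q t + P t * Q') t := fun i j => by
  have h := HasDerivAt.fun_sum fun k (_ : k ∈ Finset.univ) => (hP i k).mul (hQ k j)
  simp only [Matrix.mul_apply, Matrix.add_apply]
  rw [← Finset.sum_add_distrib]
  exact h

theorem HasMatDeriv.const (A : Matrix (Fin 7) (Fin 7) ℂ) (t : ℂ) : HasMatDeriv (fun _ => A) 0 t :=
  fun _ _ => hasDerivAt_const _ _

theorem HasMatDeriv.comp {P : ℂ → Matrix (Fin 7) (Fin 7) ℂ} {P' : Matrix (Fin 7) (Fin 7) ℂ}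
    {f : ℂ → ℂ} {f' t : ℂ} (hP : HasMatDeriv P P' (f t)) (hf : HasDerivAt f f' t) :
    HasMatDeriv (fun s => P (f s)) (f' • P') t := fun i j => by
  have := (hP i j).comp t hf
  rwa [mul_comm] at this

theorem HasMatDeriv.unique {P Q : ℂ → Matrix (Fin 7) (Fin 7) ℂ}
    {P' Q' : Matrix (Fin 7) (Fin 7) ℂ} {t : ℂ} (hP : HasMatDeriv P P' t) (hQ : HasMatDeriv Q Q' t)
    (h : ∀ᶠ s in nhds t, P s = Q s) : P' = Q' := by
  ext i j
  refine (hP i j).unique ((hQ i j).congr_of_eventuallyEq ?_)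
  filter_upwards [h] with s hs
  rw [hs]

variable {ρ ρ' : SpecialLinearGroup (Fin 2) ℂ →* G2}

/-- The image of the upper nilpotent under the differential of `ρ`. -/
def dUp (ρ : SpecialLinearGroup (Fin 2) ℂ →* G2) : Matrix (Fin 7) (Fin 7) ℂ :=
  Matrix.of fun i j => deriv (fun t => mat (ρ (slUp t)) i j) 0

/-- The image of the lower nilpotent under the differential of `ρ`. -/
def dLow (ρ : SpecialLinearGroup (Fin 2) ℂ →* G2) : Matrix (Fin 7) (Fin 7) ℂ :=
  Matrix.of fun i j => deriv (fun t => mat (ρ (slLow t)) i j) 0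

theorem slUp_add (s t : ℂ) : slUp (s + t) = slUp s * slUp t := by
  refine Subtype.ext ?_
  change (slUp (s + t)).1 = (slUp s).1 * (slUp t).1
  ext i j
  fin_cases i <;> fin_cases j <;> simp [slUp, Matrix.mul_apply, Fin.sum_univ_two, add_comm]

theorem slLow_add (s t : ℂ) : slLow (s + t) = slLow s * slLow t := by
  refine Subtype.ext ?_
  change (slLow (s + t)).1 = (slLow s).1 * (slLow t).1
  ext i j
  fin_cases i <;> fin_cases j <;> simp [slLow, Matrix.mul_apply, Fin.sum_univ_two]

theorem slUp_zero : slUp 0 = 1 := by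
  ext i j
  fin_cases i <;> fin_cases j <;> simp [slUp]

theorem slLow_zero : slLow 0 = 1 := by
  ext i j
  fin_cases i <;> fin_cases j <;> simp [slLow]

theorem hasMatDeriv_dUp (hρ : IsAlgebraicHom ρ) :
    HasMatDeriv (fun t => mat (ρ (slUp t))) (dUp ρ) 0 := fun i j => by
  obtain ⟨p, hp⟩ := exists_polynomial_slUp (hρ i j)
  have : (fun t => mat (ρ (slUp t)) i j) = fun t => p.eval t := funext hp
  refine DifferentiableAt.hasDerivAt ?_
  rw [this]
  exact p.differentiableAt

theorem hasMatDeriv_dLow (hρ : IsAlgebraicHom ρ) :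
    HasMatDeriv (fun t => mat (ρ (slLow t))) (dLow ρ) 0 := fun i j => by
  obtain ⟨p, hp⟩ := exists_polynomial_slLow (hρ i j)
  have : (fun t => mat (ρ (slLow t)) i j) = fun t => p.eval t := funext hp
  refine DifferentiableAt.hasDerivAt ?_
  rw [this]
  exact p.differentiableAt

theorem hasMatDeriv_of_add {P : ℂ → G2} {E : Matrix (Fin 7) (Fin 7) ℂ}
    (hP : HasMatDeriv (fun t => mat (P t)) E 0) (hadd : ∀ s t, P (s + t) = P s * P t) (t : ℂ) :
    HasMatDeriv (fun t => mat (P t)) (mat (P t) * E) t := by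
  have h1 : HasMatDeriv (fun s => mat (P (s - t))) ((1 : ℂ) • E) t :=
    HasMatDeriv.comp (P := fun t => mat (P t)) (f := fun s => s - t) (by rw [sub_self]; exact hP)
      ((hasDerivAt_id t).sub_const t)
  have h2 := (HasMatDeriv.const (mat (P t)) t).mul h1
  rw [zero_mul, zero_add, one_smul] at h2
  have e : (fun s => mat (P t) * mat (P (s - t))) = fun s => mat (P s) := by
    ext1 s
    rw [← mat_mul, ← hadd, add_sub_cancel]
  rwa [e] at h2

/-- Uniqueness for one-parameter groups: since Q commutes with its generator, P(t) Q(-t) has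
derivative zero and is constant. -/
theorem eq_of_hasMatDeriv {P Q : ℂ → G2} {E : Matrix (Fin 7) (Fin 7) ℂ}
    (hP : HasMatDeriv (fun t => mat (P t)) E 0) (hPadd : ∀ s t, P (s + t) = P s * P t)
    (hQ : HasMatDeriv (fun t => mat (Q t)) E 0) (hQadd : ∀ s t, Q (s + t) = Q s * Q t) : P = Q := by
  have hP0 : P 0 = 1 := by have := hPadd 0 0; simpa using this
  have hQ0 : Q 0 = 1 := by have := hQadd 0 0; simpa using this
  have hQ' : ∀ t, mat (Q t) * E = E * mat (Q t) := fun t => by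
    have h1 := (HasMatDeriv.const (mat (Q t)) 0).mul hQ
    have h2 := hQ.mul (HasMatDeriv.const (mat (Q t)) 0)
    have := h1.unique h2 (Filter.Eventually.of_forall fun s => by
      rw [← mat_mul, ← mat_mul, ← hQadd, ← hQadd, add_comm])
    simpa using this
  have hd : ∀ t, HasMatDeriv (fun t => mat (P t) * mat (Q (-t))) 0 t := fun t => by
    have h1 := hasMatDeriv_of_add hP hPadd t
    have h2 : HasMatDeriv (fun t => mat (Q (-t))) ((-1 : ℂ) • (mat (Q (-t)) * E)) t :=
      HasMatDeriv.comp (P := fun t => mat (Q t)) (f := fun s => -s)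
        (hasMatDeriv_of_add hQ hQadd (-t)) (hasDerivAt_neg t)
    have h3 := h1.mul h2
    rwa [hQ', neg_one_smul, mul_neg, mul_assoc, add_neg_cancel] at h3
  ext1 t
  have hc : mat (P t) * mat (Q (-t)) = mat (P 0) * mat (Q (-0)) := by
    ext i j
    exact is_const_of_deriv_eq_zero (𝕜 := ℂ) (fun s => (hd s i j).differentiableAt)
      (fun s => (hd s i j).deriv) t 0
  rw [← mat_mul, ← mat_mul, neg_zero, hP0, hQ0, one_mul] at hc
  have hc' := mat_injective hc
  have : Q (-t) * Q t = 1 := by rw [← hQadd, neg_add_cancel, hQ0]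
  rw [eq_inv_of_mul_eq_one_left hc', inv_eq_of_mul_eq_one_right this]

/-- Elements with nonzero lower left entry are products of an upper, a lower and an upper
unitriangular matrix. The others get such an entry after multiplication by `slLow 1`. -/
theorem hom_eq_of_slUp_slLow (hU : ∀ t, ρ (slUp t) = ρ' (slUp t))
    (hL : ∀ t, ρ (slLow t) = ρ' (slLow t)) : ρ = ρ' := by
  have main : ∀ x : SpecialLinearGroup (Fin 2) ℂ, x.1 1 0 ≠ 0 → ρ x = ρ' x := by
    intro x hc
    have hx := x.2
    have e : x = slUp ((x.1 0 0 - 1) / x.1 1 0) * slLow (x.1 1 0) *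
        slUp ((x.1 1 1 - 1) / x.1 1 0) := by
      rw [Matrix.det_fin_two] at hx
      refine Subtype.ext ?_
      change x.1 = (slUp _).1 * (slLow _).1 * (slUp _).1
      ext i j
      fin_cases i <;> fin_cases j <;>
        simp [slUp, slLow, Matrix.mul_apply, Fin.sum_univ_two] <;>
        field_simp <;> first | linear_combination hx | linear_combination -hx | ring
    rw [e, map_mul, map_mul, map_mul, map_mul, hU, hL, hU]
  ext1 x
  by_cases hc : x.1 1 0 = 0
  · have hd : x.1 1 1 ≠ 0 := by
      intro h
      have hx := x.2
      rw [Matrix.det_fin_two, hc, h] at hx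
      simp at hx
    have h := main (x * slLow 1) (by
      change (x.1 * (slLow 1).1) 1 0 ≠ 0
      simpa [slLow, Matrix.mul_apply, Fin.sum_univ_two, hc] using hd)
    rw [map_mul, map_mul, hL] at h
    exact mul_right_cancel h
  · exact main x hc

/-- An algebraic homomorphism from `SL₂(ℂ)` is determined by its differential. -/
theorem hom_eq_of_differential (hρ : IsAlgebraicHom ρ) (hρ' : IsAlgebraicHom ρ')
    (hE : dUp ρ = dUp ρ') (hF : dLow ρ = dLow ρ') : ρ = ρ' := by
  refine hom_eq_of_slUp_slLow (fun t => ?_) (fun t => ?_)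
  · refine congrFun (eq_of_hasMatDeriv (hasMatDeriv_dUp hρ) (fun s t => ?_)
      (by rw [hE]; exact hasMatDeriv_dUp hρ') (fun s t => ?_)) t
    · rw [slUp_add, map_mul]
    · rw [slUp_add, map_mul]
  · refine congrFun (eq_of_hasMatDeriv (hasMatDeriv_dLow hρ) (fun s t => ?_)
      (by rw [hF]; exact hasMatDeriv_dLow hρ') (fun s t => ?_)) t
    · rw [slLow_add, map_mul]
    · rw [slLow_add, map_mul]


/-- The commutator as a bilinear map. -/
def bracketLin : (Fin 7 → ℂ) →ₗ[ℂ] (Fin 7 → ℂ) →ₗ[ℂ] (Fin 7 → ℂ) :=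
  LinearMap.mk₂ ℂ bracket bracket_add_left bracket_smul_left bracket_add_right bracket_smul_right

theorem bracket_eq_sum (X Y : Fin 7 → ℂ) (i : Fin 7) : bracket X Y i =
    ∑ a, ∑ b, X a * Y b * bracket (Pi.single a 1) (Pi.single b 1) i := by
  have hs : ∀ Z : Fin 7 → ℂ, Z = ∑ a, Z a • Pi.single a 1 := fun Z => by
    ext j
    simp [Finset.sum_apply, Pi.single_apply]
  change bracketLin X Y i = ∑ a, ∑ b, X a * Y b * bracketLin (Pi.single a 1) (Pi.single b 1) i
  conv_lhs => rw [hs X, hs Y]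
  simp only [map_sum, LinearMap.sum_apply, map_smul, LinearMap.smul_apply, Finset.sum_apply,
    Pi.smul_apply, smul_eq_mul]
  rw [Finset.sum_comm]
  simp only [Finset.mul_sum, mul_left_comm, mul_assoc]

/-- Differentiate the invariance of the commutator at the identity. The coordinate expansion
`bracket_eq_sum` reduces this to the product rule for scalar functions. -/
theorem differential_bracket {P : ℂ → G2} {E : Matrix (Fin 7) (Fin 7) ℂ} (hP0 : P 0 = 1)
    (hP : HasMatDeriv (fun t => mat (P t)) E 0) (X Y : Fin 7 → ℂ) :
    E *ᵥ bracket X Y = bracket (E *ᵥ X) Y + bracket X (E *ᵥ Y) := by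
  have hv : ∀ Z i, HasDerivAt (fun t => (mat (P t) *ᵥ Z) i) ((E *ᵥ Z) i) 0 := fun Z i => by
    simp only [Matrix.mulVec, dotProduct]
    exact HasDerivAt.fun_sum fun k _ => (hP i k).mul_const (Z k)
  have h1 : ∀ Z i, (mat (P 0) *ᵥ Z) i = Z i := fun Z i => by
    rw [hP0, mat_one, Matrix.one_mulVec]
  ext i
  refine (hv (bracket X Y) i).unique ?_
  have h := HasDerivAt.fun_sum fun a (_ : a ∈ Finset.univ) => HasDerivAt.fun_sum
    fun b (_ : b ∈ Finset.univ) => ((hv X a).fun_mul (hv Y b)).mul_const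
      (bracket (Pi.single a 1) (Pi.single b 1) i)
  have e : (fun t => (mat (P t) *ᵥ bracket X Y) i) = fun t => ∑ a, ∑ b,
      (mat (P t) *ᵥ X) a * (mat (P t) *ᵥ Y) b * bracket (Pi.single a 1) (Pi.single b 1) i :=
    funext fun t => by rw [mat_bracket, bracket_eq_sum]
  rw [e, Pi.add_apply, bracket_eq_sum (E *ᵥ X), bracket_eq_sum X]
  convert! h using 1
  simp only [← Finset.sum_add_distrib, h1]
  refine Finset.sum_congr rfl fun a _ => Finset.sum_congr rfl fun b _ => ?_
  ring

theorem slDiag_mul_slUp (t : ℂˣ) (s : ℂ) : slDiag t * slUp s = slUp (t ^ 2 * s) * slDiag t := by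
  refine Subtype.ext ?_
  change (slDiag t).1 * (slUp s).1 = (slUp _).1 * (slDiag t).1
  ext i j
  fin_cases i <;> fin_cases j <;>
    simp [slUp, slDiag, Matrix.mul_apply, Fin.sum_univ_two] <;> field_simp

theorem slDiag_mul_slLow (t : ℂˣ) (s : ℂ) :
    slDiag t * slLow (t ^ 2 * s) = slLow s * slDiag t := by
  refine Subtype.ext ?_
  change (slDiag t).1 * (slLow _).1 = (slLow _).1 * (slDiag t).1
  ext i j
  fin_cases i <;> fin_cases j <;>
    simp [slLow, slDiag, Matrix.mul_apply, Fin.sum_univ_two] <;> field_simp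

theorem slDiag_mul_dUp (hρ : IsAlgebraicHom ρ) (t : ℂˣ) :
    mat (ρ (slDiag t)) * dUp ρ = (t ^ 2 : ℂ) • (dUp ρ * mat (ρ (slDiag t))) := by
  have h1 := (HasMatDeriv.const (mat (ρ (slDiag t))) 0).mul (hasMatDeriv_dUp hρ)
  have h0 : HasMatDeriv (fun s => mat (ρ (slUp ((t : ℂ) ^ 2 * s)))) (((t : ℂ) ^ 2 * 1) • dUp ρ) 0 :=
    HasMatDeriv.comp (P := fun s => mat (ρ (slUp s))) (f := fun s => (t : ℂ) ^ 2 * s)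
      (by rw [mul_zero]; exact hasMatDeriv_dUp hρ) ((hasDerivAt_id (0 : ℂ)).const_mul _)
  have h2 := h0.mul (HasMatDeriv.const (mat (ρ (slDiag t))) 0)
  have := h1.unique h2 (Filter.Eventually.of_forall fun s => by
    rw [← mat_mul, ← mat_mul, ← map_mul, ← map_mul, slDiag_mul_slUp])
  simpa using this

theorem slDiag_mul_dLow (hρ : IsAlgebraicHom ρ) (t : ℂˣ) :
    (t ^ 2 : ℂ) • (mat (ρ (slDiag t)) * dLow ρ) = dLow ρ * mat (ρ (slDiag t)) := by
  have h1 := (hasMatDeriv_dLow hρ).mul (HasMatDeriv.const (mat (ρ (slDiag t))) 0)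
  have h0 : HasMatDeriv (fun s => mat (ρ (slLow ((t : ℂ) ^ 2 * s)))) (((t : ℂ) ^ 2 * 1) • dLow ρ) 0 :=
    HasMatDeriv.comp (P := fun s => mat (ρ (slLow s))) (f := fun s => (t : ℂ) ^ 2 * s)
      (by rw [mul_zero]; exact hasMatDeriv_dLow hρ) ((hasDerivAt_id (0 : ℂ)).const_mul _)
  have h2 := (HasMatDeriv.const (mat (ρ (slDiag t))) 0).mul h0
  have := h2.unique h1 (Filter.Eventually.of_forall fun s => by
    rw [← mat_mul, ← mat_mul, ← map_mul, ← map_mul, slDiag_mul_slLow])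
  simpa using this

/-- The Gauss decomposition in the big cell. Its derivatives yield the relation [E, F] = H without
any general theory of Lie groups. -/
theorem slUp_mul_slLow (s t : ℂ) (c : ℂˣ) (hc : (c : ℂ) = 1 + s * t) :
    slUp s * slLow t = slLow (t / (1 + s * t)) * slDiag c * slUp (s / (1 + s * t)) := by
  have h : 1 + s * t ≠ 0 := by rw [← hc]; exact c.ne_zero
  have h' : 1 + t * s ≠ 0 := by rwa [mul_comm]
  refine Subtype.ext ?_
  change (slUp _).1 * (slLow _).1 = (slLow _).1 * (slDiag c).1 * (slUp _).1
  ext i j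
  fin_cases i <;> fin_cases j <;>
    simp [slLow, slDiag, slUp, Matrix.mul_apply, Fin.sum_univ_two, hc] <;> field_simp <;> ring

/-- The commutation relation of the differential of `ρ`. -/
theorem dUp_mul_dLow (hρ : IsAlgebraicHom ρ) {D : ℂ → Matrix (Fin 7) (Fin 7) ℂ}
    {H : Matrix (Fin 7) (Fin 7) ℂ} (hD : ∀ t : ℂˣ, mat (ρ (slDiag t)) = D t)
    (hH : HasMatDeriv D H 1) : dUp ρ * dLow ρ = dLow ρ * dUp ρ + H := by
  have hadd : ∀ s t, ρ (slLow (s + t)) = ρ (slLow s) * ρ (slLow t) := fun s t => by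
    rw [slLow_add, map_mul]
  have hD1 : D 1 = 1 := by
    have : slDiag 1 = 1 := by
      ext i j
      fin_cases i <;> fin_cases j <;> simp [slDiag]
    rw [← Units.val_one, ← hD, this, map_one, mat_one]
  -- The Gauss decomposition is differentiated in s at 0 for fixed t; differentiating the result in
  -- t at 0 then gives the relation.
  have step : ∀ t, dUp ρ * mat (ρ (slLow t)) =
      mat (ρ (slLow t)) * ((-(t ^ 2)) • dLow ρ + t • H + dUp ρ) := by
    intro t
    have hden : HasDerivAt (fun s : ℂ => 1 + s * t) t 0 := by
      simpa using ((hasDerivAt_id (0 : ℂ)).mul_const t).const_add 1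
    have hf : HasDerivAt (fun s : ℂ => t / (1 + s * t)) (-(t ^ 2)) 0 := by
      have := (hasDerivAt_const (0 : ℂ) t).fun_div hden (by simp)
      simpa [sq] using this
    have hg : HasDerivAt (fun s : ℂ => s / (1 + s * t)) 1 0 := by
      have := (hasDerivAt_id' (0 : ℂ)).fun_div hden (by simp)
      simpa using this
    have h1 := (hasMatDeriv_dUp hρ).mul (HasMatDeriv.const (mat (ρ (slLow t))) 0)
    have hL : HasMatDeriv (fun s => mat (ρ (slLow (t / (1 + s * t)))))
        ((-(t ^ 2)) • (mat (ρ (slLow t)) * dLow ρ)) 0 :=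
      HasMatDeriv.comp (P := fun s => mat (ρ (slLow s))) (f := fun s => t / (1 + s * t))
        (by simpa using hasMatDeriv_of_add (hasMatDeriv_dLow hρ) hadd t) hf
    have hM : HasMatDeriv (fun s => D (1 + s * t)) (t • H) 0 :=
      HasMatDeriv.comp (P := D) (f := fun s => 1 + s * t) (by simpa using hH) hden
    have hU : HasMatDeriv (fun s => mat (ρ (slUp (s / (1 + s * t))))) ((1 : ℂ) • dUp ρ) 0 :=
      HasMatDeriv.comp (P := fun s => mat (ρ (slUp s))) (f := fun s => s / (1 + s * t))
        (by simpa using hasMatDeriv_dUp hρ) hg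
    have h2 := (hL.mul hM).mul hU
    have hev : ∀ᶠ s in nhds (0 : ℂ), 1 + s * t ≠ 0 :=
      hden.continuousAt.eventually_ne (by simp)
    have h3 := h1.unique h2 (by
      filter_upwards [hev] with s hs
      have := slUp_mul_slLow s t (Units.mk0 _ hs) rfl
      rw [← Units.val_mk0 hs, ← hD, ← mat_mul, ← mat_mul, ← mat_mul, ← map_mul, ← map_mul,
        ← map_mul, this]
      rfl)
    simp only [zero_mul, zero_div, add_zero, div_one, slUp_zero, map_one, mat_one, mul_zero,
      mul_one, one_smul, hD1] at h3
    rw [h3, mul_add, mul_add, Matrix.mul_smul, Matrix.mul_smul]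
  have h1 := (HasMatDeriv.const (dUp ρ) 0).mul (hasMatDeriv_dLow hρ)
  have h2 : HasMatDeriv (fun t : ℂ => (-(t ^ 2)) • dLow ρ + t • H + dUp ρ) H 0 := fun i j => by
    have ha : HasDerivAt (fun t : ℂ => -(t ^ 2)) 0 0 := by
      simpa using ((hasDerivAt_id' (0 : ℂ)).fun_pow 2).fun_neg
    have := ((ha.mul_const (dLow ρ i j)).add ((hasDerivAt_id (0 : ℂ)).mul_const (H i j))).add_const
      (dUp ρ i j)
    simpa using this
  have h3 := h1.unique ((hasMatDeriv_dLow hρ).mul h2) (Filter.Eventually.of_forall step)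
  simpa [slLow_zero, mat_one] using h3

end

/-! ### Weights of the diagonal torus and simultaneous conjugation into the maximal torus -/

noncomputable section

variable {ρ : SpecialLinearGroup (Fin 2) ℂ →* G2}

/-- The matrix is a derivation of the commutator of trace zero split octonions. -/
def IsBracketDerivation (E : Matrix (Fin 7) (Fin 7) ℂ) : Prop :=
  ∀ X Y, E *ᵥ bracket X Y = bracket (E *ᵥ X) Y + bracket X (E *ᵥ Y)

theorem isBracketDerivation_dUp (hρ : IsAlgebraicHom ρ) : IsBracketDerivation (dUp ρ) :=
  differential_bracket (by rw [slUp_zero, map_one]) (hasMatDeriv_dUp hρ)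

theorem isBracketDerivation_dLow (hρ : IsAlgebraicHom ρ) : IsBracketDerivation (dLow ρ) :=
  differential_bracket (by rw [slLow_zero, map_one]) (hasMatDeriv_dLow hρ)

theorem commute_dUp (hρ : IsAlgebraicHom ρ) {A : Matrix (Fin 7) (Fin 7) ℂ}
    (hA : ∀ x, A * mat (ρ x) = mat (ρ x) * A) : A * dUp ρ = dUp ρ * A := by
  have h := ((HasMatDeriv.const A 0).mul (hasMatDeriv_dUp hρ)).unique
    ((hasMatDeriv_dUp hρ).mul (HasMatDeriv.const A 0))
    (Filter.Eventually.of_forall fun s => hA _)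
  simpa using h

/-- The conjugate of a homomorphism. -/
def conjHom (g : G2) (ρ : SpecialLinearGroup (Fin 2) ℂ →* G2) : SpecialLinearGroup (Fin 2) ℂ →* G2 :=
  (MulAut.conj g).toMonoidHom.comp ρ

theorem conjHom_apply (g : G2) (x : SpecialLinearGroup (Fin 2) ℂ) :
    conjHom g ρ x = g * ρ x * g⁻¹ := rfl

theorem isAlgebraicHom_conjHom (hρ : IsAlgebraicHom ρ) (g : G2) : IsAlgebraicHom (conjHom g ρ) := by
  intro i j
  have e : (fun x => mat (conjHom g ρ x) i j) =
      fun x => ∑ l, (∑ k, mat g i k * mat (ρ x) k l) * mat g⁻¹ l j := by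
    ext x
    rw [conjHom_apply, mat_mul, mat_mul, Matrix.mul_apply]
    simp only [Matrix.mul_apply]
  rw [e]
  exact regular_sum _ _ fun l _ => regular_mul (regular_sum _ _ fun k _ =>
    regular_mul (regular_const _) (hρ k l)) (regular_const _)

theorem dUp_eq_of_hasMatDeriv {E : Matrix (Fin 7) (Fin 7) ℂ}
    (h : HasMatDeriv (fun t => mat (ρ (slUp t))) E 0) : dUp ρ = E := by
  ext i j
  exact (h i j).deriv

theorem dLow_eq_of_hasMatDeriv {E : Matrix (Fin 7) (Fin 7) ℂ}
    (h : HasMatDeriv (fun t => mat (ρ (slLow t))) E 0) : dLow ρ = E := by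
  ext i j
  exact (h i j).deriv

theorem dUp_conjHom (hρ : IsAlgebraicHom ρ) (g : G2) :
    dUp (conjHom g ρ) = mat g * dUp ρ * mat g⁻¹ := by
  refine dUp_eq_of_hasMatDeriv ?_
  have := ((HasMatDeriv.const (mat g) 0).mul (hasMatDeriv_dUp hρ)).mul
    (HasMatDeriv.const (mat g⁻¹) 0)
  simpa [conjHom_apply, mat_mul] using this

theorem dLow_conjHom (hρ : IsAlgebraicHom ρ) (g : G2) :
    dLow (conjHom g ρ) = mat g * dLow ρ * mat g⁻¹ := by
  refine dLow_eq_of_hasMatDeriv ?_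
  have := ((HasMatDeriv.const (mat g) 0).mul (hasMatDeriv_dLow hρ)).mul
    (HasMatDeriv.const (mat g⁻¹) 0)
  simpa [conjHom_apply, mat_mul] using this

/-- Linear independence of the characters t ↦ t^k, which are distinct because their values at 2 have
different absolute values. -/
theorem eq_zero_of_sum_zpow {s : Finset ℤ} {c : ℤ → ℂ}
    (h : ∀ t : ℂˣ, ∑ k ∈ s, c k * ((t ^ k : ℂˣ) : ℂ) = 0) : ∀ k ∈ s, c k = 0 := by
  let χ : ℤ → (ℂˣ →* ℂ) := fun k => (Units.coeHom ℂ).comp (zpowGroupHom k)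
  have hχ : Function.Injective χ := by
    intro k l hkl
    have h2 := DFunLike.congr_fun hkl (Units.mk0 2 two_ne_zero)
    have h3 : (2 : ℂ) ^ k = 2 ^ l := by simpa [χ] using h2
    have h4 : (2 : ℝ) ^ k = 2 ^ l := by simpa using congrArg norm h3
    exact zpow_right_injective₀ two_pos (by norm_num) h4
  have hli := (linearIndependent_monoidHom ℂˣ ℂ).comp χ hχ
  refine linearIndependent_iff'.1 hli s c ?_
  ext t
  simpa [χ, Finset.sum_apply] using h t

/-- The decomposition of the space with respect to the weights of the diagonal torus of `SL₂(ℂ)`. -/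
theorem exists_weight_projections (hρ : IsAlgebraicHom ρ) :
    ∃ (s : Finset ℤ) (D : ℤ → Matrix (Fin 7) (Fin 7) ℂ),
      (∑ k ∈ s, D k = 1) ∧
      (∀ t : ℂˣ, ∀ k ∈ s, mat (ρ (slDiag t)) * D k = ((t ^ k : ℂˣ) : ℂ) • D k) ∧
      ∀ A : Matrix (Fin 7) (Fin 7) ℂ, (∀ t, A * mat (ρ (slDiag t)) = mat (ρ (slDiag t)) * A) →
        ∀ k ∈ s, A * D k = D k * A := by
  have hp : ∀ i j, ∃ p : ℤ →₀ ℂ, ∀ t : ℂˣ, mat (ρ (slDiag t)) i j =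
      p.sum fun k c => c * ((t ^ k : ℂˣ) : ℂ) := fun i j => exists_laurent_slDiag (hρ i j)
  choose p hp using hp
  let s : Finset ℤ := Finset.univ.biUnion fun i => Finset.univ.biUnion fun j => (p i j).support
  let D : ℤ → Matrix (Fin 7) (Fin 7) ℂ := fun k => Matrix.of fun i j => p i j k
  have hD : ∀ t, mat (ρ (slDiag t)) = ∑ k ∈ s, ((t ^ k : ℂˣ) : ℂ) • D k := by
    intro t
    ext i j
    rw [hp, Matrix.sum_apply, Finsupp.sum_of_support_subset (s := s)]
    · exact Finset.sum_congr rfl fun k _ => mul_comm _ _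
    · exact (Finset.subset_biUnion_of_mem (fun j => (p i j).support) (Finset.mem_univ j)).trans
        (Finset.subset_biUnion_of_mem (fun i => Finset.univ.biUnion fun j => (p i j).support)
          (Finset.mem_univ i))
    · simp
  -- Comparison of coefficients of matrix-valued Laurent polynomials. All claims about the
  -- coefficients D k follow from it: the D k are the projections to the weight spaces.
  have hz : ∀ (A : ℤ → Matrix (Fin 7) (Fin 7) ℂ),
      (∀ t : ℂˣ, ∑ k ∈ s, ((t ^ k : ℂˣ) : ℂ) • A k = 0) → ∀ k ∈ s, A k = 0 := by
    intro A hA k hk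
    ext i j
    refine eq_zero_of_sum_zpow (c := fun k => A k i j) (fun t => ?_) k hk
    have := congrFun (congrFun (hA t) i) j
    simpa [Matrix.sum_apply, mul_comm] using this
  refine ⟨s, D, ?_, fun t k hk => ?_, fun A hA k hk => ?_⟩
  · have h1 : slDiag 1 = 1 := by
      ext i j
      fin_cases i <;> fin_cases j <;> simp [slDiag]
    have := hD 1
    rw [h1, map_one, mat_one] at this
    simpa using this.symm
  · have := hz (fun k => mat (ρ (slDiag t)) * D k - ((t ^ k : ℂˣ) : ℂ) • D k) (fun u => ?_) k hk
    · exact sub_eq_zero.1 this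
    · have h1 : slDiag (t * u) = slDiag t * slDiag u := by
        refine Subtype.ext ?_
        change (slDiag (t * u)).1 = (slDiag t).1 * (slDiag u).1
        ext i j
        fin_cases i <;> fin_cases j <;> simp [slDiag, Matrix.mul_apply, mul_comm]
      have h2 := hD (t * u)
      rw [h1, map_mul, mat_mul, hD u, Matrix.mul_sum] at h2
      simp only [smul_sub, Finset.sum_sub_distrib, sub_eq_zero]
      simp only [Matrix.mul_smul] at h2
      rw [h2]
      refine Finset.sum_congr rfl fun k _ => ?_
      rw [smul_smul, mul_zpow, Units.val_mul, mul_comm]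
  · have := hz (fun k => A * D k - D k * A) (fun u => ?_) k hk
    · exact sub_eq_zero.1 this
    · have h2 := hA u
      rw [hD, Matrix.mul_sum, Matrix.sum_mul] at h2
      simp only [smul_sub, Finset.sum_sub_distrib, sub_eq_zero]
      simpa using h2

/-- A vector in an eigenspace in which only one weight occurs is a weight vector. -/
theorem exists_weight_of_eigenvector (hρ : IsAlgebraicHom ρ) {A : Matrix (Fin 7) (Fin 7) ℂ}
    (hA : ∀ t, A * mat (ρ (slDiag t)) = mat (ρ (slDiag t)) * A) {μ : ℂ} {e : Fin 7 → ℂ}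
    (he : A *ᵥ e = μ • e) (he0 : e ≠ 0)
    (hsep : ∀ (k l : ℤ) (v w : Fin 7 → ℂ), v ≠ 0 → w ≠ 0 →
      (∀ t : ℂˣ, mat (ρ (slDiag t)) *ᵥ v = ((t ^ k : ℂˣ) : ℂ) • v) →
      (∀ t : ℂˣ, mat (ρ (slDiag t)) *ᵥ w = ((t ^ l : ℂˣ) : ℂ) • w) →
      A *ᵥ v = μ • v → A *ᵥ w = μ • w → k = l) :
    ∃ k : ℤ, ∀ t : ℂˣ, mat (ρ (slDiag t)) *ᵥ e = ((t ^ k : ℂˣ) : ℂ) • e := by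
  obtain ⟨s, D, hsum, hD, hcomm⟩ := exists_weight_projections hρ
  have he' : e = ∑ k ∈ s, D k *ᵥ e := by
    rw [← Matrix.sum_mulVec, hsum, Matrix.one_mulVec]
  have h1 : ∀ k ∈ s, ∀ t : ℂˣ, mat (ρ (slDiag t)) *ᵥ (D k *ᵥ e) = ((t ^ k : ℂˣ) : ℂ) • D k *ᵥ e :=
    fun k hk t => by rw [Matrix.mulVec_mulVec, hD t k hk, Matrix.smul_mulVec]
  have h2 : ∀ k ∈ s, A *ᵥ (D k *ᵥ e) = μ • D k *ᵥ e := fun k hk => by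
    rw [Matrix.mulVec_mulVec, hcomm A hA k hk, ← Matrix.mulVec_mulVec, he, Matrix.mulVec_smul]
  obtain ⟨k, hk, hke⟩ : ∃ k ∈ s, D k *ᵥ e ≠ 0 := by
    by_contra! h
    exact he0 (by rw [he', Finset.sum_eq_zero h])
  refine ⟨k, fun t => ?_⟩
  have : e = D k *ᵥ e := by
    conv_lhs => rw [he']
    -- By the separation hypothesis, no second weight component of e can be nonzero.
    refine Finset.sum_eq_single k (fun l hl hlk => ?_) (fun h => absurd hk h)
    by_contra hne
    exact hlk (hsep l k _ _ hne hke (h1 l hl) (h1 k hk) (h2 l hl) (h2 k hk))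
  rw [this, h1 k hk]

/-- The weights on the trace zero split octonions of the torus element with first weights
`a`, `b`, additively. -/
def coweights (a b : ℤ) : Fin 7 → ℤ := ![a, b, a - b, 0, b - a, -b, -a]

theorem mHat_zpow_eq (a b : ℤ) (t : ℂˣ) :
    mat (mHat (t ^ a, t ^ b)) = diagonal fun i => ((t ^ coweights a b i : ℂˣ) : ℂ) := by
  rw [mat_mHat]
  congr 1
  ext i
  fin_cases i <;> simp [torusWeights, coweights, zpow_sub₀, _root_.zpow_neg, div_eq_mul_inv]

theorem diagonal_of_weights {d : ℂˣ → G2} {k : Fin 7 → ℤ}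
    (h : ∀ t i, mat (d t) *ᵥ Pi.single i 1 = ((t ^ k i : ℂˣ) : ℂ) • Pi.single i 1) (t : ℂˣ) :
    d t = mHat (t ^ k 0, t ^ k 1) := by
  have hdiag : mat (d t) = diagonal fun i => ((t ^ k i : ℂˣ) : ℂ) := by
    refine eq_of_mulVec fun X => ?_
    rw [← Finset.univ_sum_single X, Matrix.mulVec_sum, Matrix.mulVec_sum]
    refine Finset.sum_congr rfl fun i _ => ?_
    have : (Pi.single i (X i) : Fin 7 → ℂ) = X i • Pi.single i 1 := by
      rw [← Pi.single_smul]; simp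
    rw [this, Matrix.mulVec_smul, Matrix.mulVec_smul, h, Matrix.diagonal_mulVec_single,
      ← Pi.single_smul]
    simp
  obtain ⟨z, hz⟩ := exists_mHat_eq hdiag
  have h0 : (z.1 : ℂ) = ((t ^ k 0 : ℂˣ) : ℂ) := by
    have := congrFun (congrFun (hdiag.symm.trans (by rw [hz, mat_mHat])) 0) 0
    simpa [torusWeights] using this.symm
  have h1 : (z.2 : ℂ) = ((t ^ k 1 : ℂˣ) : ℂ) := by
    have := congrFun (congrFun (hdiag.symm.trans (by rw [hz, mat_mHat])) 1) 1
    simpa [torusWeights] using this.symm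
  rw [hz]
  congr 1
  exact Prod.ext (Units.ext h0) (Units.ext h1)

theorem finite_eigenvalues (A : Matrix (Fin 7) (Fin 7) ℂ) :
    {μ : ℂ | ∃ v ≠ 0, A *ᵥ v = μ • v}.Finite := by
  refine (Module.End.finite_hasEigenvalue (Matrix.toLin' A)).subset ?_
  rintro μ ⟨v, hv, h⟩
  exact Module.End.hasEigenvalue_of_hasEigenvector ⟨Module.End.mem_eigenspace_iff.2 h, hv⟩

/-- A semisimple element that commutes with an algebraic homomorphism can be conjugated to the
torus together with the image of the diagonal torus. -/
theorem exists_conj_torus (hρ : IsAlgebraicHom ρ) {s : G2} (hs : IsSemisimpleElt s)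
    (hc : ∀ x, Commute s (ρ x)) :
    ∃ (g : G2) (z : ℂˣ × ℂˣ) (a b : ℤ), g * s * g⁻¹ = mHat z ∧
      ∀ t : ℂˣ, conjHom g ρ (slDiag t) = mHat (t ^ a, t ^ b) := by
  let K : Set ℂ := {μ : ℂ | ∃ v ≠ 0, mat s *ᵥ v = μ • v}
  have hK : K.Finite := finite_eigenvalues _
  -- B bounds the absolute values of all ratios of eigenvalues of s. With t₀ = r > B, an eigenvalue
  -- of s ρ(diag(t₀, t₀⁻¹)) determines the weight: two weights with l > k would give a ratio r^(l -
  -- k) > B.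
  obtain ⟨B, hB⟩ := ((hK.prod hK).image fun p => ‖p.1 / p.2‖).bddAbove
  obtain ⟨r, hr1, hrB⟩ : ∃ r : ℝ, 1 < r ∧ B < r := ⟨max 1 B + 1, by
    have := le_max_left 1 B; linarith, by have := le_max_right 1 B; linarith⟩
  have hr0 : (r : ℂ) ≠ 0 := Complex.ofReal_ne_zero.2 (by linarith)
  let t₀ : ℂˣ := Units.mk0 r hr0
  have hcm : ∀ x, mat s * mat (ρ x) = mat (ρ x) * mat s := fun x => by
    rw [← mat_mul, (hc x).eq, mat_mul]
  have hlt : ∀ (k l : ℤ) (v w : Fin 7 → ℂ) (μ : ℂ), v ≠ 0 → w ≠ 0 →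
      (∀ t : ℂˣ, mat (ρ (slDiag t)) *ᵥ v = ((t ^ k : ℂˣ) : ℂ) • v) →
      (∀ t : ℂˣ, mat (ρ (slDiag t)) *ᵥ w = ((t ^ l : ℂˣ) : ℂ) • w) →
      mat (s * ρ (slDiag t₀)) *ᵥ v = μ • v → mat (s * ρ (slDiag t₀)) *ᵥ w = μ • w → l ≤ k := by
    intro k l v w μ hv hw hkv hlw hsv hsw
    by_contra! hkl
    have hz : ∀ n : ℤ, ((t₀ ^ n : ℂˣ) : ℂ) ≠ 0 := fun n => Units.ne_zero _
    have aux : ∀ (n : ℤ) (x : Fin 7 → ℂ),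
        (∀ t : ℂˣ, mat (ρ (slDiag t)) *ᵥ x = ((t ^ n : ℂˣ) : ℂ) • x) →
        mat (s * ρ (slDiag t₀)) *ᵥ x = μ • x →
        mat s *ᵥ x = (μ / ((t₀ ^ n : ℂˣ) : ℂ)) • x := fun n x h h' => by
      rw [mat_mul, ← Matrix.mulVec_mulVec, h, Matrix.mulVec_smul] at h'
      rw [div_eq_inv_mul, mul_smul, eq_inv_smul_iff₀ (hz n), h']
    have hkK : μ / ((t₀ ^ k : ℂˣ) : ℂ) ∈ K := ⟨v, hv, aux k v hkv hsv⟩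
    have hlK : μ / ((t₀ ^ l : ℂˣ) : ℂ) ∈ K := ⟨w, hw, aux l w hlw hsw⟩
    have hμ : μ ≠ 0 := by
      rintro rfl
      rw [zero_smul] at hsv
      exact hv (mat_mulVec_injective (s * ρ (slDiag t₀)) (by
        change _ = mat _ *ᵥ 0
        rw [Matrix.mulVec_zero]; exact hsv))
    have h1 := hB ⟨(_, _), ⟨hkK, hlK⟩, rfl⟩
    have h2 : μ / ((t₀ ^ k : ℂˣ) : ℂ) / (μ / ((t₀ ^ l : ℂˣ) : ℂ)) = (r : ℂ) ^ (l - k) := by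
      have := hz k
      have := hz l
      have e : (r : ℂ) ^ (l - k) = ((t₀ ^ l : ℂˣ) : ℂ) / ((t₀ ^ k : ℂˣ) : ℂ) := by
        rw [zpow_sub₀ hr0]; simp [t₀]
      rw [e]
      field_simp
    simp only [h2] at h1
    rw [norm_zpow, Complex.norm_real, Real.norm_of_nonneg (by linarith)] at h1
    have h3 : r ^ (1 : ℤ) ≤ r ^ (l - k) := zpow_le_zpow_right₀ hr1.le (by omega)
    rw [zpow_one] at h3
    linarith
  have hcomm0 : ∀ t, mat (s * ρ (slDiag t₀)) * mat (ρ (slDiag t)) =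
      mat (ρ (slDiag t)) * mat (s * ρ (slDiag t₀)) := fun t => by
    rw [← mat_mul, ← mat_mul]
    congr 1
    have h1 : slDiag t₀ * slDiag t = slDiag t * slDiag t₀ := by
      refine Subtype.ext ?_
      change (slDiag t₀).1 * (slDiag t).1 = (slDiag t).1 * (slDiag t₀).1
      ext i j
      fin_cases i <;> fin_cases j <;> simp [slDiag, Matrix.mul_apply, mul_comm]
    rw [mul_assoc, ← map_mul, h1, map_mul, ← mul_assoc, (hc _).eq, mul_assoc]
  -- The weight projections commute with s, so they split each eigenvector of s into common
  -- eigenvectors of s and the diagonal torus.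
  have hspan : Submodule.span ℂ (eigenvectors (mat (s * ρ (slDiag t₀)))) = ⊤ := by
    obtain ⟨S, D, hsum, hD, hDc⟩ := exists_weight_projections hρ
    rw [eq_top_iff, ← hs.span_eigenvectors, Submodule.span_le]
    rintro v ⟨μ, hv⟩
    have : v = ∑ k ∈ S, D k *ᵥ v := by
      rw [← Matrix.sum_mulVec, hsum, Matrix.one_mulVec]
    rw [SetLike.mem_coe, this]
    refine Submodule.sum_mem _ fun k hk => Submodule.subset_span
      ⟨((t₀ ^ k : ℂˣ) : ℂ) * μ, ?_⟩
    rw [mat_mul, ← Matrix.mulVec_mulVec, Matrix.mulVec_mulVec _ (mat (ρ _)), hD _ k hk,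
      Matrix.smul_mulVec, Matrix.mulVec_smul, Matrix.mulVec_mulVec, hDc _ (fun t => hcm _) k hk,
      ← Matrix.mulVec_mulVec, hv, Matrix.mulVec_smul, smul_smul]
  obtain ⟨g, z, hgz⟩ := exists_conj_mHat hspan
  -- The basis of eigenvectors found for the single product consists of weight vectors, so the same
  -- conjugation makes the whole diagonal torus diagonal, and s as well.
  have hweight : ∀ i, ∃ k : ℤ, ∀ t : ℂˣ,
      mat (ρ (slDiag t)) *ᵥ (mat g⁻¹ *ᵥ Pi.single i 1) =
        ((t ^ k : ℂˣ) : ℂ) • mat g⁻¹ *ᵥ Pi.single i 1 := by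
    intro i
    refine exists_weight_of_eigenvector hρ hcomm0 (μ := torusWeights z i) ?_ ?_ ?_
    · have : s * ρ (slDiag t₀) = g⁻¹ * mHat z * g := by rw [← hgz]; group
      rw [this, mat_mul, mat_mul, ← Matrix.mulVec_mulVec, mat_mulVec_inv, ← Matrix.mulVec_mulVec,
        mat_mHat, Matrix.diagonal_mulVec_single, ← Matrix.mulVec_smul]
      congr 1
      rw [← Pi.single_smul, smul_eq_mul]
    · intro h0
      have h1 := mat_mulVec_inv g (Pi.single i 1)
      rw [h0, Matrix.mulVec_zero] at h1
      simpa using congrFun h1 i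
    · intro k l v w hv hw h1 h2 h3 h4
      exact le_antisymm (hlt l k w v _ hw hv h2 h1 h4 h3) (hlt k l v w _ hv hw h1 h2 h3 h4)
  choose k hk using hweight
  have hdiag : ∀ t : ℂˣ, conjHom g ρ (slDiag t) = mHat (t ^ k 0, t ^ k 1) :=
    diagonal_of_weights (d := fun t => conjHom g ρ (slDiag t)) fun t i => by
      rw [conjHom_apply, mat_mul, mat_mul, ← Matrix.mulVec_mulVec, ← Matrix.mulVec_mulVec, hk,
        Matrix.mulVec_smul, mat_mulVec_inv]
  refine ⟨g, z * (t₀ ^ k 0, t₀ ^ k 1)⁻¹, k 0, k 1, ?_, hdiag⟩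
  rw [map_mul, map_inv, ← hdiag, ← hgz, conjHom_apply]
  group

end

/-! ### Coordinates on the Lie algebra of derivations -/

noncomputable section

/-- The general derivation of the commutator of trace zero split octonions, in terms of the entries at the
weights of the adjoint representation. -/
def derivMat (E : Matrix (Fin 7) (Fin 7) ℂ) : Matrix (Fin 7) (Fin 7) ℂ :=
  !![E 0 0, E 0 1, E 0 2, 2 * E 1 4, E 0 4, E 0 5, 0;
     E 1 0, E 1 1, -E 4 5, -2 * E 0 2, E 1 4, 0, -E 0 5;
     E 2 0, -E 5 4, E 0 0-E 1 1, 2 * E 0 1, 0, -E 1 4, -E 0 4;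
     E 4 1, -E 2 0, E 1 0, 0, -E 0 1, E 0 2, -E 1 4;
     E 4 0, E 4 1, 0, -2 * E 1 0, E 1 1-E 0 0, E 4 5, -E 0 2;
     E 5 0, 0, -E 4 1, 2 * E 2 0, E 5 4, -E 1 1, -E 0 1;
     0, -E 5 0, -E 4 0, -2 * E 4 1, -E 2 0, -E 1 0, -E 0 0]

/-- The derivation rule on pairs of basis vectors is a linear system for the 49 entries. The
selected equations suffice to express them by 14: two on the diagonal and one for each root. -/
theorem IsBracketDerivation.eq_of {E : Matrix (Fin 7) (Fin 7) ℂ} (hE : IsBracketDerivation E) :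
    E = derivMat E := by
  have h (i j k : Fin 7) : (E *ᵥ bracket (Pi.single i 1) (Pi.single j 1)) k =
      bracket (E.col i) (Pi.single j 1) k + bracket (Pi.single i 1) (E.col j) k := by
    rw [hE]
    simp [Matrix.mulVec_single_one]
  have h010 := h 0 1 0
  have h011 := h 0 1 1
  have h012 := h 0 1 2
  have h013 := h 0 1 3
  have h014 := h 0 1 4
  have h020 := h 0 2 0
  have h021 := h 0 2 1
  have h022 := h 0 2 2
  have h023 := h 0 2 3
  have h030 := h 0 3 0
  have h031 := h 0 3 1
  have h032 := h 0 3 2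
  have h040 := h 0 4 0
  have h041 := h 0 4 1
  have h042 := h 0 4 2
  have h043 := h 0 4 3
  have h050 := h 0 5 0
  have h051 := h 0 5 1
  have h053 := h 0 5 3
  have h063 := h 0 6 3
  have h120 := h 1 2 0
  have h130 := h 1 3 0
  have h134 := h 1 3 4
  have h140 := h 1 4 0
  have h150 := h 1 5 0
  have h153 := h 1 5 3
  have h160 := h 1 6 0
  have h161 := h 1 6 1
  have h163 := h 1 6 3
  have h230 := h 2 3 0
  have h240 := h 2 4 0
  have h250 := h 2 5 0
  have h260 := h 2 6 0
  have h263 := h 2 6 3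
  have h360 := h 3 6 0
  clear h
  simp [bracket_eq, Matrix.mulVec, dotProduct, Fin.sum_univ_seven] at h010 h011 h012 h013 h014 h020 h021 h022 h023 h030 h031 h032 h040 h041 h042 h043 h050 h051 h053 h063 h120 h130 h134 h140 h150 h153 h160 h161 h163 h230 h240 h250 h260 h263 h360
  ext i j
  fin_cases i <;> fin_cases j <;> simp only [derivMat] <;> simp <;> grind

end

/-! ### The sl₂ relations in root coordinates and homomorphisms with a given cocharacter -/

noncomputable section

/-- In this and the next five results, entries of [E, F] = H are read off in root coordinates. The
two diagonal entries determine the cocharacter; the off-diagonal ones force products of root entries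
to cancel. -/
theorem commutator_zero_zero {E F : Matrix (Fin 7) (Fin 7) ℂ} {d : Fin 7 → ℂ}
    (hE : IsBracketDerivation E) (hF : IsBracketDerivation F) (h : E * F = F * E + diagonal d) :
      E 0 1 * F 1 0 - E 1 0 * F 0 1 + E 0 2 * F 2 0 - E 2 0 * F 0 2 + 2 * (E 1 4 * F 4 1) - 2
        * (E 4 1 * F 1 4) + E 0 4 * F 4 0 - E 4 0 * F 0 4 + E 0 5 * F 5 0 - E 5 0 * F 0 5 = d
        0 := by
  rw [hE.eq_of, hF.eq_of] at h
  have := congrFun (congrFun h 0) 0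
  simp [derivMat, Matrix.mul_apply, Fin.sum_univ_seven] at this
  linear_combination this

theorem commutator_one_one {E F : Matrix (Fin 7) (Fin 7) ℂ} {d : Fin 7 → ℂ}
    (hE : IsBracketDerivation E) (hF : IsBracketDerivation F) (h : E * F = F * E + diagonal d) :
      E 1 0 * F 0 1 - E 0 1 * F 1 0 + E 4 5 * F 5 4 - E 5 4 * F 4 5 + 2 * (E 0 2 * F 2 0) - 2
        * (E 2 0 * F 0 2) + E 1 4 * F 4 1 - E 4 1 * F 1 4 + E 0 5 * F 5 0 - E 5 0 * F 0 5 = d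
        1 := by
  rw [hE.eq_of, hF.eq_of] at h
  have := congrFun (congrFun h 1) 1
  simp [derivMat, Matrix.mul_apply, Fin.sum_univ_seven] at this
  linear_combination this

theorem commutator_zero_one {E F : Matrix (Fin 7) (Fin 7) ℂ} {d : Fin 7 → ℂ}
    (hE : IsBracketDerivation E) (hF : IsBracketDerivation F) (h : E * F = F * E + diagonal d) :
      E 0 0 * F 0 1 - E 0 1 * F 0 0 + E 0 1 * F 1 1 - E 1 1 * F 0 1 - E 0 2 * F 5 4 + E 5 4 *
        F 0 2 - 2 * (E 1 4 * F 2 0) + 2 * (E 2 0 * F 1 4) + E 0 4 * F 4 1 - E 4 1 * F 0 4 = 0 := by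
  rw [hE.eq_of, hF.eq_of] at h
  have := congrFun (congrFun h 0) 1
  simp [derivMat, Matrix.mul_apply, Fin.sum_univ_seven] at this
  linear_combination this

theorem commutator_one_zero {E F : Matrix (Fin 7) (Fin 7) ℂ} {d : Fin 7 → ℂ}
    (hE : IsBracketDerivation E) (hF : IsBracketDerivation F) (h : E * F = F * E + diagonal d) :
      E 1 0 * F 0 0 - E 0 0 * F 1 0 + E 1 1 * F 1 0 - E 1 0 * F 1 1 - E 4 5 * F 2 0 + E 2 0 *
        F 4 5 - 2 * (E 0 2 * F 4 1) + 2 * (E 4 1 * F 0 2) + E 1 4 * F 4 0 - E 4 0 * F 1 4 = 0 := by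
  rw [hE.eq_of, hF.eq_of] at h
  have := congrFun (congrFun h 1) 0
  simp [derivMat, Matrix.mul_apply, Fin.sum_univ_seven] at this
  linear_combination this

theorem commutator_four_five {E F : Matrix (Fin 7) (Fin 7) ℂ} {d : Fin 7 → ℂ}
    (hE : IsBracketDerivation E) (hF : IsBracketDerivation F) (h : E * F = F * E + diagonal d) :
      E 4 0 * F 0 5 - E 0 5 * F 4 0 - 3 * (E 1 0 * F 0 2) + 3 * (E 0 2 * F 1 0) + 2 * (E 1 1 *
        F 4 5) - E 0 0 * F 4 5 - 2 * (E 4 5 * F 1 1) + E 4 5 * F 0 0 = 0 := by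
  rw [hE.eq_of, hF.eq_of] at h
  have := congrFun (congrFun h 4) 5
  simp [derivMat, Matrix.mul_apply, Fin.sum_univ_seven] at this
  linear_combination this

theorem commutator_five_four {E F : Matrix (Fin 7) (Fin 7) ℂ} {d : Fin 7 → ℂ}
    (hE : IsBracketDerivation E) (hF : IsBracketDerivation F) (h : E * F = F * E + diagonal d) :
      E 5 0 * F 0 4 - E 0 4 * F 5 0 - 3 * (E 2 0 * F 0 1) + 3 * (E 0 1 * F 2 0) + 2 * (E 5 4 *
        F 1 1) - E 5 4 * F 0 0 - 2 * (E 1 1 * F 5 4) + E 0 0 * F 5 4 = 0 := by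
  rw [hE.eq_of, hF.eq_of] at h
  have := congrFun (congrFun h 5) 4
  simp [derivMat, Matrix.mul_apply, Fin.sum_univ_seven] at this
  linear_combination this

/-- The positions of the root spaces of the adjoint representation in the derivation matrices. -/
def rootPositions : Finset (Fin 7 × Fin 7) :=
  {(4, 5), (0, 4), (0, 5), (0, 1), (1, 4), (0, 2), (5, 4), (4, 0), (5, 0), (1, 0), (4, 1), (2, 0)}

theorem IsBracketDerivation.ext {E E' : Matrix (Fin 7) (Fin 7) ℂ} (hE : IsBracketDerivation E)
    (hE' : IsBracketDerivation E') (h0 : E 0 0 = E' 0 0) (h1 : E 1 1 = E' 1 1)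
    (h : ∀ p ∈ rootPositions, E p.1 p.2 = E' p.1 p.2) : E = E' := by
  simp only [rootPositions, Finset.mem_insert, Finset.mem_singleton, forall_eq_or_imp,
    forall_eq] at h
  obtain ⟨h2, h3, h4, h5, h6, h7, h8, h9, h10, h11, h12, h13⟩ := h
  rw [hE.eq_of, hE'.eq_of]
  simp only [derivMat, h0, h1, h2, h3, h4, h5, h6, h7, h8, h9, h10, h11, h12, h13]

variable {ρ ρ' : SpecialLinearGroup (Fin 2) ℂ →* G2} {a b : ℤ}

/-- The homomorphism is algebraic and maps `diag(t, t⁻¹)` to `m̂(t^a, t^b)`. -/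
structure HasCocharacter (ρ : SpecialLinearGroup (Fin 2) ℂ →* G2) (a b : ℤ) : Prop where
  algebraic : IsAlgebraicHom ρ
  slDiag : ∀ t : ℂˣ, ρ (slDiag t) = mHat (t ^ a, t ^ b)

/-- It suffices to evaluate the torus at t = 2 and compare absolute values of powers of 2. -/
theorem coweights_of_semicommute {E : Matrix (Fin 7) (Fin 7) ℂ} {n : ℤ}
    (h : mat (mHat ((Units.mk0 2 two_ne_zero) ^ a, (Units.mk0 2 two_ne_zero) ^ b)) * E =
      (2 : ℂ) ^ n • (E * mat (mHat ((Units.mk0 2 two_ne_zero) ^ a, (Units.mk0 2 two_ne_zero) ^ b))))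
    {i j : Fin 7} (hij : E i j ≠ 0) : coweights a b i = n + coweights a b j := by
  have h1 := congrFun (congrFun h i) j
  rw [mHat_zpow_eq, Matrix.diagonal_mul, Matrix.smul_apply, Matrix.mul_diagonal] at h1
  have h2 : (2 : ℂ) ^ coweights a b i = 2 ^ (n + coweights a b j) := by
    rw [zpow_add₀ two_ne_zero]
    refine mul_right_cancel₀ hij ?_
    simp only [Units.val_zpow_eq_zpow_val, Units.val_mk0, smul_eq_mul] at h1
    linear_combination h1
  have h3 : (2 : ℝ) ^ coweights a b i = 2 ^ (n + coweights a b j) := by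
    simpa using congrArg norm h2
  exact zpow_right_injective₀ two_pos (by norm_num) h3

namespace HasCocharacter

theorem dUp_ne_zero (h : HasCocharacter ρ a b) {i j : Fin 7} (hij : dUp ρ i j ≠ 0) :
    coweights a b i = 2 + coweights a b j := by
  refine coweights_of_semicommute (E := dUp ρ) ?_ hij
  have := slDiag_mul_dUp h.algebraic (Units.mk0 2 two_ne_zero)
  rw [h.slDiag] at this
  simpa using this

theorem dLow_ne_zero (h : HasCocharacter ρ a b) {i j : Fin 7} (hij : dLow ρ i j ≠ 0) :
    coweights a b i = -2 + coweights a b j := by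
  refine coweights_of_semicommute (E := dLow ρ) ?_ hij
  have := slDiag_mul_dLow h.algebraic (Units.mk0 2 two_ne_zero)
  rw [h.slDiag] at this
  rw [← this, smul_smul]
  simp

theorem commutator (h : HasCocharacter ρ a b) :
    dUp ρ * dLow ρ = dLow ρ * dUp ρ + diagonal fun i => (coweights a b i : ℂ) := by
  refine dUp_mul_dLow h.algebraic (D := fun t => diagonal fun i => t ^ coweights a b i)
    (fun t => ?_) fun i j => ?_
  · rw [h.slDiag, mHat_zpow_eq]
    simp
  · by_cases hij : i = j
    · subst hij
      simpa using hasDerivAt_zpow (coweights a b i) (1 : ℂ) (Or.inl one_ne_zero)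
    · simpa [hij] using hasDerivAt_const (1 : ℂ) (0 : ℂ)

/-- The differential determines the homomorphism, and its raising and lowering parts have entries
only at weights 2 and -2; the diagonal entries of these parts vanish because they have weight 0. -/
theorem hom_ext (h : HasCocharacter ρ a b) (h' : HasCocharacter ρ' a b)
    (hU : ∀ p ∈ rootPositions, coweights a b p.1 = 2 + coweights a b p.2 →
      dUp ρ p.1 p.2 = dUp ρ' p.1 p.2)
    (hL : ∀ p ∈ rootPositions, coweights a b p.1 = -2 + coweights a b p.2 →
      dLow ρ p.1 p.2 = dLow ρ' p.1 p.2) : ρ = ρ' := by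
  have key : ∀ {ρ : SpecialLinearGroup (Fin 2) ℂ →* G2} (h : HasCocharacter ρ a b) {i j : Fin 7},
      coweights a b i ≠ 2 + coweights a b j → dUp ρ i j = 0 := fun h _ _ hne => by
    by_contra hc
    exact hne (h.dUp_ne_zero hc)
  have key' : ∀ {ρ : SpecialLinearGroup (Fin 2) ℂ →* G2} (h : HasCocharacter ρ a b) {i j : Fin 7},
      coweights a b i ≠ -2 + coweights a b j → dLow ρ i j = 0 := fun h _ _ hne => by
    by_contra hc
    exact hne (h.dLow_ne_zero hc)
  refine hom_eq_of_differential h.algebraic h'.algebraic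
    ((isBracketDerivation_dUp h.algebraic).ext (isBracketDerivation_dUp h'.algebraic) ?_ ?_ ?_)
    ((isBracketDerivation_dLow h.algebraic).ext (isBracketDerivation_dLow h'.algebraic) ?_ ?_ ?_)
  · rw [key h (by omega), key h' (by omega)]
  · rw [key h (by omega), key h' (by omega)]
  · intro p hp
    by_cases hc : coweights a b p.1 = 2 + coweights a b p.2
    · exact hU p hp hc
    · rw [key h hc, key h' hc]
  · rw [key' h (by omega), key' h' (by omega)]
  · rw [key' h (by omega), key' h' (by omega)]
  · intro p hp
    by_cases hc : coweights a b p.1 = -2 + coweights a b p.2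
    · exact hL p hp hc
    · rw [key' h hc, key' h' hc]

end HasCocharacter

theorem hasCocharacter_one : HasCocharacter 1 0 0 :=
  ⟨trivial_algebraic, fun t => by simp [← Prod.one_eq_mk]⟩

theorem hasCocharacter_iota10 : HasCocharacter iota10 0 1 := ⟨M10_reg, fun t => mat_injective <| by
  refine eq_of_mulVec fun X => ?_
  rw [mHat_zpow_eq]
  refine (M10_mulVec _ _).trans ?_
  ext i
  fin_cases i <;> simp [coweights, slDiag, Matrix.mulVec_diagonal]⟩

theorem hasCocharacter_iota13 : HasCocharacter iota13 1 0 := ⟨M13_reg, fun t => mat_injective <| by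
  refine eq_of_mulVec fun X => ?_
  rw [mHat_zpow_eq]
  refine (M13_mulVec _ _).trans ?_
  ext i
  fin_cases i <;> simp [coweights, slDiag, Matrix.mulVec_diagonal]⟩

theorem hasCocharacter_iota23 : HasCocharacter iota23 1 1 := ⟨M23_reg, fun t => mat_injective <| by
  refine eq_of_mulVec fun X => ?_
  rw [mHat_zpow_eq]
  refine (M23_mulVec _ _).trans ?_
  ext i
  fin_cases i <;> simp [coweights, slDiag, Matrix.mulVec_diagonal]⟩

theorem hasCocharacter_iota01 : HasCocharacter iota01 1 (-1) := ⟨M01_reg, fun t => mat_injective <| by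
  refine eq_of_mulVec fun X => ?_
  rw [mHat_zpow_eq]
  refine (M01_mulVec _ _).trans ?_
  ext i
  fin_cases i <;> simp [coweights, slDiag, Matrix.mulVec_diagonal]⟩

theorem hasCocharacter_iota12 : HasCocharacter iota12 2 1 := ⟨M12_reg, fun t => mat_injective <| by
  refine eq_of_mulVec fun X => ?_
  rw [mHat_zpow_eq]
  refine (M12_mulVec _ _).trans ?_
  ext i
  fin_cases i <;> simp [coweights, slDiag, Matrix.mulVec_diagonal]⟩

theorem hasCocharacter_iotaA2 : HasCocharacter iotaA2 2 2 := ⟨MA2_reg, fun t => mat_injective <| by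
  refine eq_of_mulVec fun X => ?_
  rw [mHat_zpow_eq]
  refine (MA2_mulVec _ _).trans ?_
  ext i
  fin_cases i <;> simp [coweights, slDiag, Matrix.mulVec_diagonal]⟩

theorem hasCocharacter_iotaD2 : HasCocharacter iotaD2 2 2 := ⟨iotaD2_algebraic, fun t => by
  change iota10 _ * iota12 _ = _
  rw [hasCocharacter_iota10.slDiag, hasCocharacter_iota12.slDiag, ← map_mul]
  congr 1
  ext <;> simp; ring⟩

theorem hasCocharacter_iotaReg : HasCocharacter iotaReg 6 4 := ⟨symSix_reg, fun t => mat_injective <| by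
  rw [mHat_zpow_eq]
  refine ext_of_sexticBasis fun X Y => ?_
  refine (sexticBasis_vecMul_symSix _ _ _).trans ?_
  ext i
  fin_cases i <;> simp [coweights, slDiag, Matrix.vecMul_diagonal, sexticBasis, scl] <;>
    field_simp⟩

end

/-! ### Conjugacy of pairs, the Weyl group and the chamber -/

noncomputable section

variable {ρ ρ' ρ'' : SpecialLinearGroup (Fin 2) ℂ →* G2} {a b : ℤ} {s s' s'' : G2}

/-- The two pairs of an element and a homomorphism are conjugate. -/
def PairConj (s : G2) (ρ : SpecialLinearGroup (Fin 2) ℂ →* G2) (s' : G2)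
    (ρ' : SpecialLinearGroup (Fin 2) ℂ →* G2) : Prop :=
  ∃ g : G2, g * s * g⁻¹ = s' ∧ conjHom g ρ = ρ'

theorem PairConj.refl (s : G2) (ρ : SpecialLinearGroup (Fin 2) ℂ →* G2) : PairConj s ρ s ρ :=
  ⟨1, by simp, by ext1 x; simp [conjHom_apply]⟩

theorem PairConj.trans (h : PairConj s ρ s' ρ') (h' : PairConj s' ρ' s'' ρ'') :
    PairConj s ρ s'' ρ'' := by
  obtain ⟨g, rfl, rfl⟩ := h
  obtain ⟨g', rfl, rfl⟩ := h'
  refine ⟨g' * g, by group, ?_⟩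
  ext1 x
  simp only [conjHom_apply]
  group

theorem PairConj.commute (h : PairConj s ρ s' ρ') (hc : ∀ x, Commute s (ρ x)) (x) :
    Commute s' (ρ' x) := by
  obtain ⟨g, rfl, rfl⟩ := h
  have := (hc x).map (MulAut.conj g).toMonoidHom
  exact this

theorem pairConj_mHat (z w : ℂˣ × ℂˣ) (ρ : SpecialLinearGroup (Fin 2) ℂ →* G2) :
    PairConj (mHat z) ρ (mHat z) (conjHom (mHat w) ρ) :=
  ⟨mHat w, by rw [← map_mul, mul_comm, map_mul, mul_inv_cancel_right], rfl⟩

/-! ### Conjugation by elements of the Weyl group -/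

theorem slWeyl_iota01_mHat (z : ℂˣ × ℂˣ) :
    iota01 slWeyl * mHat z * (iota01 slWeyl)⁻¹ = mHat (z.2, z.1) := by
  rw [mul_inv_eq_iff_eq_mul]
  refine mat_injective (eq_of_mulVec fun X => ?_)
  rw [mat_mul, mat_mul, ← Matrix.mulVec_mulVec, ← Matrix.mulVec_mulVec, mat_mHat, mat_mHat]
  refine (M01_mulVec _ _).trans ?_
  change _ = diagonal _ *ᵥ (M01 _ *ᵥ X)
  rw [M01_mulVec]
  ext i
  fin_cases i <;> simp [slWeyl, Matrix.mulVec_diagonal, torusWeights]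

theorem slWeyl_iota10_mHat (z : ℂˣ × ℂˣ) :
    iota10 slWeyl * mHat z * (iota10 slWeyl)⁻¹ = mHat (z.1, z.1 / z.2) := by
  rw [mul_inv_eq_iff_eq_mul]
  refine mat_injective (eq_of_mulVec fun X => ?_)
  rw [mat_mul, mat_mul, ← Matrix.mulVec_mulVec, ← Matrix.mulVec_mulVec, mat_mHat, mat_mHat]
  refine (M10_mulVec _ _).trans ?_
  change _ = diagonal _ *ᵥ (M10 _ *ᵥ X)
  rw [M10_mulVec]
  ext i
  fin_cases i <;> simp [slWeyl, Matrix.mulVec_diagonal, torusWeights, div_eq_mul_inv] <;>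
    field_simp <;> simp

theorem HasCocharacter.conjHom_of (h : HasCocharacter ρ a b) {n : G2} {a' b' : ℤ}
    (hn : ∀ t : ℂˣ, n * mHat (t ^ a, t ^ b) * n⁻¹ = mHat (t ^ a', t ^ b')) :
    HasCocharacter (conjHom n ρ) a' b' :=
  ⟨isAlgebraicHom_conjHom h.algebraic n, fun t => by rw [conjHom_apply, h.slDiag, hn]⟩

theorem HasCocharacter.conjHom_mHat (h : HasCocharacter ρ a b) (w : ℂˣ × ℂˣ) :
    HasCocharacter (conjHom (mHat w) ρ) a b :=
  h.conjHom_of fun t => by rw [← map_mul, mul_comm, map_mul, mul_inv_cancel_right]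

theorem HasCocharacter.exists_swap (h : HasCocharacter ρ a b) (z : ℂˣ × ℂˣ) :
    ∃ ρ', HasCocharacter ρ' b a ∧ PairConj (mHat z) ρ (mHat (z.2, z.1)) ρ' :=
  ⟨conjHom (iota01 slWeyl) ρ, h.conjHom_of fun _ => slWeyl_iota01_mHat _,
    iota01 slWeyl, slWeyl_iota01_mHat z, rfl⟩

theorem HasCocharacter.exists_sub (h : HasCocharacter ρ a b) (z : ℂˣ × ℂˣ) :
    ∃ ρ', HasCocharacter ρ' a (a - b) ∧ PairConj (mHat z) ρ (mHat (z.1, z.1 / z.2)) ρ' :=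
  ⟨conjHom (iota10 slWeyl) ρ, h.conjHom_of fun t => by
    rw [slWeyl_iota10_mHat, _root_.zpow_sub, div_eq_mul_inv],
    iota10 slWeyl, slWeyl_iota10_mHat z, rfl⟩

/-- The closed chamber is where γ̂₁ and γ̂₂ take the nonnegative values 2b - a and a - b. The two
simple reflections act on (a, b) by exchanging the entries and by replacing b with a - b. -/
theorem HasCocharacter.exists_chamber (h : HasCocharacter ρ a b) (z : ℂˣ × ℂˣ) :
    ∃ ρ' a' b' z', HasCocharacter ρ' a' b' ∧ PairConj (mHat z) ρ (mHat z') ρ' ∧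
      b' ≤ a' ∧ a' ≤ 2 * b' := by
  let P : ℤ → ℤ → Prop := fun a b => ∀ ρ z, HasCocharacter ρ a b →
    ∃ ρ' a' b' z', HasCocharacter ρ' a' b' ∧ PairConj (mHat z) ρ (mHat z') ρ' ∧
      b' ≤ a' ∧ a' ≤ 2 * b'
  have h0 : ∀ {a b}, ¬ P a b → ¬ (b ≤ a ∧ a ≤ 2 * b) := fun hP hab => hP fun ρ z hρ =>
    ⟨ρ, _, _, z, hρ, PairConj.refl _ _, hab⟩
  have h1 : ∀ {a b}, ¬ P a b → ¬ P b a := fun hP hP' => hP fun ρ z hρ => by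
    obtain ⟨ρ', hρ', hc⟩ := hρ.exists_swap z
    obtain ⟨ρ'', a', b', z', h1, h2, h3⟩ := hP' _ _ hρ'
    exact ⟨ρ'', a', b', z', h1, hc.trans h2, h3⟩
  have h2 : ∀ {a b}, ¬ P a b → ∀ c, c = a - b → ¬ P a c := fun hP c hc hP' => hP fun ρ z hρ => by
    subst hc
    obtain ⟨ρ', hρ', hc⟩ := hρ.exists_sub z
    obtain ⟨ρ'', a', b', z', h1, h2, h3⟩ := hP' _ _ hρ'
    exact ⟨ρ'', a', b', z', h1, hc.trans h2, h3⟩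
  suffices hP : P a b from hP ρ z h
  -- Alternating the two reflections runs through the twelve Weyl images of (a, b), and not all of
  -- them can avoid the chamber.
  by_contra k1
  have k2 := h1 k1
  have k3 := h2 k2 (b - a) rfl
  have k4 := h1 k3
  have k5 := h2 k4 (-a) (by ring)
  have k6 := h1 k5
  have k7 := h2 k6 (-b) (by ring)
  have k8 := h1 k7
  have k9 := h2 k8 (a - b) (by ring)
  have k10 := h1 k9
  have k11 := h2 k10 a (by ring)
  have k12 := h1 k11
  have := h0 k1
  have := h0 k2
  have := h0 k3
  have := h0 k4
  have := h0 k5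
  have := h0 k6
  have := h0 k7
  have := h0 k8
  have := h0 k9
  have := h0 k10
  have := h0 k11
  have := h0 k12
  omega

/-! ### The entries of the differentials -/

theorem HasCocharacter.dUp_eq_zero (h : HasCocharacter ρ a b) {i j : Fin 7}
    (hne : coweights a b i ≠ 2 + coweights a b j) : dUp ρ i j = 0 := by
  by_contra hc
  exact hne (h.dUp_ne_zero hc)

theorem HasCocharacter.dLow_eq_zero (h : HasCocharacter ρ a b) {i j : Fin 7}
    (hne : coweights a b i ≠ -2 + coweights a b j) : dLow ρ i j = 0 := by
  by_contra hc
  exact hne (h.dLow_ne_zero hc)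

theorem mat_inv_mHat (w : ℂˣ × ℂˣ) :
    mat (mHat w)⁻¹ = diagonal fun i => (torusWeights w i)⁻¹ := by
  rw [← map_inv, mat_mHat]
  congr 1
  ext i
  fin_cases i <;> simp [torusWeights, mul_comm]

theorem dUp_conjHom_mHat (hρ : IsAlgebraicHom ρ) (w : ℂˣ × ℂˣ) (i j : Fin 7) :
    dUp (conjHom (mHat w) ρ) i j = torusWeights w i * dUp ρ i j * (torusWeights w j)⁻¹ := by
  rw [dUp_conjHom hρ, mat_mHat, mat_inv_mHat, Matrix.mul_diagonal, Matrix.diagonal_mul]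

theorem dLow_conjHom_mHat (hρ : IsAlgebraicHom ρ) (w : ℂˣ × ℂˣ) (i j : Fin 7) :
    dLow (conjHom (mHat w) ρ) i j = torusWeights w i * dLow ρ i j * (torusWeights w j)⁻¹ := by
  rw [dLow_conjHom hρ, mat_mHat, mat_inv_mHat, Matrix.mul_diagonal, Matrix.diagonal_mul]

theorem dUp_iota10 : dUp iota10 4 5 = 1 := by
  change deriv (fun t => M10 !![1, t; 0, 1] 4 5) 0 = 1
  simp [M10]

theorem dLow_iota10 : dLow iota10 5 4 = 1 := by
  change deriv (fun t => M10 !![1, 0; t, 1] 5 4) 0 = 1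
  simp [M10]

theorem dUp_iota13 : dUp iota13 0 4 = 1 := by
  change deriv (fun t => M13 !![1, t; 0, 1] 0 4) 0 = 1
  simp [M13]

theorem dLow_iota13 : dLow iota13 4 0 = 1 := by
  change deriv (fun t => M13 !![1, 0; t, 1] 4 0) 0 = 1
  simp [M13]

theorem dUp_iota23 : dUp iota23 0 5 = 1 := by
  change deriv (fun t => M23 !![1, t; 0, 1] 0 5) 0 = 1
  simp [M23]

theorem dLow_iota23 : dLow iota23 5 0 = 1 := by
  change deriv (fun t => M23 !![1, 0; t, 1] 5 0) 0 = 1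
  simp [M23]

theorem dUp_iota01 : dUp iota01 0 1 = 1 := by
  change deriv (fun t => M01 !![1, t; 0, 1] 0 1) 0 = 1
  simp [M01]

theorem dLow_iota01 : dLow iota01 1 0 = 1 := by
  change deriv (fun t => M01 !![1, 0; t, 1] 1 0) 0 = 1
  simp [M01]

theorem dUp_iota12 : dUp iota12 1 4 = 1 := by
  change deriv (fun t => M12 !![1, t; 0, 1] 1 4) 0 = 1
  simp [M12]

theorem dLow_iota12 : dLow iota12 4 1 = 1 := by
  change deriv (fun t => M12 !![1, 0; t, 1] 4 1) 0 = 1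
  simp [M12]

theorem dUp_iotaA2 : dUp iotaA2 4 5 = 1 ∧ dUp iotaA2 0 4 = 1 ∧ dUp iotaA2 1 4 = 0 ∧
    dUp iotaA2 0 2 = 0 := by
  refine ⟨?_, ?_, ?_, ?_⟩
  · change deriv (fun t => MA2 !![1, t; 0, 1] 4 5) 0 = 1
    simp [MA2]
  · change deriv (fun t => MA2 !![1, t; 0, 1] 0 4) 0 = 1
    simp [MA2]
  · change deriv (fun t => MA2 !![1, t; 0, 1] 1 4) 0 = 0
    simp [MA2]
  · change deriv (fun t => MA2 !![1, t; 0, 1] 0 2) 0 = 0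
    simp [MA2]

theorem dLow_iotaA2 : dLow iotaA2 5 4 = 2 ∧ dLow iotaA2 4 0 = 2 ∧ dLow iotaA2 4 1 = 0 ∧
    dLow iotaA2 2 0 = 0 := by
  refine ⟨?_, ?_, ?_, ?_⟩
  · change deriv (fun t => MA2 !![1, 0; t, 1] 5 4) 0 = 2
    simp [MA2]
  · change deriv (fun t => MA2 !![1, 0; t, 1] 4 0) 0 = 2
    simp [MA2]
  · change deriv (fun t => MA2 !![1, 0; t, 1] 4 1) 0 = 0
    simp [MA2]
  · change deriv (fun t => MA2 !![1, 0; t, 1] 2 0) 0 = 0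
    simp [MA2]

theorem dUp_iotaReg : dUp iotaReg 4 5 = 1 ∧ dUp iotaReg 0 1 = 1 := by
  refine ⟨?_, ?_⟩
  · change deriv (fun t => symSix !![1, t; 0, 1] 4 5) 0 = 1
    simp [symSix_upper]
  · change deriv (fun t => symSix !![1, t; 0, 1] 0 1) 0 = 1
    simp [symSix_upper]

theorem dLow_iotaReg : dLow iotaReg 5 4 = 10 ∧ dLow iotaReg 1 0 = 6 := by
  refine ⟨?_, ?_⟩
  · change deriv (fun t => symSix !![1, 0; t, 1] 5 4) 0 = 10
    simp [symSix_lower]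
  · change deriv (fun t => symSix !![1, 0; t, 1] 1 0) 0 = 6
    simp [symSix_lower]

theorem dUp_iotaD2 : dUp iotaD2 4 5 = 1 ∧ dUp iotaD2 1 4 = 1 ∧ dUp iotaD2 0 2 = 0 ∧
    dUp iotaD2 0 4 = 0 := by
  refine ⟨?_, ?_, ?_, ?_⟩
  · change deriv (fun t => (M10 !![1, t; 0, 1] * M12 !![1, t; 0, 1]) 4 5) 0 = 1
    simp [M10, M12, Matrix.mul_apply, Fin.sum_univ_seven]
  · change deriv (fun t => (M10 !![1, t; 0, 1] * M12 !![1, t; 0, 1]) 1 4) 0 = 1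
    simp [M10, M12, Matrix.mul_apply, Fin.sum_univ_seven]
  · change deriv (fun t => (M10 !![1, t; 0, 1] * M12 !![1, t; 0, 1]) 0 2) 0 = 0
    simp [M10, M12, Matrix.mul_apply, Fin.sum_univ_seven]
  · change deriv (fun t => (M10 !![1, t; 0, 1] * M12 !![1, t; 0, 1]) 0 4) 0 = 0
    simp [M10, M12, Matrix.mul_apply, Fin.sum_univ_seven]

theorem dLow_iotaD2 : dLow iotaD2 5 4 = 1 ∧ dLow iotaD2 4 1 = 1 ∧ dLow iotaD2 2 0 = 0 ∧
    dLow iotaD2 4 0 = 0 := by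
  refine ⟨?_, ?_, ?_, ?_⟩
  · change deriv (fun t => (M10 !![1, 0; t, 1] * M12 !![1, 0; t, 1]) 5 4) 0 = 1
    simp [M10, M12, Matrix.mul_apply, Fin.sum_univ_seven]
  · change deriv (fun t => (M10 !![1, 0; t, 1] * M12 !![1, 0; t, 1]) 4 1) 0 = 1
    simp [M10, M12, Matrix.mul_apply, Fin.sum_univ_seven]
  · change deriv (fun t => (M10 !![1, 0; t, 1] * M12 !![1, 0; t, 1]) 2 0) 0 = 0
    simp [M10, M12, Matrix.mul_apply, Fin.sum_univ_seven]
  · change deriv (fun t => (M10 !![1, 0; t, 1] * M12 !![1, 0; t, 1]) 4 0) 0 = 0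
    simp [M10, M12, Matrix.mul_apply, Fin.sum_univ_seven]

/-! ### Homomorphisms with a given cocharacter -/

end

noncomputable section

variable {ρ ρ' ρ'' : SpecialLinearGroup (Fin 2) ℂ →* G2} {a b : ℤ} {s s' s'' : G2}

namespace HasCocharacter

theorem up (h : HasCocharacter ρ a b) : IsBracketDerivation (dUp ρ) :=
  isBracketDerivation_dUp h.algebraic

theorem low (h : HasCocharacter ρ a b) : IsBracketDerivation (dLow ρ) :=
  isBracketDerivation_dLow h.algebraic

/-- Writing the vanishing of an entry of the wrong weight as a conditional lets the simplifier
discard it as soon as a and b are numerals. The commutator identities that follow are restated in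
this form. -/
theorem ite_dUp (h : HasCocharacter ρ a b) {i j : Fin 7} {v : ℤ}
    (hv : coweights a b i = v + coweights a b j) :
    (if v = 2 then dUp ρ i j else 0) = dUp ρ i j :=
  ite_eq_left_iff.2 fun hc => (h.dUp_eq_zero (by omega)).symm

theorem ite_dLow (h : HasCocharacter ρ a b) {i j : Fin 7} {v : ℤ}
    (hv : coweights a b i = v + coweights a b j) :
    (if v = -2 then dLow ρ i j else 0) = dLow ρ i j :=
  ite_eq_left_iff.2 fun hc => (h.dLow_eq_zero (by omega)).symm

theorem commutator_zero_zero (h : HasCocharacter ρ a b) :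
      (if a - b = 2 then dUp ρ 0 1 else 0) * (if b - a = -2 then dLow ρ 1 0 else 0) - (if b -
        a = 2 then dUp ρ 1 0 else 0) * (if a - b = -2 then dLow ρ 0 1 else 0) + (if b = 2 then
        dUp ρ 0 2 else 0) * (if -b = -2 then dLow ρ 2 0 else 0) - (if -b = 2 then dUp ρ 2 0
        else 0) * (if b = -2 then dLow ρ 0 2 else 0) + 2 * ((if a = 2 then dUp ρ 1 4 else 0) *
        (if -a = -2 then dLow ρ 4 1 else 0)) - 2 * ((if -a = 2 then dUp ρ 4 1 else 0) * (if a
        = -2 then dLow ρ 1 4 else 0)) + (if 2 * a - b = 2 then dUp ρ 0 4 else 0) * (if b - 2 *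
        a = -2 then dLow ρ 4 0 else 0) - (if b - 2 * a = 2 then dUp ρ 4 0 else 0) * (if 2 * a
        - b = -2 then dLow ρ 0 4 else 0) + (if a + b = 2 then dUp ρ 0 5 else 0) * (if -a - b =
        -2 then dLow ρ 5 0 else 0) - (if -a - b = 2 then dUp ρ 5 0 else 0) * (if a + b = -2
        then dLow ρ 0 5 else 0) = a := by
  have := G2Arthur.commutator_zero_zero h.up h.low h.commutator
  simp only [h.ite_dUp (i := 0) (j := 1) (v := a - b) (by simp [coweights]),
    h.ite_dLow (i := 1) (j := 0) (v := b - a) (by simp [coweights]),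
    h.ite_dUp (i := 1) (j := 0) (v := b - a) (by simp [coweights]),
    h.ite_dLow (i := 0) (j := 1) (v := a - b) (by simp [coweights]),
    h.ite_dUp (i := 0) (j := 2) (v := b) (by simp [coweights]),
    h.ite_dLow (i := 2) (j := 0) (v := -b) (by simp [coweights]; omega),
    h.ite_dUp (i := 2) (j := 0) (v := -b) (by simp [coweights]; omega),
    h.ite_dLow (i := 0) (j := 2) (v := b) (by simp [coweights]),
    h.ite_dUp (i := 1) (j := 4) (v := a) (by simp [coweights]),
    h.ite_dLow (i := 4) (j := 1) (v := -a) (by simp [coweights]; omega),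
    h.ite_dUp (i := 4) (j := 1) (v := -a) (by simp [coweights]; omega),
    h.ite_dLow (i := 1) (j := 4) (v := a) (by simp [coweights]),
    h.ite_dUp (i := 0) (j := 4) (v := 2 * a - b) (by simp [coweights]; omega),
    h.ite_dLow (i := 4) (j := 0) (v := b - 2 * a) (by simp [coweights]; omega),
    h.ite_dUp (i := 4) (j := 0) (v := b - 2 * a) (by simp [coweights]; omega),
    h.ite_dLow (i := 0) (j := 4) (v := 2 * a - b) (by simp [coweights]; omega),
    h.ite_dUp (i := 0) (j := 5) (v := a + b) (by simp [coweights]),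
    h.ite_dLow (i := 5) (j := 0) (v := -a - b) (by simp [coweights]; omega),
    h.ite_dUp (i := 5) (j := 0) (v := -a - b) (by simp [coweights]; omega),
    h.ite_dLow (i := 0) (j := 5) (v := a + b) (by simp [coweights])]
  simpa [coweights] using this

theorem commutator_one_one (h : HasCocharacter ρ a b) :
      (if b - a = 2 then dUp ρ 1 0 else 0) * (if a - b = -2 then dLow ρ 0 1 else 0) - (if a -
        b = 2 then dUp ρ 0 1 else 0) * (if b - a = -2 then dLow ρ 1 0 else 0) + (if 2 * b - a
        = 2 then dUp ρ 4 5 else 0) * (if a - 2 * b = -2 then dLow ρ 5 4 else 0) - (if a - 2 *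
        b = 2 then dUp ρ 5 4 else 0) * (if 2 * b - a = -2 then dLow ρ 4 5 else 0) + 2 * ((if b
        = 2 then dUp ρ 0 2 else 0) * (if -b = -2 then dLow ρ 2 0 else 0)) - 2 * ((if -b = 2
        then dUp ρ 2 0 else 0) * (if b = -2 then dLow ρ 0 2 else 0)) + (if a = 2 then dUp ρ 1
        4 else 0) * (if -a = -2 then dLow ρ 4 1 else 0) - (if -a = 2 then dUp ρ 4 1 else 0) *
        (if a = -2 then dLow ρ 1 4 else 0) + (if a + b = 2 then dUp ρ 0 5 else 0) * (if -a - b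
        = -2 then dLow ρ 5 0 else 0) - (if -a - b = 2 then dUp ρ 5 0 else 0) * (if a + b = -2
        then dLow ρ 0 5 else 0) = b := by
  have := G2Arthur.commutator_one_one h.up h.low h.commutator
  simp only [h.ite_dUp (i := 1) (j := 0) (v := b - a) (by simp [coweights]),
    h.ite_dLow (i := 0) (j := 1) (v := a - b) (by simp [coweights]),
    h.ite_dUp (i := 0) (j := 1) (v := a - b) (by simp [coweights]),
    h.ite_dLow (i := 1) (j := 0) (v := b - a) (by simp [coweights]),
    h.ite_dUp (i := 4) (j := 5) (v := 2 * b - a) (by simp [coweights]; omega),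
    h.ite_dLow (i := 5) (j := 4) (v := a - 2 * b) (by simp [coweights]; omega),
    h.ite_dUp (i := 5) (j := 4) (v := a - 2 * b) (by simp [coweights]; omega),
    h.ite_dLow (i := 4) (j := 5) (v := 2 * b - a) (by simp [coweights]; omega),
    h.ite_dUp (i := 0) (j := 2) (v := b) (by simp [coweights]),
    h.ite_dLow (i := 2) (j := 0) (v := -b) (by simp [coweights]; omega),
    h.ite_dUp (i := 2) (j := 0) (v := -b) (by simp [coweights]; omega),
    h.ite_dLow (i := 0) (j := 2) (v := b) (by simp [coweights]),
    h.ite_dUp (i := 1) (j := 4) (v := a) (by simp [coweights]),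
    h.ite_dLow (i := 4) (j := 1) (v := -a) (by simp [coweights]; omega),
    h.ite_dUp (i := 4) (j := 1) (v := -a) (by simp [coweights]; omega),
    h.ite_dLow (i := 1) (j := 4) (v := a) (by simp [coweights]),
    h.ite_dUp (i := 0) (j := 5) (v := a + b) (by simp [coweights]),
    h.ite_dLow (i := 5) (j := 0) (v := -a - b) (by simp [coweights]; omega),
    h.ite_dUp (i := 5) (j := 0) (v := -a - b) (by simp [coweights]; omega),
    h.ite_dLow (i := 0) (j := 5) (v := a + b) (by simp [coweights])]
  simpa [coweights] using this

theorem commutator_zero_one (h : HasCocharacter ρ a b) :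
      - (if b = 2 then dUp ρ 0 2 else 0) * (if a - 2 * b = -2 then dLow ρ 5 4 else 0) + (if a
        - 2 * b = 2 then dUp ρ 5 4 else 0) * (if b = -2 then dLow ρ 0 2 else 0) - 2 * ((if a =
        2 then dUp ρ 1 4 else 0) * (if -b = -2 then dLow ρ 2 0 else 0)) + 2 * ((if -b = 2 then
        dUp ρ 2 0 else 0) * (if a = -2 then dLow ρ 1 4 else 0)) + (if 2 * a - b = 2 then dUp ρ
        0 4 else 0) * (if -a = -2 then dLow ρ 4 1 else 0) - (if -a = 2 then dUp ρ 4 1 else 0)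
        * (if 2 * a - b = -2 then dLow ρ 0 4 else 0) = 0 := by
  have := G2Arthur.commutator_zero_one h.up h.low h.commutator
  simp only [h.ite_dLow (i := 0) (j := 1) (v := a - b) (by simp [coweights]),
    h.ite_dUp (i := 0) (j := 1) (v := a - b) (by simp [coweights]),
    h.ite_dUp (i := 0) (j := 2) (v := b) (by simp [coweights]),
    h.ite_dLow (i := 5) (j := 4) (v := a - 2 * b) (by simp [coweights]; omega),
    h.ite_dUp (i := 5) (j := 4) (v := a - 2 * b) (by simp [coweights]; omega),
    h.ite_dLow (i := 0) (j := 2) (v := b) (by simp [coweights]),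
    h.ite_dUp (i := 1) (j := 4) (v := a) (by simp [coweights]),
    h.ite_dLow (i := 2) (j := 0) (v := -b) (by simp [coweights]; omega),
    h.ite_dUp (i := 2) (j := 0) (v := -b) (by simp [coweights]; omega),
    h.ite_dLow (i := 1) (j := 4) (v := a) (by simp [coweights]),
    h.ite_dUp (i := 0) (j := 4) (v := 2 * a - b) (by simp [coweights]; omega),
    h.ite_dLow (i := 4) (j := 1) (v := -a) (by simp [coweights]; omega),
    h.ite_dUp (i := 4) (j := 1) (v := -a) (by simp [coweights]; omega),
    h.ite_dLow (i := 0) (j := 4) (v := 2 * a - b) (by simp [coweights]; omega)]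
  simpa [coweights, h.dUp_eq_zero (i := 0) (j := 0) (by omega), h.dUp_eq_zero (i := 1) (j := 1) (by omega),
    h.dLow_eq_zero (i := 0) (j := 0) (by omega), h.dLow_eq_zero (i := 1) (j := 1) (by omega)] using this

theorem commutator_one_zero (h : HasCocharacter ρ a b) :
      - (if 2 * b - a = 2 then dUp ρ 4 5 else 0) * (if -b = -2 then dLow ρ 2 0 else 0) + (if
        -b = 2 then dUp ρ 2 0 else 0) * (if 2 * b - a = -2 then dLow ρ 4 5 else 0) - 2 * ((if
        b = 2 then dUp ρ 0 2 else 0) * (if -a = -2 then dLow ρ 4 1 else 0)) + 2 * ((if -a = 2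
        then dUp ρ 4 1 else 0) * (if b = -2 then dLow ρ 0 2 else 0)) + (if a = 2 then dUp ρ 1
        4 else 0) * (if b - 2 * a = -2 then dLow ρ 4 0 else 0) - (if b - 2 * a = 2 then dUp ρ
        4 0 else 0) * (if a = -2 then dLow ρ 1 4 else 0) = 0 := by
  have := G2Arthur.commutator_one_zero h.up h.low h.commutator
  simp only [h.ite_dUp (i := 1) (j := 0) (v := b - a) (by simp [coweights]),
    h.ite_dLow (i := 1) (j := 0) (v := b - a) (by simp [coweights]),
    h.ite_dUp (i := 4) (j := 5) (v := 2 * b - a) (by simp [coweights]; omega),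
    h.ite_dLow (i := 2) (j := 0) (v := -b) (by simp [coweights]; omega),
    h.ite_dUp (i := 2) (j := 0) (v := -b) (by simp [coweights]; omega),
    h.ite_dLow (i := 4) (j := 5) (v := 2 * b - a) (by simp [coweights]; omega),
    h.ite_dUp (i := 0) (j := 2) (v := b) (by simp [coweights]),
    h.ite_dLow (i := 4) (j := 1) (v := -a) (by simp [coweights]; omega),
    h.ite_dUp (i := 4) (j := 1) (v := -a) (by simp [coweights]; omega),
    h.ite_dLow (i := 0) (j := 2) (v := b) (by simp [coweights]),
    h.ite_dUp (i := 1) (j := 4) (v := a) (by simp [coweights]),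
    h.ite_dLow (i := 4) (j := 0) (v := b - 2 * a) (by simp [coweights]; omega),
    h.ite_dUp (i := 4) (j := 0) (v := b - 2 * a) (by simp [coweights]; omega),
    h.ite_dLow (i := 1) (j := 4) (v := a) (by simp [coweights])]
  simpa [coweights, h.dUp_eq_zero (i := 0) (j := 0) (by omega), h.dUp_eq_zero (i := 1) (j := 1) (by omega),
    h.dLow_eq_zero (i := 0) (j := 0) (by omega), h.dLow_eq_zero (i := 1) (j := 1) (by omega)] using this

theorem commutator_four_five (h : HasCocharacter ρ a b) :
      (if b - 2 * a = 2 then dUp ρ 4 0 else 0) * (if a + b = -2 then dLow ρ 0 5 else 0) - (if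
        a + b = 2 then dUp ρ 0 5 else 0) * (if b - 2 * a = -2 then dLow ρ 4 0 else 0) - 3 *
        ((if b - a = 2 then dUp ρ 1 0 else 0) * (if b = -2 then dLow ρ 0 2 else 0)) + 3 * ((if
        b = 2 then dUp ρ 0 2 else 0) * (if b - a = -2 then dLow ρ 1 0 else 0)) = 0 := by
  have := G2Arthur.commutator_four_five h.up h.low h.commutator
  simp only [h.ite_dUp (i := 4) (j := 0) (v := b - 2 * a) (by simp [coweights]; omega),
    h.ite_dLow (i := 0) (j := 5) (v := a + b) (by simp [coweights]),
    h.ite_dUp (i := 0) (j := 5) (v := a + b) (by simp [coweights]),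
    h.ite_dLow (i := 4) (j := 0) (v := b - 2 * a) (by simp [coweights]; omega),
    h.ite_dUp (i := 1) (j := 0) (v := b - a) (by simp [coweights]),
    h.ite_dLow (i := 0) (j := 2) (v := b) (by simp [coweights]),
    h.ite_dUp (i := 0) (j := 2) (v := b) (by simp [coweights]),
    h.ite_dLow (i := 1) (j := 0) (v := b - a) (by simp [coweights]),
    h.ite_dLow (i := 4) (j := 5) (v := 2 * b - a) (by simp [coweights]; omega),
    h.ite_dUp (i := 4) (j := 5) (v := 2 * b - a) (by simp [coweights]; omega)]
  simpa [coweights, h.dUp_eq_zero (i := 0) (j := 0) (by omega), h.dUp_eq_zero (i := 1) (j := 1) (by omega),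
    h.dLow_eq_zero (i := 0) (j := 0) (by omega), h.dLow_eq_zero (i := 1) (j := 1) (by omega)] using this

theorem commutator_five_four (h : HasCocharacter ρ a b) :
      (if -a - b = 2 then dUp ρ 5 0 else 0) * (if 2 * a - b = -2 then dLow ρ 0 4 else 0) - (if
        2 * a - b = 2 then dUp ρ 0 4 else 0) * (if -a - b = -2 then dLow ρ 5 0 else 0) - 3 *
        ((if -b = 2 then dUp ρ 2 0 else 0) * (if a - b = -2 then dLow ρ 0 1 else 0)) + 3 *
        ((if a - b = 2 then dUp ρ 0 1 else 0) * (if -b = -2 then dLow ρ 2 0 else 0)) = 0 := by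
  have := G2Arthur.commutator_five_four h.up h.low h.commutator
  simp only [h.ite_dUp (i := 5) (j := 0) (v := -a - b) (by simp [coweights]; omega),
    h.ite_dLow (i := 0) (j := 4) (v := 2 * a - b) (by simp [coweights]; omega),
    h.ite_dUp (i := 0) (j := 4) (v := 2 * a - b) (by simp [coweights]; omega),
    h.ite_dLow (i := 5) (j := 0) (v := -a - b) (by simp [coweights]; omega),
    h.ite_dUp (i := 2) (j := 0) (v := -b) (by simp [coweights]; omega),
    h.ite_dLow (i := 0) (j := 1) (v := a - b) (by simp [coweights]),
    h.ite_dUp (i := 0) (j := 1) (v := a - b) (by simp [coweights]),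
    h.ite_dLow (i := 2) (j := 0) (v := -b) (by simp [coweights]; omega),
    h.ite_dUp (i := 5) (j := 4) (v := a - 2 * b) (by simp [coweights]; omega),
    h.ite_dLow (i := 5) (j := 4) (v := a - 2 * b) (by simp [coweights]; omega)]
  simpa [coweights, h.dUp_eq_zero (i := 0) (j := 0) (by omega), h.dUp_eq_zero (i := 1) (j := 1) (by omega),
    h.dLow_eq_zero (i := 0) (j := 0) (by omega), h.dLow_eq_zero (i := 1) (j := 1) (by omega)] using this

theorem eq_one (h : HasCocharacter ρ 0 0) : ρ = 1 :=
  by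
  refine h.hom_ext hasCocharacter_one ?_ ?_ <;> simp [rootPositions, coweights]

/-- The only root of weight 2 for this coroot is the root itself. The diagonal relation makes its
raising entry invertible and determines the lowering entry, so scaling the raising entry to 1 fixes
the homomorphism. The next four results follow the same pattern. -/
theorem exists_conj_iota12 (h : HasCocharacter ρ 2 1) : dUp ρ 1 4 ≠ 0 ∧ ∃ w, conjHom (mHat w) ρ = iota12 := by
  have h0 := h.commutator_zero_zero
  simp at h0
  have hE : dUp ρ 1 4 ≠ 0 := fun hc => by simp [hc] at h0
  refine ⟨hE, (Units.mk0 _ (inv_ne_zero hE), 1),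
    (h.conjHom_mHat _).hom_ext hasCocharacter_iota12 ?_ ?_⟩
  · simp [rootPositions, coweights, dUp_conjHom_mHat h.algebraic, torusWeights, dUp_iota12, hE]
  · simp [rootPositions, coweights, dLow_conjHom_mHat h.algebraic, torusWeights, dLow_iota12]
    linear_combination h0

theorem exists_conj_iota01 (h : HasCocharacter ρ 1 (-1)) :
    dUp ρ 0 1 ≠ 0 ∧ ∃ w, conjHom (mHat w) ρ = iota01 := by
  have h0 := h.commutator_zero_zero
  simp at h0
  have hE : dUp ρ 0 1 ≠ 0 := fun hc => by simp [hc] at h0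
  refine ⟨hE, (Units.mk0 _ (inv_ne_zero hE), 1),
    (h.conjHom_mHat _).hom_ext hasCocharacter_iota01 ?_ ?_⟩
  · simp [rootPositions, coweights, dUp_conjHom_mHat h.algebraic, torusWeights, dUp_iota01, hE]
  · simp [rootPositions, coweights, dLow_conjHom_mHat h.algebraic, torusWeights, dLow_iota01]
    linear_combination h0

theorem exists_conj_iota23 (h : HasCocharacter ρ 1 1) : dUp ρ 0 5 ≠ 0 ∧ ∃ w, conjHom (mHat w) ρ = iota23 := by
  have h0 := h.commutator_zero_zero
  simp at h0
  have hE : dUp ρ 0 5 ≠ 0 := fun hc => by simp [hc] at h0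
  refine ⟨hE, (Units.mk0 _ (inv_ne_zero hE), 1),
    (h.conjHom_mHat _).hom_ext hasCocharacter_iota23 ?_ ?_⟩
  · simp [rootPositions, coweights, dUp_conjHom_mHat h.algebraic, torusWeights, dUp_iota23, hE]
  · simp [rootPositions, coweights, dLow_conjHom_mHat h.algebraic, torusWeights, dLow_iota23]
    linear_combination h0

theorem exists_conj_iota10 (h : HasCocharacter ρ 0 1) : dUp ρ 4 5 ≠ 0 ∧ ∃ w, conjHom (mHat w) ρ = iota10 := by
  have h0 := h.commutator_one_one
  simp at h0
  have hE : dUp ρ 4 5 ≠ 0 := fun hc => by simp [hc] at h0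
  refine ⟨hE, (Units.mk0 _ hE, 1),
    (h.conjHom_mHat _).hom_ext hasCocharacter_iota10 ?_ ?_⟩
  · simp [rootPositions, coweights, dUp_conjHom_mHat h.algebraic, torusWeights, dUp_iota10, hE]
  · simp [rootPositions, coweights, dLow_conjHom_mHat h.algebraic, torusWeights, dLow_iota10]
    linear_combination h0

theorem exists_conj_iota13 (h : HasCocharacter ρ 1 0) : dUp ρ 0 4 ≠ 0 ∧ ∃ w, conjHom (mHat w) ρ = iota13 := by
  have h0 := h.commutator_zero_zero
  simp at h0
  have hE : dUp ρ 0 4 ≠ 0 := fun hc => by simp [hc] at h0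
  refine ⟨hE, (1, Units.mk0 _ hE),
    (h.conjHom_mHat _).hom_ext hasCocharacter_iota13 ?_ ?_⟩
  · simp [rootPositions, coweights, dUp_conjHom_mHat h.algebraic, torusWeights, dUp_iota13, hE]
  · simp [rootPositions, coweights, dLow_conjHom_mHat h.algebraic, torusWeights, dLow_iota13]
    linear_combination h0

/-- Here exactly the two simple roots have weight 2. The simple roots are coordinates on the torus,
so both raising entries can be scaled to 1 at once. -/
theorem exists_conj_iotaReg (h : HasCocharacter ρ 6 4) :
    dUp ρ 4 5 ≠ 0 ∧ dUp ρ 0 1 ≠ 0 ∧ ∃ w, conjHom (mHat w) ρ = iotaReg := by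
  have h0 := h.commutator_zero_zero
  have h1 := h.commutator_one_one
  simp at h0 h1
  have hE : dUp ρ 0 1 ≠ 0 := fun hc => by simp [hc] at h0
  have hE' : dUp ρ 4 5 ≠ 0 := fun hc => by
    simp [hc] at h1
    norm_num [h0] at h1
  refine ⟨hE', hE, (Units.mk0 _ (inv_ne_zero (mul_ne_zero (mul_ne_zero hE hE) hE')),
    Units.mk0 _ (inv_ne_zero (mul_ne_zero hE hE'))),
    (h.conjHom_mHat _).hom_ext hasCocharacter_iotaReg ?_ ?_⟩
  · simp [rootPositions, coweights, dUp_conjHom_mHat h.algebraic, torusWeights, dUp_iotaReg]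
    constructor <;> field_simp
  · simp [rootPositions, coweights, dLow_conjHom_mHat h.algebraic, torusWeights, dLow_iotaReg]
    constructor
    · field_simp
      linear_combination h1 + h0
    · field_simp
      linear_combination h0

/-- Four roots have weight 2 here; the hypotheses leave the orthogonal roots γ̂₁ and γ̂₁ + 2γ̂₂. The
off-diagonal relations then kill the superfluous lowering entries. -/
theorem exists_conj_iotaD2 (h : HasCocharacter ρ 2 2) (h02 : dUp ρ 0 2 = 0) (h04 : dUp ρ 0 4 = 0) :
    dUp ρ 4 5 ≠ 0 ∧ dUp ρ 1 4 ≠ 0 ∧ ∃ w, conjHom (mHat w) ρ = iotaD2 := by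
  have h0 := h.commutator_zero_zero
  have h1 := h.commutator_one_one
  have h2 := h.commutator_zero_one
  have h3 := h.commutator_one_zero
  simp [h02, h04] at h0 h1 h2 h3
  have hE : dUp ρ 1 4 ≠ 0 := fun hc => by simp [hc] at h0
  have hE' : dUp ρ 4 5 ≠ 0 := fun hc => by
    simp [hc] at h1
    norm_num [h1] at h0
  have hF : dLow ρ 2 0 = 0 := by simpa [hE] using h2
  have hF' : dLow ρ 4 0 = 0 := by simpa [hE, hF] using h3
  -- With x the inverse of the entry at γ̂₁ + 2γ̂₂, scaling the entry at γ̂₁ to 1 prescribes y².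
  obtain ⟨y, hy⟩ := IsAlgClosed.exists_pow_nat_eq (dUp ρ 1 4 * dUp ρ 4 5)⁻¹ two_pos
  have hy0 : y ≠ 0 := by
    rintro rfl
    simp [hE, hE'] at hy
  have hy' : y ^ 2 * (dUp ρ 1 4 * dUp ρ 4 5) = 1 := by
    rw [hy]
    exact inv_mul_cancel₀ (mul_ne_zero hE hE')
  refine ⟨hE', hE, (Units.mk0 _ (inv_ne_zero hE), Units.mk0 y hy0),
    (h.conjHom_mHat _).hom_ext hasCocharacter_iotaD2 ?_ ?_⟩
  · simp [rootPositions, coweights, dUp_conjHom_mHat h.algebraic, torusWeights, dUp_iotaD2, h02,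
      h04]
    constructor <;> field_simp
    linear_combination hy'
  · simp [rootPositions, coweights, dLow_conjHom_mHat h.algebraic, torusWeights, dLow_iotaD2, hF,
      hF']
    constructor <;> field_simp
    · linear_combination -dLow ρ 5 4 * hy' + y ^ 2 * dUp ρ 1 4 * (h1 - h0)
    · linear_combination h0

/-- The hypotheses leave the long roots γ̂₁ and γ̂₁ + 3γ̂₂, the simple roots of the subgroup SL₃. -/
theorem exists_conj_iotaA2 (h : HasCocharacter ρ 2 2) (h02 : dUp ρ 0 2 = 0) (h14 : dUp ρ 1 4 = 0) :
    dUp ρ 4 5 ≠ 0 ∧ dUp ρ 0 4 ≠ 0 ∧ ∃ w, conjHom (mHat w) ρ = iotaA2 := by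
  have h0 := h.commutator_zero_zero
  have h1 := h.commutator_one_one
  have h2 := h.commutator_zero_one
  have h3 := h.commutator_one_zero
  simp [h02, h14] at h0 h1 h2 h3
  have hE : dUp ρ 0 4 ≠ 0 := fun hc => by simp [hc] at h0
  have hE' : dUp ρ 4 5 ≠ 0 := fun hc => by simp [hc] at h1
  have hF : dLow ρ 4 1 = 0 := by simpa [hE] using h2
  have hF' : dLow ρ 2 0 = 0 := by simpa [hE'] using h3
  -- The entry at γ̂₁ + 3γ̂₂ prescribes y in terms of x²; the entry at γ̂₁ then prescribes x³.
  obtain ⟨x, hx⟩ := IsAlgClosed.exists_pow_nat_eq (dUp ρ 0 4 ^ 2 * dUp ρ 4 5)⁻¹ three_pos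
  have hx0 : x ≠ 0 := by
    rintro rfl
    simp [hE, hE'] at hx
  have hx' : x ^ 3 * (dUp ρ 0 4 ^ 2 * dUp ρ 4 5) = 1 := by
    rw [hx]
    exact inv_mul_cancel₀ (mul_ne_zero (pow_ne_zero 2 hE) hE')
  refine ⟨hE', hE, (Units.mk0 x hx0, Units.mk0 _ (mul_ne_zero (pow_ne_zero 2 hx0) hE)),
    (h.conjHom_mHat _).hom_ext hasCocharacter_iotaA2 ?_ ?_⟩
  · simp [rootPositions, coweights, dUp_conjHom_mHat h.algebraic, torusWeights, dUp_iotaA2, h02,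
      h14]
    constructor <;> field_simp
    linear_combination hx'
  · simp [rootPositions, coweights, dLow_conjHom_mHat h.algebraic, torusWeights, dLow_iotaA2, hF,
      hF']
    constructor <;> field_simp
    · linear_combination -dLow ρ 5 4 * hx' + x ^ 3 * dUp ρ 0 4 ^ 2 * h1
    · linear_combination h0

end HasCocharacter

end

/-! ### Classification of the commuting pairs -/

noncomputable section

variable {ρ ρ' ρ'' : SpecialLinearGroup (Fin 2) ℂ →* G2} {a b : ℤ} {s s' s'' : G2}

theorem torusWeights_eq_of_dUp (hρ : IsAlgebraicHom ρ) {z : ℂˣ × ℂˣ}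
    (hc : ∀ x, Commute (mHat z) (ρ x)) {i j : Fin 7} (h : dUp ρ i j ≠ 0) :
    torusWeights z i = torusWeights z j := by
  have h1 := commute_dUp hρ (A := mat (mHat z)) fun x => by rw [← mat_mul, (hc x).eq, mat_mul]
  have h2 := congrFun (congrFun h1 i) j
  rw [mat_mHat, Matrix.diagonal_mul, Matrix.mul_diagonal, mul_comm] at h2
  exact mul_left_cancel₀ h h2

namespace HasCocharacter

/-- Dynkin's weighted diagrams: the values p and r of the two simple roots cannot exceed 2, since
otherwise too few roots have weight 2 to satisfy the diagonal relations. The relations exclude four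
of the nine remaining pairs. -/
theorem eq_of_chamber (h : HasCocharacter ρ a b) (h1 : b ≤ a) (h2 : a ≤ 2 * b) :
    (a = 0 ∧ b = 0) ∨ (a = 1 ∧ b = 1) ∨ (a = 2 ∧ b = 1) ∨ (a = 2 ∧ b = 2) ∨ (a = 6 ∧ b = 4) := by
  have h00 := h.commutator_zero_zero
  have h11 := h.commutator_one_one
  obtain ⟨r, hr⟩ : ∃ r, r = a - b := ⟨_, rfl⟩
  obtain ⟨p, hp⟩ : ∃ p, p = 2 * b - a := ⟨_, rfl⟩
  obtain rfl : a = p + 2 * r := by omega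
  obtain rfl : b = p + r := by omega
  rcases le_or_gt 3 r with hr3 | hr3
  -- If r ≥ 3, every positive root involving γ̂₂ has weight at least 3, so the right-hand entry a
  -- would be 0.
  · simp only [if_neg (show ¬ (p + 2 * r - (p + r) = 2) by omega),
      if_neg (show ¬ (p + r - (p + 2 * r) = 2) by omega), if_neg (show ¬ (p + r = 2) by omega),
      if_neg (show ¬ (-(p + r) = 2) by omega), if_neg (show ¬ (p + 2 * r = 2) by omega),
      if_neg (show ¬ (-(p + 2 * r) = 2) by omega),
      if_neg (show ¬ (2 * (p + 2 * r) - (p + r) = 2) by omega),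
      if_neg (show ¬ ((p + r) - 2 * (p + 2 * r) = 2) by omega),
      if_neg (show ¬ ((p + 2 * r) + (p + r) = 2) by omega),
      if_neg (show ¬ (-(p + 2 * r) - (p + r) = 2) by omega), zero_mul, mul_zero, sub_zero,
      add_zero] at h00
    have : p + 2 * r = 0 := by exact_mod_cast h00.symm
    omega
  rcases le_or_gt 3 p with hp3 | hp3
  -- If p ≥ 3, among the positive roots only γ̂₂ can have weight 2; its contributions cancel in the
  -- sum of the two diagonal relations, giving a + b = 0.
  · have e1 : (p + r) - (p + 2 * r) ≠ 2 := by omega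
    simp only [if_neg e1, if_neg (show ¬ (p + r = 2) by omega),
      if_neg (show ¬ (-(p + r) = 2) by omega), if_neg (show ¬ (p + 2 * r = 2) by omega),
      if_neg (show ¬ (-(p + 2 * r) = 2) by omega),
      if_neg (show ¬ (2 * (p + 2 * r) - (p + r) = 2) by omega),
      if_neg (show ¬ ((p + r) - 2 * (p + 2 * r) = 2) by omega),
      if_neg (show ¬ ((p + 2 * r) + (p + r) = 2) by omega),
      if_neg (show ¬ (-(p + 2 * r) - (p + r) = 2) by omega),
      if_neg (show ¬ (2 * (p + r) - (p + 2 * r) = 2) by omega),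
      if_neg (show ¬ ((p + 2 * r) - 2 * (p + r) = 2) by omega), zero_mul, mul_zero, sub_zero,
      add_zero, zero_sub] at h00 h11
    have : (p + 2 * r) + (p + r) = 0 := by
      have : (((p + 2 * r) + (p + r) : ℤ) : ℂ) = 0 := by
        rw [Int.cast_add, ← h00, ← h11]
        ring
      exact_mod_cast this
    omega
  have h45 := h.commutator_four_five
  have h54 := h.commutator_five_four
  have hp0 : 0 ≤ p := by omega
  have hr0 : 0 ≤ r := by omega
  clear hr hp h1 h2
  interval_cases p <;> interval_cases r <;> simp at h00 h11 h45 h54 ⊢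
  · rcases h54 with h54 | h54 <;> simp [h54] at h00 h11
    · norm_num [h00] at h11
    · norm_num [h00] at h11
  · norm_num [h00] at h11
  · norm_num [h00] at h11

/-- The four root spaces γ̂₁ + jγ̂₂ form the space of binary cubics under the SL₂ of γ̂₂. Only the
two coefficients that are to be made zero are computed. -/
theorem dUp_conj_iota01 (h : HasCocharacter ρ 2 2) (x : SpecialLinearGroup (Fin 2) ℂ) :
    dUp (conjHom (iota01 x) ρ) 0 4 = x 0 0 ^ 3 * dUp ρ 0 4 + 3 * x 0 0 ^ 2 * x 0 1 * dUp ρ 1 4 -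
        3 * x 0 0 * x 0 1 ^ 2 * dUp ρ 0 2 + x 0 1 ^ 3 * dUp ρ 4 5 ∧
      dUp (conjHom (iota01 x) ρ) 0 2 = (x 0 0 * dUp ρ 0 2 - x 0 1 * dUp ρ 4 5) * x 1 1 ^ 2 -
        2 * (x 0 0 * dUp ρ 1 4 - x 0 1 * dUp ρ 0 2) * x 1 1 * x 1 0 -
        (x 0 0 * dUp ρ 0 4 + x 0 1 * dUp ρ 1 4) * x 1 0 ^ 2 := by
  have h00 := h.dUp_eq_zero (i := 0) (j := 0) (by omega)
  have h11 := h.dUp_eq_zero (i := 1) (j := 1) (by omega)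
  have h01 := h.dUp_eq_zero (i := 0) (j := 1) (by decide)
  have h10 := h.dUp_eq_zero (i := 1) (j := 0) (by decide)
  have h05 := h.dUp_eq_zero (i := 0) (j := 5) (by decide)
  have h54 := h.dUp_eq_zero (i := 5) (j := 4) (by decide)
  have h40 := h.dUp_eq_zero (i := 4) (j := 0) (by decide)
  have h41 := h.dUp_eq_zero (i := 4) (j := 1) (by decide)
  have h20 := h.dUp_eq_zero (i := 2) (j := 0) (by decide)
  have h50 := h.dUp_eq_zero (i := 5) (j := 0) (by decide)
  rw [dUp_conjHom h.algebraic, ← map_inv]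
  change (M01 x.1 * dUp ρ * M01 (x⁻¹).1) 0 4 = _ ∧ (M01 x.1 * dUp ρ * M01 (x⁻¹).1) 0 2 = _
  rw [h.up.eq_of, Matrix.SpecialLinearGroup.SL2_inv_expl]
  simp [derivMat, M01, Matrix.mul_apply, Fin.sum_univ_seven, h00, h11, h01, h10, h05, h54, h40,
    h41, h20, h50]
  constructor <;> ring

/-- A root of the cubic kills the coefficient at γ̂₁ + 3γ̂₂. The sl₂ relations show that the next
coefficient, essentially the derivative at that root, is nonzero, and a lower unipotent then kills
the coefficient at γ̂₁ + γ̂₂. The conjugating elements centralize m̂(z, z), where γ̂₂ is trivial. -/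
theorem exists_conj_eq_zero (h : HasCocharacter ρ 2 2) :
    ∃ k : G2, (∀ z : ℂˣ, k * mHat (z, z) * k⁻¹ = mHat (z, z)) ∧ HasCocharacter (conjHom k ρ) 2 2 ∧
      dUp (conjHom k ρ) 0 2 = 0 ∧ dUp (conjHom k ρ) 0 4 = 0 := by
  have hcomm : ∀ (x : SpecialLinearGroup (Fin 2) ℂ) (z : ℂˣ),
      iota01 x * mHat (z, z) * (iota01 x)⁻¹ = mHat (z, z) := fun x z => by
    rw [mul_inv_eq_iff_eq_mul]
    exact (commute_of_mat (g := iota01 x) (M01_comm rfl x.1)).eq.symm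
  have hconj : ∀ {ρ : SpecialLinearGroup (Fin 2) ℂ →* G2} (x : SpecialLinearGroup (Fin 2) ℂ),
      HasCocharacter ρ 2 2 → HasCocharacter (conjHom (iota01 x) ρ) 2 2 := fun x h =>
    h.conjHom_of fun t => hcomm x _
  obtain ⟨x, hx⟩ : ∃ x, dUp (conjHom (iota01 x) ρ) 0 4 = 0 := by
    by_cases h45 : dUp ρ 4 5 = 0
    · exact ⟨slWeyl, by rw [(h.dUp_conj_iota01 _).1]; simp [slWeyl, h45]⟩
    · let P : Polynomial ℂ := Polynomial.C (dUp ρ 4 5) * Polynomial.X ^ 3 +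
        Polynomial.C (-3 * dUp ρ 0 2) * Polynomial.X ^ 2 + Polynomial.C (3 * dUp ρ 1 4) * Polynomial.X +
          Polynomial.C (dUp ρ 0 4)
      obtain ⟨t, ht⟩ := IsAlgClosed.exists_root P (by
        rw [Polynomial.degree_cubic h45]; norm_num)
      refine ⟨slUp t, ?_⟩
      rw [(h.dUp_conj_iota01 _).1]
      simp [P] at ht
      simp [slUp]
      linear_combination ht
  have h' := hconj x h
  have h14 : dUp (conjHom (iota01 x) ρ) 1 4 ≠ 0 := fun h14 => by
    have h0 := h'.commutator_zero_zero
    have h1 := h'.commutator_one_one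
    have h2 := h'.commutator_zero_one
    simp [h14, hx] at h0 h1 h2
    rcases h2 with h2 | h2
    · simp [h2] at h0
    · norm_num [h0, h2] at h1
  -- The parameter solves the equation for the coefficient at γ̂₁ + γ̂₂, which is linear because the
  -- one at γ̂₁ + 3γ̂₂ already vanishes.
  refine ⟨iota01 (slLow (dUp (conjHom (iota01 x) ρ) 0 2 / (2 * dUp (conjHom (iota01 x) ρ) 1 4)))
    * iota01 x, fun z => ?_, ?_⟩
  · rw [← map_mul, hcomm]
  · have e : ∀ k, conjHom (k * iota01 x) ρ = conjHom k (conjHom (iota01 x) ρ) := fun k => by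
      ext1 y
      simp only [conjHom_apply]
      group
    rw [e]
    refine ⟨hconj _ h', ?_, ?_⟩
    · rw [(h'.dUp_conj_iota01 _).2, hx]
      simp [slLow]
      field_simp
      ring
    · rw [(h'.dUp_conj_iota01 _).1, hx]
      simp [slLow]

end HasCocharacter

/-- The classification of the pairs of a semisimple element and an algebraic homomorphism from
`SL₂(ℂ)` that commute. -/
theorem exists_pairConj_of_commute (hρ : IsAlgebraicHom ρ) (hs : IsSemisimpleElt s)
    (hc : ∀ x, Commute s (ρ x)) : ∃ z : ℂˣ × ℂˣ,
      PairConj s ρ (mHat z) 1 ∨ (PairConj s ρ (mHat z) iota23 ∧ z.1 * z.2 = 1) ∨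
      (PairConj s ρ (mHat z) iota12 ∧ z.1 = 1) ∨ (PairConj s ρ (mHat z) iotaReg ∧ z = 1) ∨
      (PairConj s ρ (mHat z) iotaD2 ∧ z.1 = 1 ∧ z.2 ^ 2 = 1) ∨
      (PairConj s ρ (mHat z) iotaA2 ∧ z.2 = z.1 ^ 2 ∧ z.1 ^ 3 = 1 ∧ z.1 ≠ 1) := by
  obtain ⟨g, z₀, a₀, b₀, hg, hd⟩ := exists_conj_torus hρ hs hc
  have h0 : HasCocharacter (conjHom g ρ) a₀ b₀ := ⟨isAlgebraicHom_conjHom hρ g, hd⟩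
  obtain ⟨ρ', a, b, z, h, hconj, hab, hab'⟩ := h0.exists_chamber z₀
  have hp : PairConj s ρ (mHat z) ρ' := PairConj.trans ⟨g, hg, rfl⟩ hconj
  have hcz := hp.commute hc
  clear hconj h0
  have key : ∀ {i j : Fin 7}, dUp ρ' i j ≠ 0 → torusWeights z i = torusWeights z j :=
    torusWeights_eq_of_dUp h.algebraic hcz
  obtain ⟨x, y⟩ := z
  obtain ⟨rfl, rfl⟩ | ⟨rfl, rfl⟩ | ⟨rfl, rfl⟩ | ⟨rfl, rfl⟩ | ⟨rfl, rfl⟩ := h.eq_of_chamber hab hab'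
  · exact ⟨_, Or.inl (h.eq_one ▸ hp)⟩
  · obtain ⟨hE, w, hw⟩ := h.exists_conj_iota23
    refine ⟨_, Or.inr (Or.inl ⟨hp.trans (hw ▸ pairConj_mHat _ w _), ?_⟩)⟩
    have := key hE
    simp [torusWeights] at this
    rw [← Units.val_inv_eq_inv_val, Units.val_inj] at this
    simp [this]
  · obtain ⟨hE, w, hw⟩ := h.exists_conj_iota12
    refine ⟨_, Or.inr (Or.inr (Or.inl ⟨hp.trans (hw ▸ pairConj_mHat _ w _), ?_⟩))⟩
    have := key hE
    simpa [torusWeights] using this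
  -- For the cocharacter (2, 2) the roots trivial at m̂(x, y) decide. If γ̂₂ is trivial, the cubic
  -- is normalized. Otherwise, commuting with m̂(x, y) kills root entries: x = 1, or y = 1 after a
  -- reflection, leads to `iotaD2`, and the remaining case to `iotaA2`.
  · by_cases hz1 : x = y
    · subst hz1
      obtain ⟨k, hk, hkρ, h02, h04⟩ := h.exists_conj_eq_zero
      have hp' : PairConj s ρ (mHat (x, x)) (conjHom k ρ') := hp.trans ⟨k, hk x, rfl⟩
      obtain ⟨hE, hE', w, hw⟩ := hkρ.exists_conj_iotaD2 h02 h04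
      have hE'' := torusWeights_eq_of_dUp hkρ.algebraic (hp'.commute hc) hE
      have hE''' := torusWeights_eq_of_dUp hkρ.algebraic (hp'.commute hc) hE'
      refine ⟨_, Or.inr (Or.inr (Or.inr (Or.inr (Or.inl
        ⟨hp'.trans (hw ▸ pairConj_mHat _ w _), ?_, ?_⟩))))⟩
      · simpa [torusWeights] using hE'''
      · have h1 : x = 1 := by simpa [torusWeights] using hE'''
        simp [h1]
    have aux : ∀ (ρ' : SpecialLinearGroup (Fin 2) ℂ →* G2) (y : ℂˣ), 1 ≠ y →
        HasCocharacter ρ' 2 2 → PairConj s ρ (mHat (1, y)) ρ' →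
        PairConj s ρ (mHat (1, y)) iotaD2 ∧ y ^ 2 = 1 := by
      intro ρ' y hy h hp
      have key : ∀ {i j : Fin 7}, dUp ρ' i j ≠ 0 → torusWeights (1, y) i = torusWeights (1, y) j :=
        torusWeights_eq_of_dUp h.algebraic (hp.commute hc)
      have h02 : dUp ρ' 0 2 = 0 := by
        by_contra hne
        have := key hne
        simp [torusWeights] at this
        exact hy this.symm
      have h04 : dUp ρ' 0 4 = 0 := by
        by_contra hne
        have := key hne
        simp [torusWeights] at this
        exact hy (Units.ext this)
      obtain ⟨hE, hE', w, hw⟩ := h.exists_conj_iotaD2 h02 h04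
      refine ⟨hp.trans (hw ▸ pairConj_mHat _ w _), ?_⟩
      have := key hE
      simp [torusWeights] at this
      refine Units.ext ?_
      have h0 := y.ne_zero
      field_simp at this
      simpa using this
    by_cases hx : x = 1
    · subst hx
      obtain ⟨h1, h2⟩ := aux ρ' y hz1 h hp
      exact ⟨_, Or.inr (Or.inr (Or.inr (Or.inr (Or.inl ⟨h1, rfl, h2⟩))))⟩
    by_cases hy : y = 1
    · subst hy
      obtain ⟨ρ'', h'', hp''⟩ := h.exists_swap (x, 1)
      obtain ⟨h1, h2⟩ := aux ρ'' x (Ne.symm hx) h'' (hp.trans hp'')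
      exact ⟨_, Or.inr (Or.inr (Or.inr (Or.inr (Or.inl ⟨h1, rfl, h2⟩))))⟩
    have h02 : dUp ρ' 0 2 = 0 := by
      by_contra hne
      have := key hne
      simp [torusWeights] at this
      exact hy this
    have h14 : dUp ρ' 1 4 = 0 := by
      by_contra hne
      have := key hne
      simp [torusWeights] at this
      exact hx this
    obtain ⟨hE, hE', w, hw⟩ := h.exists_conj_iotaA2 h02 h14
    have e1 := key hE
    have e2 := key hE'
    simp [torusWeights] at e1 e2
    have hx0 := x.ne_zero
    have hy0 := y.ne_zero
    field_simp at e1 e2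
    have e3 : y = x ^ 2 := Units.ext (by simpa using e2.symm)
    refine ⟨_, Or.inr (Or.inr (Or.inr (Or.inr (Or.inr
      ⟨hp.trans (hw ▸ pairConj_mHat _ w _), ?_, ?_, hx⟩))))⟩
    · exact e3
    · refine Units.ext (mul_left_cancel₀ hx0 ?_)
      rw [e3] at e1
      push_cast at e1 ⊢
      linear_combination e1
  · obtain ⟨hE, hE', w, hw⟩ := h.exists_conj_iotaReg
    refine ⟨_, Or.inr (Or.inr (Or.inr (Or.inl ⟨hp.trans (hw ▸ pairConj_mHat _ w _), ?_⟩)))⟩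
    have e1 := key hE
    have e2 := key hE'
    simp [torusWeights] at e1 e2
    have e3 : x = y := Units.ext e2
    subst e3
    have hx0 := x.ne_zero
    field_simp at e1
    ext <;> simpa using e1


end

/-! ### Polar coordinates on the torus and the roots with value q -/

noncomputable section

variable {F : Type*} [NontriviallyNormedField F] [IsUltrametricDist F] [LocallyCompactSpace F]

theorem one_lt_resCard_real : (1 : ℝ) < resCard F := Nat.one_lt_cast.2 (one_lt_resCard F)

theorem norm_qpolar (u : Circle) (a : ℝ) : ‖(qpolar F u a : ℂ)‖ = (resCard F : ℝ) ^ a := by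
  simp [qpolar, Real.abs_rpow_of_nonneg, Circle.norm_coe]

theorem qpolar_inj {u v : Circle} {a b : ℝ} : qpolar F u a = qpolar F v b ↔ u = v ∧ a = b := by
  refine ⟨fun h => ?_, fun h => qpolar_eq h.1 h.2⟩
  have hab : a = b := by
    have := congrArg (fun x : ℂˣ => ‖(x : ℂ)‖) h
    simp only [norm_qpolar] at this
    exact (Real.rpow_right_inj (zero_lt_one.trans one_lt_resCard_real)
      one_lt_resCard_real.ne').1 this
  subst hab
  refine ⟨?_, rfl⟩
  have := congrArg (fun x : ℂˣ => (x : ℂ)) (mul_right_cancel h)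
  exact Circle.ext this

theorem exists_eq_qpolar (x : ℂˣ) : ∃ u a, x = qpolar F u a := by
  have hx : 0 < ‖(x : ℂ)‖ := norm_pos_iff.2 x.ne_zero
  have hq : (0 : ℝ) < resCard F := zero_lt_one.trans one_lt_resCard_real
  refine ⟨Circle.exp (x : ℂ).arg, Real.logb (resCard F) ‖(x : ℂ)‖, ?_⟩
  ext
  simp only [qpolar, Units.val_mul, Units.val_mk0, Real.rpow_logb hq one_lt_resCard_real.ne' hx]
  rw [mul_comm]
  exact (Complex.norm_mul_exp_arg_mul_I _).symm

theorem qpolar_div (u v : Circle) (a b : ℝ) :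
    qpolar F u a / qpolar F v b = qpolar F (u / v) (a - b) := by
  rw [div_eq_mul_inv, qpolar_inv, qpolar_mul, div_eq_mul_inv, sub_eq_add_neg]

theorem qpolar_zpow (u : Circle) (a : ℝ) (n : ℤ) : qpolar F u a ^ n = qpolar F (u ^ n) (n * a) := by
  cases n with
  | ofNat n => simpa using qpolar_pow u a n
  | negSucc n =>
    rw [zpow_negSucc, qpolar_pow, qpolar_inv, zpow_negSucc]
    refine qpolar_eq rfl ?_
    push_cast [Int.cast_negSucc]
    ring

theorem rootValue_qpolar (γ : ℤ × ℤ) (u v : Circle) (a b : ℝ) :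
    rootValue γ (qpolar F u a, qpolar F v b) = qpolar F (u ^ (γ.2 - γ.1) * v ^ (2 * γ.1 - γ.2))
      ((γ.2 - γ.1) * a + (2 * γ.1 - γ.2) * b) := by
  rw [rootValue, qpolar_inv, qpolar_inv, qpolar_pow, qpolar_mul, qpolar_mul, qpolar_zpow,
    qpolar_zpow, qpolar_mul]
  refine qpolar_eq ?_ ?_
  · rw [mul_zpow, mul_zpow, _root_.inv_zpow, _root_.inv_zpow, _root_.zpow_sub, _root_.zpow_sub, _root_.zpow_mul]
    have : (v ^ 2) ^ γ.1 = (v ^ (2 : ℤ)) ^ γ.1 := by norm_cast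
    rw [this]
    simp only [mul_comm, mul_left_comm, mul_assoc]
  · push_cast
    ring

theorem mem_qRoots_qpolar {γ : ℤ × ℤ} {u v : Circle} {a b : ℝ} :
    γ ∈ qRoots F (qpolar F u a, qpolar F v b) ↔ γ ∈ roots ∧
      u ^ (γ.2 - γ.1) * v ^ (2 * γ.1 - γ.2) = 1 ∧ (γ.2 - γ.1) * a + (2 * γ.1 - γ.2) * b = 1 := by
  have h : ((resCard F : ℕ) : ℂ) = qpolar F 1 1 := by simp [qpolar]
  rw [qRoots, Set.mem_ofPred_eq, h, Units.val_inj, rootValue_qpolar, qpolar_inj]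

theorem circle_sq_eq_one {u : Circle} (h : u ^ 2 = 1) : u = 1 ∨ u = -1 := by
  have : (u : ℂ) ^ 2 = 1 := by simpa using congrArg (fun x : Circle => (x : ℂ)) h
  rcases sq_eq_one_iff.1 this with h | h
  · exact Or.inl (Circle.ext (by simpa using h))
  · exact Or.inr (Circle.ext (by simpa using h))

theorem circle_cube_eq_one {θ₃ u : Circle} (hθ₃ : IsPrimitiveRoot θ₃ 3) (h : u ^ 3 = 1) :
    ∃ n : Fin 3, u = θ₃ ^ n.val := by
  have h1 : IsPrimitiveRoot (θ₃ : ℂ) 3 :=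
    hθ₃.map_of_injective (f := Circle.coeHom) Circle.coe_injective
  have h2 : (u : ℂ) ^ 3 = 1 := by simpa using congrArg (fun x : Circle => (x : ℂ)) h
  obtain ⟨i, hi, h3⟩ := h1.eq_pow_of_pow_eq_one h2
  exact ⟨⟨i, hi⟩, Circle.ext (by simpa using h3.symm)⟩

/-- Each further root with value q gives an equation for the power of u and a linear equation for a;
solving them produces the exceptional points. Together they cover the exclusions built into the
families 1a and 1b. -/
theorem qRoots_one_two (u : Circle) (a : ℝ) : qRoots F (qpolar F 1 1, qpolar F u a) = {(1, 2)} ∨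
    (u = 1 ∧ (a = 0 ∨ a = 1 ∨ a = 2 ∨ a = -1 ∨ a = 3 ∨ a = -2)) ∨ (u = -1 ∧ (a = 0 ∨ a = 1)) := by
  rw [or_iff_not_imp_right]
  intro h
  ext γ
  rw [mem_qRoots_qpolar, Set.mem_singleton_iff]
  constructor
  · rintro ⟨h1, h2, h3⟩
    simp only [roots, Finset.mem_insert, Finset.mem_singleton] at h1
    by_contra hne
    apply h
    have hsq : u ^ 2 = 1 → u = 1 ∨ u = -1 := circle_sq_eq_one
    replace h2 : u ^ (2 * γ.1 - γ.2) = 1 := by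
      simpa [← _root_.zpow_add] using h2
    rcases h1 with rfl | rfl | rfl | rfl | rfl | rfl | rfl | rfl | rfl | rfl | rfl | rfl <;>
      first
      | exact (hne rfl).elim
      | (norm_num at h3; done)
      | (norm_num [zpow_ofNat, _root_.zpow_neg] at h2 h3; grind)
  · rintro rfl
    norm_num [roots]

/-- The same computation along xy = q. Here long roots can contribute the third power of u, which is
the source of the cube roots of unity in the list. -/
theorem qRoots_two_three (u : Circle) (a : ℝ) :
    qRoots F (qpolar F u a, qpolar F u⁻¹ (1 - a)) = {(2, 3)} ∨
    (u = 1 ∧ (a = 0 ∨ a = 1 ∨ a = 2 ∨ a = -1)) ∨ (u = -1 ∧ (a = 0 ∨ a = 1)) ∨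
      (u ^ 3 = 1 ∧ (a = 0 ∨ a = 1 / 3 ∨ a = 2 / 3 ∨ a = 1)) := by
  rw [or_iff_not_imp_right]
  intro h
  ext γ
  rw [mem_qRoots_qpolar, Set.mem_singleton_iff]
  constructor
  · rintro ⟨h1, h2, h3⟩
    simp only [roots, Finset.mem_insert, Finset.mem_singleton] at h1
    by_contra hne
    apply h
    have hsq : u ^ 2 = 1 → u = 1 ∨ u = -1 := circle_sq_eq_one
    replace h2 : u ^ ((γ.2 - γ.1) + -(2 * γ.1 - γ.2)) = 1 := by
      simpa [← _root_.zpow_add, _root_.inv_zpow'] using h2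
    rcases h1 with rfl | rfl | rfl | rfl | rfl | rfl | rfl | rfl | rfl | rfl | rfl | rfl <;>
      first
      | exact (hne rfl).elim
      | (norm_num at h3; done)
      | (norm_num [zpow_ofNat, _root_.zpow_neg] at h2 h3; grind)
  · rintro rfl
    norm_num [roots]

end

/-! ### Matching with the list up to conjugacy -/

noncomputable section

variable {F : Type*} [NontriviallyNormedField F] [IsUltrametricDist F] [LocallyCompactSpace F]
  {θ₃ : Circle} {hθ₃ : IsPrimitiveRoot θ₃ 3} {ρ ρ' : SpecialLinearGroup (Fin 2) ℂ →* G2}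

/-- The pair of an element and a homomorphism is conjugate to the one of a member of the list. -/
def InList (F : Type*) [NontriviallyNormedField F] [IsUltrametricDist F] [LocallyCompactSpace F]
    {θ₃ : Circle} (hθ₃ : IsPrimitiveRoot θ₃ 3) (s : G2)
    (ρ : SpecialLinearGroup (Fin 2) ℂ →* G2) : Prop :=
  ∃ (r : ParamIndex F) (z : ℂˣ × ℂˣ) (ι : SpecialLinearGroup (Fin 2) ℂ →* G2),
    PairConj s ρ (mHat z) ι ∧ ∀ p, (r.param θ₃ hθ₃).toHom p = mHat z ^ ord p.1 * ι p.2

theorem InList.of_pairConj {s s' : G2} (h : PairConj s ρ s' ρ') (h' : InList F hθ₃ s' ρ') :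
    InList F hθ₃ s ρ := by
  obtain ⟨r, z, ι, h1, h2⟩ := h'
  exact ⟨r, z, ι, h.trans h1, h2⟩

theorem InList.of_index {z : ℂˣ × ℂˣ} {ι : SpecialLinearGroup (Fin 2) ℂ →* G2} (r : ParamIndex F)
    (h : ∀ p, (r.param θ₃ hθ₃).toHom p = mHat z ^ ord p.1 * ι p.2) :
    InList F hθ₃ (mHat z) ι :=
  ⟨r, z, ι, PairConj.refl _ _, h⟩

theorem InList.congr {u v u' v' : Circle} {a b a' b' : ℝ}
    (h : InList F hθ₃ (mHat (qpolar F u' a', qpolar F v' b')) ρ) (hu : u = u') (ha : a = a')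
    (hv : v = v') (hb : b = b') : InList F hθ₃ (mHat (qpolar F u a, qpolar F v b)) ρ := by
  rwa [hu, ha, hv, hb]

/-! ### Parameters that are trivial on `SL₂(ℂ)` -/

theorem InList.swap_one {x y : ℂˣ} (h : InList F hθ₃ (mHat (y, x)) 1) :
    InList F hθ₃ (mHat (x, y)) 1 := by
  obtain ⟨ρ', h1, h2⟩ := hasCocharacter_one.exists_swap (x, y)
  rw [h1.eq_one] at h2
  exact h.of_pairConj h2

theorem InList.div_one {x y : ℂˣ} (h : InList F hθ₃ (mHat (x, x / y)) 1) :
    InList F hθ₃ (mHat (x, y)) 1 := by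
  obtain ⟨ρ', h1, h2⟩ := hasCocharacter_one.exists_sub (x, y)
  rw [sub_zero] at h1
  rw [h1.eq_one] at h2
  exact h.of_pairConj h2

/-- The product of the two simple reflections has order six, and its third power is the element -1
of the Weyl group. -/
theorem InList.inv_one {x y : ℂˣ} (h : InList F hθ₃ (mHat (x⁻¹, y⁻¹)) 1) :
    InList F hθ₃ (mHat (x, y)) 1 := by
  refine swap_one (div_one (swap_one (div_one (swap_one (div_one ?_)))))
  have e1 : y / x / y = x⁻¹ := by
    ext
    push_cast
    field_simp
  have e2 : y / x / y / (y / x) = y⁻¹ := by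
    ext
    push_cast
    field_simp
  rwa [e2, e1]

theorem InList.div_qpolar {u v w : Circle} {a b c : ℝ}
    (h : InList F hθ₃ (mHat (qpolar F u a, qpolar F w c)) 1) (hu : u = w * v) (ha : a = c + b) :
    InList F hθ₃ (mHat (qpolar F u a, qpolar F v b)) 1 := by
  refine .div_one ?_
  rw [qpolar_div]
  exact h.congr rfl rfl (by rw [hu, mul_div_cancel_right]) (by rw [ha, add_sub_cancel_right])

/-- Outside the exceptional points this is the family 1a. The exceptional points are Weyl conjugates
of those of 4a, 5a, 7a and 8a. -/
theorem inList_one_of_fst (u : Circle) (a : ℝ) :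
    InList F hθ₃ (mHat (qpolar F 1 1, qpolar F u a)) 1 := by
  have h8 : InList F hθ₃ (mHat (qpolar F 1 1, qpolar F 1 1)) 1 := .of_index .i8a fun _ => rfl
  have h4 : InList F hθ₃ (mHat (qpolar F 1 1, qpolar F (-1) 1)) 1 := .of_index .i4a fun _ => rfl
  have h5 : InList F hθ₃ (mHat (qpolar F 1 1, qpolar F 1 2)) 1 :=
    .swap_one (.of_index .i5a fun _ => rfl)
  have h7 : InList F hθ₃ (mHat (qpolar F 1 3, qpolar F 1 2)) 1 := .of_index .i7a fun _ => rfl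
  have h7' : InList F hθ₃ (mHat (qpolar F 1 1, qpolar F 1 3)) 1 :=
    .swap_one (h7.div_qpolar (by simp) (by norm_num))
  rcases qRoots_one_two (F := F) u a with h | ⟨rfl, rfl | rfl | rfl | rfl | rfl | rfl⟩ |
    ⟨rfl, rfl | rfl⟩
  · exact .of_index (.i1a u a h) fun _ => rfl
  · exact h8.div_qpolar (by simp) (by norm_num)
  · exact h8
  · exact h5
  · exact h5.div_qpolar (by simp) (by norm_num)
  · exact h7'
  · exact h7'.div_qpolar (by simp) (by norm_num)
  · exact h4.div_qpolar (by simp) (by norm_num)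
  · exact h4

/-- Outside the exceptional points this is the family 2a. For u = ±1 a reflection or inversion makes
a coordinate equal to q, which is the previous case; cube roots of unity lead to 3a and 6a. -/
theorem inList_one_of_mul (u : Circle) (a : ℝ) :
    InList F hθ₃ (mHat (qpolar F u a, qpolar F u⁻¹ (1 - a))) 1 := by
  have h3 : ∀ u : Circle, u ^ 3 = 1 →
      InList F hθ₃ (mHat (qpolar F u (1 / 3), qpolar F u⁻¹ (2 / 3))) 1 := fun u hu => by
    obtain ⟨n, rfl⟩ := circle_cube_eq_one hθ₃ hu
    have : (θ₃ ^ n.val)⁻¹ = (θ₃ ^ n.val) ^ 2 := by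
      rw [inv_eq_iff_mul_eq_one, ← pow_succ', hu]
    rw [this]
    exact .of_index (.i3a n) fun _ => rfl
  have h6 : ∀ u : Circle, u ^ 3 = 1 →
      InList F hθ₃ (mHat (qpolar F u 1, qpolar F u⁻¹ 0)) 1 := fun u hu => by
    have h6' : InList F hθ₃ (mHat (qpolar F θ₃ 1, qpolar F (θ₃ ^ 2) 1)) 1 :=
      .of_index .i6a fun _ => rfl
    have e : θ₃ ^ 3 = 1 := hθ₃.pow_eq_one
    obtain ⟨n, rfl⟩ := circle_cube_eq_one hθ₃ hu
    fin_cases n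
    · exact (inList_one_of_fst 1 0).congr (by simp) rfl (by simp) rfl
    · refine h6'.div_qpolar (v := _) (by simp [sq]) (by norm_num) |>.congr (by simp) rfl rfl rfl
    · refine (h6'.swap_one.div_qpolar (v := θ₃) (b := 0) (by rw [sq]) (by norm_num)).congr rfl rfl ?_ rfl
      change (θ₃ ^ 2)⁻¹ = θ₃
      rw [inv_eq_iff_mul_eq_one, ← pow_succ, e]
  have hs : ∀ (u : Circle) (a b : ℝ), b = 1 →
      InList F hθ₃ (mHat (qpolar F u a, qpolar F 1 b)) 1 := fun u a b hb => by
    subst hb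
    exact .swap_one (inList_one_of_fst _ _)
  rcases qRoots_two_three (F := F) u a with h | ⟨rfl, rfl | rfl | rfl | rfl⟩ |
    ⟨rfl, rfl | rfl⟩ | ⟨hu, rfl | rfl | rfl | rfl⟩
  · exact .of_index (.i2a u a h) fun _ => rfl
  · exact (hs 1 0 _ rfl).congr rfl rfl (by simp) (by norm_num)
  · exact inList_one_of_fst _ _
  · exact (InList.inv_one (by
      rw [qpolar_inv, qpolar_inv]
      exact (hs _ _ _ rfl).congr rfl rfl (by simp) (by norm_num)))
  · exact .swap_one (.inv_one (by
      rw [qpolar_inv, qpolar_inv]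
      exact (hs _ _ _ rfl).congr rfl rfl (by simp) (by norm_num)))
  · refine .swap_one (.div_qpolar (w := 1) (c := 1) (hs _ _ _ rfl) ?_ ?_)
    · simp
    · norm_num
  · refine .div_qpolar (w := 1) (c := 1) (hs _ _ _ rfl) ?_ ?_
    · simp
    · norm_num
  · refine .swap_one ((h6 u⁻¹ (by rw [inv_pow, hu, inv_one])).congr rfl (by norm_num) (by simp) rfl)
  · exact (h3 u hu).congr rfl rfl rfl (by norm_num)
  · refine .swap_one ((h3 u⁻¹ (by rw [inv_pow, hu, inv_one])).congr rfl (by norm_num) (by simp) rfl)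
  · exact (h6 u hu).congr rfl rfl rfl (by norm_num)

/-- If no root has value q, this is the family 0. Otherwise the Weyl group moves such a root to γ̂₁
+ 2γ̂₂ or 2γ̂₁ + 3γ̂₂ according to its length, and the equation becomes x = q or xy = q. -/
theorem inList_one (z : ℂˣ × ℂˣ) : InList F hθ₃ (mHat z) 1 := by
  obtain ⟨x, y⟩ := z
  have hs : ∀ x y, x = qpolar F 1 1 → InList F hθ₃ (mHat (x, y)) 1 := fun x y hx => by
    obtain ⟨u, a, rfl⟩ := exists_eq_qpolar (F := F) y
    exact hx ▸ inList_one_of_fst u a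
  have hl : ∀ x y, x * y = qpolar F 1 1 → InList F hθ₃ (mHat (x, y)) 1 := fun x y hxy => by
    obtain ⟨u, a, rfl⟩ := exists_eq_qpolar (F := F) x
    rw [← eq_div_iff_mul_eq'', qpolar_div, one_div] at hxy
    subst hxy
    exact inList_one_of_mul u a
  by_cases hR : qRoots F (x, y) = ∅
  · obtain ⟨u, a, rfl⟩ := exists_eq_qpolar (F := F) x
    obtain ⟨v, b, rfl⟩ := exists_eq_qpolar (F := F) y
    exact .of_index (.i0 u v a b hR) fun _ => rfl
  · obtain ⟨γ, h1, h2⟩ := Set.nonempty_iff_ne_empty.2 hR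
    have h : ((resCard F : ℕ) : ℂ) = qpolar F 1 1 := by simp [qpolar]
    rw [h, Units.val_inj] at h2
    have key : ∀ c : ℂˣ, c = rootValue γ (x, y) → c = qpolar F 1 1 := fun c hc => hc.trans h2
    simp only [roots, Finset.mem_insert, Finset.mem_singleton] at h1
    rcases h1 with rfl | rfl | rfl | rfl | rfl | rfl | rfl | rfl | rfl | rfl | rfl | rfl
    · refine .swap_one (.div_one (hl _ _ (key _ ?_)))
      ext; simp [rootValue]; try field_simp
    · refine .div_one (.swap_one (hs _ _ (key _ ?_)))
      ext; simp [rootValue]; try field_simp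
    · refine .swap_one (hs _ _ (key _ ?_))
      ext; simp [rootValue]; try field_simp
    · refine hs _ _ (key _ ?_)
      ext; simp [rootValue]; try field_simp
    · refine .div_one (hl _ _ (key _ ?_))
      ext; simp [rootValue]; try field_simp
    · refine hl _ _ (key _ ?_)
      ext; simp [rootValue]; try field_simp
    · refine .inv_one (.swap_one (.div_one (hl _ _ (key _ ?_))))
      ext; simp [rootValue]; try field_simp
    · refine .inv_one (.div_one (.swap_one (hs _ _ (key _ ?_))))
      ext; simp [rootValue]; try field_simp
    · refine .inv_one (.swap_one (hs _ _ (key _ ?_)))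
      ext; simp [rootValue]; try field_simp
    · refine .inv_one (hs _ _ (key _ ?_))
      ext; simp [rootValue]; try field_simp
    · refine .inv_one (.div_one (hl _ _ (key _ ?_)))
      ext; simp [rootValue]; try field_simp
    · refine .inv_one (hl _ _ (key _ ?_))
      ext; simp [rootValue]; try field_simp

end

noncomputable section

variable {F : Type*} [NontriviallyNormedField F] [IsUltrametricDist F] [LocallyCompactSpace F]
  {θ₃ : Circle} {hθ₃ : IsPrimitiveRoot θ₃ 3} {ρ ι : SpecialLinearGroup (Fin 2) ℂ →* G2}

/-! ### Parameters that are not trivial on `SL₂(ℂ)` -/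

/-- All pairs of `m̂(x, y)` and a homomorphism with the given cocharacter are in the list. -/
def AllInList (F : Type*) [NontriviallyNormedField F] [IsUltrametricDist F] [LocallyCompactSpace F]
    {θ₃ : Circle} (hθ₃ : IsPrimitiveRoot θ₃ 3) (a b : ℤ) (x y : ℂˣ) : Prop :=
  ∀ ρ, HasCocharacter ρ a b → InList F hθ₃ (mHat (x, y)) ρ

variable {a b : ℤ} {x y : ℂˣ}

theorem AllInList.swap (H : AllInList F hθ₃ b a y x) : AllInList F hθ₃ a b x y := fun ρ h => by
  obtain ⟨ρ', h1, h2⟩ := h.exists_swap (x, y)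
  exact (H ρ' h1).of_pairConj h2

theorem AllInList.sub (H : AllInList F hθ₃ a (a - b) x (x / y)) : AllInList F hθ₃ a b x y :=
  fun ρ h => by
  obtain ⟨ρ', h1, h2⟩ := h.exists_sub (x, y)
  exact (H ρ' h1).of_pairConj h2

theorem AllInList.of_index {r : ParamIndex F}
    (H : ∀ ρ, HasCocharacter ρ a b → ∃ w, conjHom (mHat w) ρ = ι)
    (h : ∀ p, (r.param θ₃ hθ₃).toHom p = mHat (x, y) ^ ord p.1 * ι p.2) :
    AllInList F hθ₃ a b x y := fun ρ hρ => by
  obtain ⟨w, rfl⟩ := H ρ hρ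
  exact .of_pairConj (pairConj_mHat _ w ρ) (.of_index r h)

/-- The shift by 1/2 makes (q, u q^a) the infinitesimal Frobenius, so the exceptional points are
those of `qRoots_one_two`. They are covered by 4c and 8c, by 5b and 7c after a reflection taking γ̂₁
+ 2γ̂₂ to γ̂₂, and by inverses of these. -/
theorem allInList_two_one (u : Circle) (a : ℝ) :
    AllInList F hθ₃ 2 1 1 (qpolar F u (a - 1 / 2)) := by
  have hI : ∀ (r : ParamIndex F) {x y : ℂˣ}
      (_ : ∀ p, (r.param θ₃ hθ₃).toHom p = mHat (x, y) ^ ord p.1 * iota12 p.2),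
      AllInList F hθ₃ 2 1 x y := fun r _ _ h =>
    .of_index (fun ρ h => h.exists_conj_iota12.2) h
  have h01 : ∀ (r : ParamIndex F) {y : ℂˣ}
      (_ : ∀ p, (r.param θ₃ hθ₃).toHom p = mHat (y, y) ^ ord p.1 * iota01 p.2),
      AllInList F hθ₃ 2 1 1 y := fun r y h => by
    refine .swap (.sub ?_)
    rw [div_one]
    exact .of_index (fun ρ h => h.exists_conj_iota01.2) h
  have hinv : ∀ {u : Circle} {b : ℝ}, AllInList F hθ₃ 2 1 1 (qpolar F u b) →
      AllInList F hθ₃ 2 1 1 (qpolar F u⁻¹ (-b)) := fun {u b} h => by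
    refine .sub ?_
    rw [one_div, qpolar_inv, inv_inv, neg_neg]
    exact h
  have h8 : AllInList F hθ₃ 2 1 1 (qpolar F 1 (1 / 2)) := hI .i8c fun _ => rfl
  have h4 : AllInList F hθ₃ 2 1 1 (qpolar F (-1) (1 / 2)) := hI .i4c fun _ => rfl
  have h5 : AllInList F hθ₃ 2 1 1 (qpolar F 1 (3 / 2)) := h01 .i5b fun _ => rfl
  have h7 : AllInList F hθ₃ 2 1 1 (qpolar F 1 (5 / 2)) := h01 .i7c fun _ => rfl
  have of_eq : ∀ {u v : Circle} {a b : ℝ}, AllInList F hθ₃ 2 1 1 (qpolar F u b) → v = u → a = b →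
      AllInList F hθ₃ 2 1 1 (qpolar F v a) := fun h hu hb => by rwa [hu, hb]
  rcases qRoots_one_two (F := F) u a with h | ⟨rfl, rfl | rfl | rfl | rfl | rfl | rfl⟩ |
    ⟨rfl, rfl | rfl⟩
  · exact hI (.i1b u a h) fun _ => rfl
  · exact of_eq (hinv h8) (by simp) (by norm_num)
  · exact of_eq h8 rfl (by norm_num)
  · exact of_eq h5 rfl (by norm_num)
  · exact of_eq (hinv h5) (by simp) (by norm_num)
  · exact of_eq h7 rfl (by norm_num)
  · exact of_eq (hinv h7) (by simp) (by norm_num)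
  · exact of_eq (hinv h4) (by simp) (by norm_num)
  · exact of_eq h4 rfl (by norm_num)

/-- The analogue for long roots. At the exceptional points the root is reflected to γ̂₁ + 3γ̂₂ or
γ̂₁, which gives the members 3b, 4b, 6b, 6c, 7b and 8b. -/
theorem allInList_one_one (u : Circle) (a : ℝ) :
    AllInList F hθ₃ 1 1 (qpolar F u (a - 1 / 2)) (qpolar F u⁻¹ (1 / 2 - a)) := by
  have h13 : ∀ (r : ParamIndex F) {u : Circle} {a : ℝ}
      (_ : ∀ p, (r.param θ₃ hθ₃).toHom p =
        mHat (qpolar F u a, qpolar F (u ^ 2) (2 * a)) ^ ord p.1 * iota13 p.2),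
      AllInList F hθ₃ 1 1 (qpolar F u a) (qpolar F u⁻¹ (-a)) := fun r u a h => by
    refine .sub ?_
    rw [qpolar_div, div_inv_eq_mul, ← sq, sub_neg_eq_add, ← two_mul]
    exact .of_index (fun ρ h => h.exists_conj_iota13.2) h
  have h10 : ∀ (r : ParamIndex F) {u : Circle} {a : ℝ}
      (_ : ∀ p, (r.param θ₃ hθ₃).toHom p =
        mHat (qpolar F (u ^ 2) (2 * a), qpolar F u a) ^ ord p.1 * iota10 p.2),
      AllInList F hθ₃ 1 1 (qpolar F u a) (qpolar F u⁻¹ (-a)) := fun r u a h => by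
    refine .sub ?_
    rw [qpolar_div, div_inv_eq_mul, ← sq, sub_neg_eq_add, ← two_mul]
    exact .swap (.of_index (fun ρ h => h.exists_conj_iota10.2) h)
  have of_eq : ∀ {u v : Circle} {a b : ℝ},
      AllInList F hθ₃ 1 1 (qpolar F v b) (qpolar F v⁻¹ (-b)) → u = v → a - 1 / 2 = b →
      AllInList F hθ₃ 1 1 (qpolar F u (a - 1 / 2)) (qpolar F u⁻¹ (1 / 2 - a)) :=
    fun h hu hb => by rwa [hu, ← neg_sub _ (1 / 2 : ℝ), hb]
  have of_inv : ∀ {u v : Circle} {a b : ℝ},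
      AllInList F hθ₃ 1 1 (qpolar F v b) (qpolar F v⁻¹ (-b)) → u = v⁻¹ → 1 / 2 - a = b →
      AllInList F hθ₃ 1 1 (qpolar F u (a - 1 / 2)) (qpolar F u⁻¹ (1 / 2 - a)) :=
    fun h hu hb => .swap (by rwa [hu, inv_inv, ← neg_sub (1 / 2 : ℝ), hb])
  have h8 : AllInList F hθ₃ 1 1 (qpolar F 1 (1 / 2)) (qpolar F 1⁻¹ (-(1 / 2))) :=
    h10 .i8b fun _ => by rw [one_pow, mul_one_div_cancel two_ne_zero]; rfl
  have h4 : AllInList F hθ₃ 1 1 (qpolar F (-1) (1 / 2)) (qpolar F (-1)⁻¹ (-(1 / 2))) :=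
    h10 .i4b fun _ => by rw [neg_one_sq, mul_one_div_cancel two_ne_zero]; rfl
  have h7 : AllInList F hθ₃ 1 1 (qpolar F 1 (3 / 2)) (qpolar F 1⁻¹ (-(3 / 2))) :=
    h10 .i7b fun _ => by rw [one_pow, mul_div_cancel₀ _ two_ne_zero]; rfl
  -- For cube roots of unity, the second coordinate in the γ̂₁ members is the square of the first;
  -- squaring permutes the cube roots, so the index has to be translated.
  have e3 : θ₃ ^ 3 = 1 := hθ₃.pow_eq_one
  have e4 : (θ₃ ^ 2) ^ 2 = θ₃ := by
    rw [← pow_mul, show 2 * 2 = 3 + 1 from rfl, pow_succ, e3, one_mul]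
  have h3 : ∀ u : Circle, u ^ 3 = 1 →
      AllInList F hθ₃ 1 1 (qpolar F u (1 / 6)) (qpolar F u⁻¹ (-(1 / 6))) := fun u hu => by
    have hu2 : (u ^ 2) ^ 3 = 1 := by rw [← pow_mul, mul_comm, pow_mul, hu, one_pow]
    have hu4 : (u ^ 2) ^ 2 = u := by
      rw [← pow_mul, show 2 * 2 = 3 + 1 from rfl, pow_succ, hu, one_mul]
    obtain ⟨n, hn⟩ := circle_cube_eq_one hθ₃ hu2
    refine h10 (.i3b n) fun p => ?_
    have hu' : u = (θ₃ ^ n.val) ^ 2 := by rw [← hn, hu4]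
    rw [hn, hu', show (2 * (1 / 6) : ℝ) = 1 / 3 by norm_num]
    rfl
  have h6 : ∀ u : Circle, u ^ 3 = 1 →
      AllInList F hθ₃ 1 1 (qpolar F u (1 / 2)) (qpolar F u⁻¹ (-(1 / 2))) := fun u hu => by
    obtain ⟨n, rfl⟩ := circle_cube_eq_one hθ₃ hu
    fin_cases n
    · simpa using h8
    · refine h13 .i6c fun _ => ?_
      rw [mul_one_div_cancel two_ne_zero]
      simp only [pow_one]
      rfl
    · refine h10 .i6b fun _ => ?_
      rw [mul_one_div_cancel two_ne_zero]
      simp only [e4]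
      rfl
  rcases qRoots_two_three (F := F) u a with h | ⟨rfl, rfl | rfl | rfl | rfl⟩ |
    ⟨rfl, rfl | rfl⟩ | ⟨hu, ha⟩
  · exact .of_index (fun ρ h => h.exists_conj_iota23.2) (r := .i2b u a h) fun _ => rfl
  · exact of_inv h8 (by simp) (by norm_num)
  · exact of_eq h8 rfl (by norm_num)
  · exact of_eq h7 rfl (by norm_num)
  · exact of_inv h7 (by simp) (by norm_num)
  · exact of_inv h4 (by simp) (by norm_num)
  · exact of_eq h4 rfl (by norm_num)
  · have hu' : u⁻¹ ^ 3 = 1 := by rw [inv_pow, hu, inv_one]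
    rcases ha with rfl | rfl | rfl | rfl
    · exact of_inv (h6 _ hu') (by simp) (by norm_num)
    · exact of_inv (h3 _ hu') (by simp) (by norm_num)
    · exact of_eq (h3 _ hu) rfl (by norm_num)
    · exact of_eq (h6 _ hu) rfl (by norm_num)

theorem inList_iotaD2 {z : ℂˣ × ℂˣ} (h1 : z.1 = 1) (h2 : z.2 ^ 2 = 1) :
    InList F hθ₃ (mHat z) iotaD2 := by
  obtain ⟨x, y⟩ := z
  obtain rfl : x = 1 := h1
  obtain ⟨u, a, rfl⟩ := exists_eq_qpolar (F := F) y
  replace h2 : qpolar F u a ^ 2 = 1 := h2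
  rw [qpolar_pow, ← qpolar_one (F := F), qpolar_inj] at h2
  obtain rfl : a = 0 := by simpa using h2.2
  rcases circle_sq_eq_one h2.1 with rfl | rfl
  · refine .of_index .i8d ?_
    rw [qpolar_one]
    exact fun _ => rfl
  · exact .of_index .i4d fun _ => rfl

/-- The reflection exchanges the two primitive cube roots of unity and preserves the cocharacter (2,
2). The reflected homomorphism still commutes with the torus element, so it can again be normalized
to `iotaA2`. -/
theorem InList.swap_iotaA2 (hx : x ^ 3 = 1) (hx1 : x ≠ 1)
    (H : InList F hθ₃ (mHat (x ^ 2, x)) iotaA2) : InList F hθ₃ (mHat (x, x ^ 2)) iotaA2 := by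
  have hc : ∀ g, Commute (mHat (x, x ^ 2)) (iotaA2 g) := fun g =>
    commute_of_mat (g := iotaA2 g) (MA2_comm (z := (x, x ^ 2)) rfl hx g.1)
  obtain ⟨ρ', h4, h5⟩ := hasCocharacter_iotaA2.exists_swap (x, x ^ 2)
  have hw := fun {i j} => torusWeights_eq_of_dUp h4.algebraic (h5.commute hc) (i := i) (j := j)
  have h02 : dUp ρ' 0 2 = 0 := by
    by_contra h
    have := hw h
    simp only [torusWeights, cons_val, ← Units.val_mul, Units.val_inj] at this
    exact hx1 (by simpa [sq] using this)
  have h14 : dUp ρ' 1 4 = 0 := by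
    by_contra h
    have := hw h
    simp only [torusWeights, cons_val, ← Units.val_mul, Units.val_inj] at this
    refine hx1 ?_
    rwa [eq_mul_inv_iff_mul_eq, mul_eq_left, ← mul_eq_left (a := x), ← pow_succ', hx, eq_comm] at this
  obtain ⟨-, -, w, hwρ⟩ := h4.exists_conj_iotaA2 h02 h14
  refine .of_pairConj (h5.trans (pairConj_mHat _ w ρ')) ?_
  rwa [hwρ]

theorem inList_iotaA2 {z : ℂˣ × ℂˣ} (h1 : z.2 = z.1 ^ 2) (h2 : z.1 ^ 3 = 1) (h3 : z.1 ≠ 1) :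
    InList F hθ₃ (mHat z) iotaA2 := by
  obtain ⟨x, y⟩ := z
  obtain rfl : y = x ^ 2 := h1
  replace h2 : x ^ 3 = 1 := h2
  replace h3 : x ≠ 1 := h3
  have h6 : InList F hθ₃ (mHat (qpolar F θ₃ 0, qpolar F (θ₃ ^ 2) 0)) iotaA2 :=
    .of_index .i6d fun _ => rfl
  obtain ⟨u, a, rfl⟩ := exists_eq_qpolar (F := F) x
  have h2' := h2
  rw [qpolar_pow, ← qpolar_one (F := F), qpolar_inj] at h2'
  obtain rfl : a = 0 := by simpa using h2'.2
  obtain ⟨n, rfl⟩ := circle_cube_eq_one hθ₃ h2'.1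
  obtain ⟨_ | _ | _ | n, hn⟩ := n
  · simp [qpolar_one] at h3
  · simpa [qpolar_pow] using h6
  · refine .swap_iotaA2 h2 h3 ?_
    have hx2 : qpolar F (θ₃ ^ 2) 0 ^ 2 = qpolar F θ₃ 0 := by
      rw [qpolar_pow, ← pow_mul, show 2 * 2 = 3 + 1 from rfl, pow_succ, hθ₃.pow_eq_one, one_mul,
        mul_zero]
    change InList F hθ₃ (mHat (qpolar F (θ₃ ^ 2) 0 ^ 2, qpolar F (θ₃ ^ 2) 0)) iotaA2
    rwa [hx2]
  · omega

theorem inList_of_commute {s : G2} (hρ : IsAlgebraicHom ρ) (hs : IsSemisimpleElt s)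
    (hc : ∀ x, Commute s (ρ x)) : InList F hθ₃ s ρ := by
  obtain ⟨⟨x, y⟩, h | ⟨h, hz⟩ | ⟨h, hz⟩ | ⟨h, hz⟩ | ⟨h, h1, h2⟩ | ⟨h, h1, h2, h3⟩⟩ :=
    exists_pairConj_of_commute hρ hs hc
  · exact .of_pairConj h (inList_one _)
  · refine .of_pairConj h ?_
    obtain ⟨u, a, rfl⟩ := exists_eq_qpolar (F := F) x
    obtain rfl : y = (qpolar F u a)⁻¹ := eq_inv_of_mul_eq_one_right hz
    have := allInList_one_one (F := F) (hθ₃ := hθ₃) u (a + 1 / 2) _ hasCocharacter_iota23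
    rwa [add_sub_cancel_right, sub_add_cancel_right, ← qpolar_inv] at this
  · refine .of_pairConj h ?_
    obtain ⟨u, a, rfl⟩ := exists_eq_qpolar (F := F) y
    obtain rfl : x = 1 := hz
    have := allInList_two_one (F := F) (hθ₃ := hθ₃) u (a + 1 / 2) _ hasCocharacter_iota12
    rwa [add_sub_cancel_right] at this
  · rw [hz] at h
    exact .of_pairConj h (.of_index .i7d fun _ => rfl)
  · exact .of_pairConj h (inList_iotaD2 h1 h2)
  · exact .of_pairConj h (inList_iotaA2 h1 h2 h3)

theorem LanglandsParameter.IsUnramified.exists_isConj {φ : LanglandsParameter F}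
    (hφ : φ.IsUnramified) : ∃ r : ParamIndex F, φ.IsConj (r.param θ₃ hθ₃) := by
  obtain ⟨w₁, hw₁⟩ := exists_ord_eq_one F
  obtain ⟨r, z, ι, ⟨g, h1, h2⟩, h3⟩ : InList F hθ₃ (φ.toHom (w₁, 1))
      (φ.toHom.comp (MonoidHom.inr _ _)) :=
    inList_of_commute φ.algebraic (φ.semisimple w₁) fun x => by
      change φ.toHom (w₁, 1) * φ.toHom (1, x) = φ.toHom (1, x) * φ.toHom (w₁, 1)
      rw [← map_mul, ← map_mul, Prod.mk_mul_mk, Prod.mk_mul_mk, one_mul, one_mul, mul_one, mul_one]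
  refine ⟨r, g, fun ⟨w, x⟩ => ?_⟩
  -- w differs from a power of the Frobenius element w₁ by inertia, where the parameter is trivial.
  have hw : φ.toHom (w, 1) = φ.toHom (w₁, 1) ^ ord w := by
    have h4 : ord (w * (w₁ ^ ord w)⁻¹) = 0 := by
      have h5 : weilOrd F w₁ = Multiplicative.ofAdd 1 := hw₁
      rw [ord, map_mul, map_inv, map_zpow, h5]
      simp [ord]
    have h5 := hφ _ h4
    have h6 : ((w * (w₁ ^ ord w)⁻¹, 1) : WeilGroup F × SpecialLinearGroup (Fin 2) ℂ) =
        (w, 1) * ((w₁, 1) ^ ord w)⁻¹ := by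
      ext1 <;> simp
    rwa [h6, map_mul, map_inv, map_zpow, mul_inv_eq_one] at h5
  have hwx : φ.toHom (w, x) = φ.toHom (w, 1) * φ.toHom (1, x) := by
    rw [← map_mul, Prod.mk_mul_mk, one_mul, mul_one]
  have h7 : ι x = g * φ.toHom (1, x) * g⁻¹ := by rw [← h2]; rfl
  rw [h3, hwx, hw, ← h1, h7, conj_zpow]
  group

end

noncomputable section

variable {F : Type*} [NontriviallyNormedField F] [IsUltrametricDist F]

/-! ### Parameters of Arthur type -/

theorem LanglandsParameter.IsConj.symm {φ φ' : LanglandsParameter F} (h : φ.IsConj φ') :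
    φ'.IsConj φ := by
  obtain ⟨g, hg⟩ := h
  exact ⟨g⁻¹, fun p => by rw [hg]; group⟩

theorem IsSemisimpleElt.conj {s : G2} (hs : IsSemisimpleElt s) (g : G2) :
    IsSemisimpleElt (g * s * g⁻¹) := by
  obtain ⟨P, hP⟩ := hs
  refine ⟨P * (g : GL (Fin 7) ℂ)⁻¹, ?_⟩
  convert hP using 2
  push_cast
  group

theorem exists_norm_mul_mul_le (A B : Matrix (Fin 7) (Fin 7) ℂ) (C : ℝ) :
    ∃ C', ∀ M : Matrix (Fin 7) (Fin 7) ℂ, (∀ i j, ‖M i j‖ ≤ C) →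
      ∀ i j, ‖(A * M * B) i j‖ ≤ C' := by
  refine ⟨∑ i, ∑ j, ∑ k, ∑ l, ‖A i l‖ * C * ‖B k j‖, fun M hM i j => ?_⟩
  have hC : 0 ≤ C := (norm_nonneg _).trans (hM 0 0)
  have h0 : ∀ i j k l, 0 ≤ ‖A i l‖ * C * ‖B k j‖ := fun i j k l => by positivity
  have h1 : ‖(A * M * B) i j‖ ≤ ∑ k, ∑ l, ‖A i l‖ * C * ‖B k j‖ := by
    rw [Matrix.mul_apply]
    refine (norm_sum_le _ _).trans (Finset.sum_le_sum fun k _ => ?_)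
    rw [Matrix.mul_apply, Finset.sum_mul]
    refine (norm_sum_le _ _).trans (Finset.sum_le_sum fun l _ => ?_)
    rw [norm_mul, norm_mul]
    gcongr
    exact hM _ _
  refine h1.trans ?_
  refine (Finset.single_le_sum (f := fun j => ∑ k, ∑ l, ‖A i l‖ * C * ‖B k j‖) (fun j _ => ?_)
    (Finset.mem_univ j)).trans ?_
  · exact Finset.sum_nonneg fun k _ => Finset.sum_nonneg fun l _ => h0 _ _ _ _
  · exact Finset.single_le_sum (f := fun i => ∑ j, ∑ k, ∑ l, ‖A i l‖ * C * ‖B k j‖)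
      (fun i _ => Finset.sum_nonneg fun j _ => Finset.sum_nonneg fun k _ =>
        Finset.sum_nonneg fun l _ => h0 _ _ _ _) (Finset.mem_univ i)

theorem LanglandsParameter.IsArthurType.of_isConj [LocallyCompactSpace F]
    {φ φ' : LanglandsParameter F} (hφ : φ.IsArthurType) (h : φ.IsConj φ') : φ'.IsArthurType := by
  obtain ⟨ψ, hψ⟩ := hφ
  obtain ⟨g, hg⟩ := h
  refine ⟨{ toHom := (MulAut.conj g).toMonoidHom.comp ψ.toHom
            continuous_weil := ?_
            semisimple := fun w => (ψ.semisimple w).conj g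
            bounded := ?_
            algebraic_left := isAlgebraicHom_conjHom ψ.algebraic_left g
            algebraic_right := isAlgebraicHom_conjHom ψ.algebraic_right g }, fun w x => ?_⟩
  · exact (continuous_const.mul ψ.continuous_weil).mul continuous_const
  · obtain ⟨C, hC⟩ := ψ.bounded
    obtain ⟨C', hC'⟩ := exists_norm_mul_mul_le (mat g) (mat g⁻¹) C
    exact ⟨C', fun w => hC' _ (hC w)⟩
  · rw [hg, hψ]
    rfl

variable [LocallyCompactSpace F]

theorem normDiag_eq (w : WeilGroup F) : normDiag w = slDiag (qpolar F 1 (1 / 2) ^ ord w) := by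
  have hq : (0 : ℝ) ≤ resCard F := Nat.cast_nonneg _
  have h : ∀ c : ℝ, ((weilNorm w ^ c : ℝ) : ℂ) = (qpolar F 1 (ord w * c) : ℂˣ) := fun c => by
    rw [weilNorm, ← Real.rpow_intCast, ← Real.rpow_mul hq]
    simp [qpolar]
  refine Subtype.ext ?_
  change diagonal ![((weilNorm w ^ (1 / 2 : ℝ) : ℝ) : ℂ), ((weilNorm w ^ (-1 / 2 : ℝ) : ℝ) : ℂ)] =
    !![((qpolar F 1 (1 / 2) ^ ord w : ℂˣ) : ℂ), 0; 0, ((qpolar F 1 (1 / 2) ^ ord w)⁻¹ : ℂˣ)]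
  rw [h, h, qpolar_zpow, _root_.one_zpow, qpolar_inv, inv_one, neg_div, mul_neg]
  ext i j
  fin_cases i <;> fin_cases j <;> rfl

theorem norm_torusWeights (u v : Circle) (i : Fin 7) :
    ‖torusWeights (qpolar F u 0, qpolar F v 0) i‖ = 1 := by
  fin_cases i <;> simp [torusWeights, norm_qpolar]

/-- The Arthur parameter is ψ(w, x, y) = m̂(u, v)^{ord w} ι(x) ι'(y). It is bounded because u and v
are unitary, and ι'(diag(q^{1/2}, q^{-1/2})) = m̂(q^{a/2}, q^{b/2}) supplies the rest of m̂(z). -/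
theorem isArthurType_of_commute {φ : LanglandsParameter F}
    {ι ι' : SpecialLinearGroup (Fin 2) ℂ →* G2} {z : ℂˣ × ℂˣ} {u v : Circle} {a b : ℤ}
    (hφ : ∀ p, φ.toHom p = mHat z ^ ord p.1 * ι p.2) (hι : IsAlgebraicHom ι)
    (hι' : HasCocharacter ι' a b)
    (hc : ∀ x, Commute (mHat (qpolar F u 0, qpolar F v 0)) (ι x))
    (hc' : ∀ x, Commute (mHat (qpolar F u 0, qpolar F v 0)) (ι' x))
    (hcomm : ∀ x y, Commute (ι x) (ι' y))
    (hz : z = (qpolar F u (a / 2), qpolar F v (b / 2))) : φ.IsArthurType := by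
  set s := mHat (qpolar F u 0, qpolar F v 0) with hs
  let f : WeilGroup F →* G2 := (zpowersHom G2 s).comp (weilOrd F)
  have hf : ∀ w, f w = s ^ ord w := fun w => rfl
  have hι1 : ∀ w x, Commute (f w) (ι x) := fun w x => by rw [hf]; exact (hc x).zpow_left _
  have hι2 : ∀ w x, Commute (f w) (ι' x) := fun w x => by rw [hf]; exact (hc' x).zpow_left _
  have hs' : ∀ n : ℤ, s ^ n = mHat (qpolar F (u ^ n) 0, qpolar F (v ^ n) 0) := fun n => by
    rw [hs, ← map_zpow, Prod.pow_mk, qpolar_zpow, qpolar_zpow, mul_zero]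
  let g : SpecialLinearGroup (Fin 2) ℂ × SpecialLinearGroup (Fin 2) ℂ →* G2 :=
    ι.noncommCoprod ι' hcomm
  let h : WeilGroup F × SpecialLinearGroup (Fin 2) ℂ × SpecialLinearGroup (Fin 2) ℂ →* G2 :=
    f.noncommCoprod g fun w x => (hι1 w x.1).mul_right (hι2 w x.2)
  have hh : ∀ w x y, h (w, x, y) = s ^ ord w * (ι x * ι' y) := fun w x y => rfl
  have hh1 : ∀ w, h (w, 1, 1) = s ^ ord w := fun w => by
    rw [hh, map_one, map_one, mul_one, mul_one]
  refine ⟨{ toHom := h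
            continuous_weil := ?_
            semisimple := fun w => ?_
            bounded := ⟨1, fun w i j => ?_⟩
            algebraic_left := ?_
            algebraic_right := ?_ }, fun w x => ?_⟩
  · simp only [hh1]
    have : Continuous fun n : Multiplicative ℤ => s ^ n.toAdd := continuous_of_discreteTopology
    exact this.comp continuous_weilOrd
  · rw [hh1, hs']
    exact mHat_semisimple _
  · rw [hh1, hs', mat_mHat, Matrix.diagonal_apply]
    split_ifs
    · exact (norm_torusWeights _ _ _).le
    · simp
  · convert hι
    ext1 x
    change h (1, x, 1) = _
    rw [hh, ord_one, zpow_zero, map_one, one_mul, mul_one]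
  · convert hι'.algebraic
    ext1 x
    change h (1, 1, x) = _
    rw [hh, ord_one, zpow_zero, map_one, one_mul, one_mul]
  · change _ = h (w, x, normDiag w)
    rw [hφ, hh, normDiag_eq, (hcomm _ _).eq, hι'.slDiag, ← mul_assoc, hs, ← map_zpow, ← map_zpow,
      ← map_mul, hz]
    congr 2
    simp only [Prod.pow_mk, Prod.mk_mul_mk, qpolar_zpow, qpolar_mul, _root_.one_zpow, mul_one]
    refine Prod.ext (qpolar_eq rfl ?_) (qpolar_eq rfl ?_) <;> simp <;> ring

end

/-! ### The members of Arthur type -/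

noncomputable section

variable {F : Type*} [NontriviallyNormedField F] [IsUltrametricDist F] [LocallyCompactSpace F]
  {θ₃ : Circle} {hθ₃ : IsPrimitiveRoot θ₃ 3}

theorem commute_iota10_iota12 (x y : SpecialLinearGroup (Fin 2) ℂ) :
    Commute (iota10 x) (iota12 y) :=
  mat_injective (M10_M12_comm x.1 y.1)

theorem commute_mHat_iota10 {z : ℂˣ × ℂˣ} (h : z.1 = z.2 ^ 2) (x : SpecialLinearGroup (Fin 2) ℂ) :
    Commute (mHat z) (iota10 x) :=
  commute_of_mat (M10_comm h x.1)

theorem commute_mHat_iota12 {z : ℂˣ × ℂˣ} (h : z.1 = 1) (x : SpecialLinearGroup (Fin 2) ℂ) :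
    Commute (mHat z) (iota12 x) :=
  commute_of_mat (M12_comm h x.1)

theorem commute_mHat_iota23 {z : ℂˣ × ℂˣ} (h : z.2 = z.1⁻¹) (x : SpecialLinearGroup (Fin 2) ℂ) :
    Commute (mHat z) (iota23 x) :=
  commute_of_mat (M23_comm h x.1)

theorem commute_mHat_iotaD2 {z : ℂˣ × ℂˣ} (h : z.1 = z.2 ^ 2) (h' : z.1 = 1)
    (x : SpecialLinearGroup (Fin 2) ℂ) : Commute (mHat z) (iotaD2 x) :=
  (commute_mHat_iota10 h x).mul_right (commute_mHat_iota12 h' x)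

theorem commute_mHat_iotaA2 (x : SpecialLinearGroup (Fin 2) ℂ) (h : θ₃ ^ 3 = 1) :
    Commute (mHat (qpolar F θ₃ 0, qpolar F (θ₃ ^ 2) 0)) (iotaA2 x) :=
  commute_of_mat (MA2_comm (by rw [qpolar_pow]; exact qpolar_eq rfl (by norm_num))
    (by rw [qpolar_pow, h, mul_zero, qpolar_one]) x.1)

/-- A parameter that is already bounded on the Weil group is of Arthur type. -/
theorem isArthurType_of_bounded {φ : LanglandsParameter F}
    {ι : SpecialLinearGroup (Fin 2) ℂ →* G2} {u v : Circle}
    (hφ : ∀ p, φ.toHom p = mHat (qpolar F u 0, qpolar F v 0) ^ ord p.1 * ι p.2)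
    (hι : IsAlgebraicHom ι)
    (hc : ∀ x, Commute (mHat (qpolar F u 0, qpolar F v 0)) (ι x)) : φ.IsArthurType :=
  isArthurType_of_commute hφ hι hasCocharacter_one hc (fun _ => Commute.one_right _)
    (fun _ _ => Commute.one_right _) (by simp)

theorem isArthurType_of_trivial {φ : LanglandsParameter F}
    {ι : SpecialLinearGroup (Fin 2) ℂ →* G2} {z : ℂˣ × ℂˣ} {u v : Circle} {a b : ℤ}
    (hφ : ∀ p, φ.toHom p = mHat z ^ ord p.1 * (1 : SpecialLinearGroup (Fin 2) ℂ →* G2) p.2)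
    (hι : HasCocharacter ι a b)
    (hc : ∀ x, Commute (mHat (qpolar F u 0, qpolar F v 0)) (ι x))
    (hz : z = (qpolar F u (a / 2), qpolar F v (b / 2))) : φ.IsArthurType :=
  isArthurType_of_commute hφ trivial_algebraic hι (fun _ => Commute.one_right _) hc
    (fun _ _ => Commute.one_left _) hz

/-- Bounded members take the trivial second SL₂. Members trivial on SL₂, apart from the family 0,
use as second SL₂ the homomorphism of their bounded companion. In 4b, 4c, 8b and 8c the commuting
homomorphisms of γ̂₁ and γ̂₁ + 2γ̂₂ are distributed over the two factors. -/
theorem ParamIndex.isArthurType_param {r : ParamIndex F} (h : r.arthurCondition) :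
    (r.param θ₃ hθ₃).IsArthurType := by
  have h1 : (qpolar F (-1) 0) ^ 2 = 1 := by
    rw [qpolar_pow, neg_one_sq, mul_zero, qpolar_one]
  have h11 : (qpolar F 1 0) = qpolar F (-1) 0 ^ 2 := by rw [h1, qpolar_one]
  have h12 : (qpolar F 1 0) = qpolar F 1 0 ^ 2 := by rw [qpolar_one, one_pow]
  have e : (1 : ℂˣ) = qpolar F 1 0 := qpolar_one.symm
  cases r with
  | i0 u₁ u₂ a₁ a₂ hR =>
    obtain ⟨rfl, rfl⟩ := h
    exact isArthurType_of_bounded (fun _ => rfl) trivial_algebraic fun _ => Commute.one_right _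
  | i1a u a hR =>
    obtain rfl : a = 1 / 2 := h
    exact isArthurType_of_trivial (fun _ => rfl) hasCocharacter_iota12 (u := 1) (v := u)
      (commute_mHat_iota12 qpolar_one) (by norm_num)
  | i1b u a hR =>
    obtain rfl : a = 1 / 2 := h
    refine isArthurType_of_bounded (u := 1) (v := u) (fun p => ?_) (ι := iota12) M12_reg
      (commute_mHat_iota12 qpolar_one)
    rw [qpolar_one, ← sub_self (1 / 2 : ℝ)]
    rfl
  | i2a u a hR =>
    obtain rfl : a = 1 / 2 := h
    exact isArthurType_of_trivial (fun _ => rfl) hasCocharacter_iota23 (u := u) (v := u⁻¹)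
      (commute_mHat_iota23 (by simp [qpolar_inv])) (by norm_num)
  | i2b u a hR =>
    obtain rfl : a = 1 / 2 := h
    refine isArthurType_of_bounded (u := u) (v := u⁻¹) (ι := iota23) (fun p => ?_) M23_reg
      (commute_mHat_iota23 (by simp [qpolar_inv]))
    rw [← sub_self (1 / 2 : ℝ)]
    rfl
  | i3a n => exact h.elim
  | i3b n => exact h.elim
  | i4a =>
    exact isArthurType_of_trivial (fun _ => rfl) hasCocharacter_iotaD2 (u := 1) (v := -1)
      (commute_mHat_iotaD2 h11 qpolar_one) (by norm_num)
  | i4b =>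
    exact isArthurType_of_commute (fun _ => rfl) M10_reg hasCocharacter_iota12 (u := 1) (v := -1)
      (commute_mHat_iota10 h11) (commute_mHat_iota12 qpolar_one) commute_iota10_iota12
      (by norm_num)
  | i4c =>
    exact isArthurType_of_commute (fun _ => rfl) M12_reg hasCocharacter_iota10 (u := 1) (v := -1)
      (commute_mHat_iota12 qpolar_one) (commute_mHat_iota10 h11)
      (fun x y => (commute_iota10_iota12 y x).symm) (by simp [qpolar_one])
  | i4d =>
    refine isArthurType_of_bounded (u := 1) (v := -1) (fun p => ?_) iotaD2_algebraic
      (commute_mHat_iotaD2 h11 qpolar_one)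
    rw [qpolar_one]
    rfl
  | i5a => exact h.elim
  | i5b => exact h.elim
  | i6a =>
    exact isArthurType_of_trivial (fun _ => rfl) hasCocharacter_iotaA2
      (fun x => commute_mHat_iotaA2 x hθ₃.pow_eq_one) (by norm_num)
  | i6b => exact h.elim
  | i6c => exact h.elim
  | i6d =>
    exact isArthurType_of_bounded (fun _ => rfl) MA2_reg
      fun x => commute_mHat_iotaA2 x hθ₃.pow_eq_one
  | i7a =>
    refine isArthurType_of_trivial (fun _ => rfl) hasCocharacter_iotaReg (u := 1) (v := 1)
      (fun x => ?_) (by norm_num)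
    rw [qpolar_one]
    exact (map_one mHat).symm ▸ Commute.one_left _
  | i7b => exact h.elim
  | i7c => exact h.elim
  | i7d =>
    refine isArthurType_of_bounded (u := 1) (v := 1) (ι := iotaReg) (fun p => ?_) symSix_reg (fun x => ?_)
    · rw [qpolar_one]
      rfl
    · rw [qpolar_one]
      exact (map_one mHat).symm ▸ Commute.one_left _
  | i8a =>
    exact isArthurType_of_trivial (fun _ => rfl) hasCocharacter_iotaD2 (u := 1) (v := 1)
      (commute_mHat_iotaD2 h12 qpolar_one) (by norm_num)
  | i8b =>
    exact isArthurType_of_commute (fun _ => rfl) M10_reg hasCocharacter_iota12 (u := 1) (v := 1)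
      (commute_mHat_iota10 h12) (commute_mHat_iota12 qpolar_one) commute_iota10_iota12
      (by norm_num)
  | i8c =>
    exact isArthurType_of_commute (fun _ => rfl) M12_reg hasCocharacter_iota10 (u := 1) (v := 1)
      (commute_mHat_iota12 qpolar_one) (commute_mHat_iota10 h12)
      (fun x y => (commute_iota10_iota12 y x).symm) (by simp [qpolar_one])
  | i8d =>
    refine isArthurType_of_bounded (u := 1) (v := 1) (fun p => ?_) iotaD2_algebraic
      (commute_mHat_iotaD2 h12 qpolar_one)
    rw [qpolar_one]
    rfl

end

noncomputable section

variable {F : Type*} [NontriviallyNormedField F] [IsUltrametricDist F] [LocallyCompactSpace F]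
  {ρ ι : SpecialLinearGroup (Fin 2) ℂ →* G2} {k l m n : ℤ}

/-! ### The second `SL₂(ℂ)` of an Arthur parameter -/

theorem norm_le_one_of_eigenvector {M : Matrix (Fin 7) (Fin 7) ℂ} {C : ℝ}
    (hC : ∀ (n : ℕ) i j, ‖(M ^ n) i j‖ ≤ C) {v : Fin 7 → ℂ} (hv : v ≠ 0) {μ : ℂ}
    (h : M *ᵥ v = μ • v) : ‖μ‖ ≤ 1 := by
  obtain ⟨i, hi⟩ := Function.ne_iff.1 hv
  have hpos : 0 < ‖v i‖ := norm_pos_iff.2 hi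
  have hpow : ∀ n : ℕ, (M ^ n) *ᵥ v = μ ^ n • v := fun n => by
    induction n with
    | zero => simp
    | succ n ih =>
      rw [pow_succ, ← Matrix.mulVec_mulVec, h, Matrix.mulVec_smul, ih, smul_smul, pow_succ']
  by_contra! hμ
  obtain ⟨n, hn⟩ := pow_unbounded_of_one_lt ((∑ j, C * ‖v j‖) / ‖v i‖) hμ
  rw [div_lt_iff₀ hpos, ← norm_pow, ← norm_mul] at hn
  have h1 : μ ^ n * v i = ∑ j, (M ^ n) i j * v j := (congrFun (hpow n) i).symm
  rw [h1] at hn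
  refine hn.not_ge ((norm_sum_le _ _).trans (Finset.sum_le_sum fun j _ => ?_))
  rw [norm_mul]
  exact mul_le_mul_of_nonneg_right (hC n i j) (norm_nonneg _)

/-- Bounded powers force eigenvalues of absolute value at most 1; this is applied to s and to its
inverse. -/
theorem norm_eq_one_of_eigenvector {s : G2} {C : ℝ} (hC : ∀ (n : ℤ) i j, ‖mat (s ^ n) i j‖ ≤ C)
    {v : Fin 7 → ℂ} (hv : v ≠ 0) {μ : ℂ} (h : mat s *ᵥ v = μ • v) : ‖μ‖ = 1 := by
  have hpow : ∀ (s : G2) (n : ℕ), mat (s ^ n) = mat s ^ n := fun s n => by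
    induction n with
    | zero => simp only [pow_zero]; rfl
    | succ n ih => rw [pow_succ, pow_succ, mat_mul, ih]
  have hinv : mat s⁻¹ *ᵥ (mat s *ᵥ v) = v := by
    rw [Matrix.mulVec_mulVec, ← mat_mul, inv_mul_cancel]
    exact Matrix.one_mulVec v
  have hμ : μ ≠ 0 := fun hc => hv (by rw [← hinv, h, hc, zero_smul, Matrix.mulVec_zero])
  refine le_antisymm (norm_le_one_of_eigenvector (C := C) (fun n i j => ?_) hv h) ?_
  · rw [← hpow]
    exact_mod_cast hC n i j
  · have h' : mat s⁻¹ *ᵥ v = μ⁻¹ • v := by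
      rw [h, Matrix.mulVec_smul] at hinv
      conv_rhs => rw [← hinv, smul_smul, inv_mul_cancel₀ hμ, one_smul]
    have := norm_le_one_of_eigenvector (C := C) (fun n i j => by
      rw [← hpow, inv_pow, ← zpow_natCast, ← _root_.zpow_neg]
      exact hC _ i j) hv h'
    rw [norm_inv] at this
    exact (inv_le_one₀ (norm_pos_iff.2 hμ)).1 this

theorem torusWeights_zpow (r : ℂˣ) (k l : ℤ) (i : Fin 7) :
    torusWeights (r ^ k, r ^ l) i = (r ^ coweights k l i : ℂˣ) := by
  have := mHat_zpow_eq k l r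
  rw [mat_mHat] at this
  exact congrFun (diagonal_injective this) i

theorem HasCocharacter.torusWeights_of_dUp (h : HasCocharacter ρ k l) {i j : Fin 7}
    (hne : dUp ρ i j ≠ 0) (r : ℂˣ) :
    torusWeights (r ^ k, r ^ l) i = (r ^ 2 : ℂˣ) * torusWeights (r ^ k, r ^ l) j := by
  rw [torusWeights_zpow, torusWeights_zpow, h.dUp_ne_zero hne, _root_.zpow_add, Units.val_mul]
  rfl

theorem norm_torusWeights_apply (u v : Circle) (a b : ℝ) :
    ‖torusWeights (qpolar F u a, qpolar F v b) 0‖ = (resCard F : ℝ) ^ a ∧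
    ‖torusWeights (qpolar F u a, qpolar F v b) 1‖ = (resCard F : ℝ) ^ b :=
  ⟨norm_qpolar _ _, norm_qpolar _ _⟩

/-- The restriction of an Arthur parameter to the second `SL₂(ℂ)`, if the Langlands parameter maps
a Frobenius element to the torus. -/
theorem exists_hasCocharacter_of_mHat {s : G2} {C : ℝ} (hρ : IsAlgebraicHom ρ)
    (hC : ∀ (n : ℤ) i j, ‖mat (s ^ n) i j‖ ≤ C) (hs : ∀ x, Commute s (ρ x)) {u v : Circle} {a b : ℝ}
    (hz : mHat (qpolar F u a, qpolar F v b) = s * ρ (slDiag (qpolar F 1 (1 / 2)))) :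
    ∃ k l : ℤ, HasCocharacter ρ k l ∧ (k : ℝ) = 2 * a ∧ (l : ℝ) = 2 * b := by
  set z := (qpolar F u a, qpolar F v b) with hz'
  set r := qpolar F 1 (1 / 2) with hr
  have hslDiag : ∀ t t', slDiag t * slDiag t' = slDiag t' * slDiag t := fun t t' => by
    refine Subtype.ext ?_
    change !![(t : ℂ), 0; 0, ((t⁻¹ : ℂˣ) : ℂ)] * !![(t' : ℂ), 0; 0, ((t'⁻¹ : ℂˣ) : ℂ)] =
      !![(t' : ℂ), 0; 0, ((t'⁻¹ : ℂˣ) : ℂ)] * !![(t : ℂ), 0; 0, ((t⁻¹ : ℂˣ) : ℂ)]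
    simp [mul_comm]
  have hA : ∀ t, mat (mHat z) * mat (ρ (slDiag t)) = mat (ρ (slDiag t)) * mat (mHat z) := fun t => by
    rw [← mat_mul, ← mat_mul, hz]
    refine congrArg mat ?_
    exact ((hs _).mul_left (by rw [Commute, SemiconjBy, ← map_mul, hslDiag, map_mul])).eq
  -- The bounded factor s contributes absolute value 1, so the eigenvalue of m̂(z) on a vector of
  -- weight k has absolute value q^{k/2} and determines k.
  have hnorm : ∀ (k : ℤ) (v : Fin 7 → ℂ) (μ : ℂ), v ≠ 0 →
      (∀ t : ℂˣ, mat (ρ (slDiag t)) *ᵥ v = ((t ^ k : ℂˣ) : ℂ) • v) → mat (mHat z) *ᵥ v = μ • v →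
      ‖μ‖ = (resCard F : ℝ) ^ (k / 2 : ℝ) := fun k v μ hv h1 h2 => by
    rw [hz, mat_mul, ← Matrix.mulVec_mulVec, h1, Matrix.mulVec_smul] at h2
    have h3 : mat s *ᵥ v = (((r ^ k)⁻¹ : ℂˣ) * μ) • v := by
      rw [← smul_smul, ← h2, smul_smul, Units.inv_mul, one_smul]
    have h4 := norm_eq_one_of_eigenvector hC hv h3
    rw [norm_mul, Units.val_inv_eq_inv_val, norm_inv, hr, qpolar_zpow, norm_qpolar,
      inv_mul_eq_one₀ (Real.rpow_pos_of_pos (zero_lt_one.trans one_lt_resCard_real) _).ne'] at h4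
    rw [← h4]
    congr 1
    ring
  have hinj : ∀ {c d : ℝ}, (resCard F : ℝ) ^ c = (resCard F : ℝ) ^ d → c = d := fun h =>
    (Real.rpow_right_inj (zero_lt_one.trans one_lt_resCard_real) one_lt_resCard_real.ne').1 h
  have he0 : ∀ i : Fin 7, (Pi.single i 1 : Fin 7 → ℂ) ≠ 0 := fun i => by simp
  have he : ∀ i, mat (mHat z) *ᵥ Pi.single i 1 = torusWeights z i • Pi.single i 1 := fun i => by
    rw [mat_mHat]
    ext j
    simp only [Matrix.mulVec_diagonal, Pi.single_apply, Pi.smul_apply, smul_eq_mul, mul_ite,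
      mul_one, mul_zero]
    exact ite_congr rfl (fun h => by rw [h]) fun _ => rfl
  -- Hence the standard basis already consists of weight vectors, and no further conjugation is
  -- needed.
  have hw : ∀ i, ∃ k : ℤ, ∀ t : ℂˣ,
      mat (ρ (slDiag t)) *ᵥ (Pi.single i 1 : Fin 7 → ℂ) = ((t ^ k : ℂˣ) : ℂ) • Pi.single i 1 :=
    fun i => exists_weight_of_eigenvector hρ hA (he i) (he0 i) fun k l v w hv hw h1 h2 h3 h4 => by
      have := hinj ((hnorm k v _ hv h1 h3).symm.trans (hnorm l w _ hw h2 h4))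
      exact_mod_cast (div_left_inj' (two_ne_zero' ℝ)).1 this
  choose K hK using hw
  refine ⟨K 0, K 1, ⟨hρ, fun t => diagonal_of_weights (fun t i => hK i t) t⟩, ?_, ?_⟩
  · have := hinj ((hnorm _ _ _ (he0 0) (hK 0) (he 0)).symm.trans (norm_torusWeights_apply u v a b).1)
    linarith
  · have := hinj ((hnorm _ _ _ (he0 1) (hK 1) (he 1)).symm.trans (norm_torusWeights_apply u v a b).2)
    linarith

/-- Comparison of absolute values gives the cocharacter of the second SL₂, and dividing it out
leaves the unitary part as the image of Frobenius. The raising operator scales by q under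
ρ(diag(q^{1/2}, q^{-1/2})) and commutes with the unitary part and with ι; the conclusions about
torus weights combine these facts. -/
theorem LanglandsParameter.IsArthurType.exists_hasCocharacter {φ : LanglandsParameter F}
    (h : φ.IsArthurType) {u v : Circle} {a b : ℝ}
    (hφ : ∀ p, φ.toHom p = mHat (qpolar F u a, qpolar F v b) ^ ord p.1 * ι p.2)
    (hι : HasCocharacter ι m n) :
    ∃ ρ k l, HasCocharacter ρ k l ∧ (k : ℝ) = 2 * a ∧ (l : ℝ) = 2 * b ∧
      (∀ x, Commute (mHat (qpolar F u 0, qpolar F v 0)) (ρ x)) ∧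
      ∀ i j, dUp ρ i j ≠ 0 →
        torusWeights (qpolar F u (a + m / 2), qpolar F v (b + n / 2)) i =
          qpolar F 1 1 * torusWeights (qpolar F u (a + m / 2), qpolar F v (b + n / 2)) j ∧
        torusWeights (qpolar F 1 m, qpolar F 1 n) i =
          torusWeights (qpolar F 1 m, qpolar F 1 n) j := by
  obtain ⟨ψ, hψ⟩ := h
  obtain ⟨w₁, hw₁⟩ := exists_ord_eq_one F
  obtain ⟨C, hC⟩ := ψ.bounded
  set s := ψ.toHom (w₁, 1, 1) with hs
  set ρ : SpecialLinearGroup (Fin 2) ℂ →* G2 :=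
    ψ.toHom.comp ((MonoidHom.inr _ _).comp (MonoidHom.inr _ _)) with hρ
  have hρx : ∀ x, ρ x = ψ.toHom (1, 1, x) := fun x => rfl
  have hsρ : ∀ x, Commute s (ρ x) := fun x => by
    rw [hρx, hs, Commute, SemiconjBy, ← map_mul, ← map_mul]
    simp
  have hpow : ∀ n : ℤ, s ^ n = ψ.toHom (w₁ ^ n, 1, 1) := fun n => by
    rw [hs, ← map_zpow]
    simp
  have hιx : ∀ x, ι x = ψ.toHom (1, x, 1) := fun x => by
    have h1 := hφ (1, x)
    rw [ord_one, zpow_zero, one_mul, hψ] at h1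
    rw [← h1, normDiag_eq, ord_one, zpow_zero]
    congr 3
    refine Subtype.ext ?_
    simp [slDiag, Matrix.one_fin_two]
  have hιρ : ∀ x y, Commute (ι x) (ρ y) := fun x y => by
    rw [hρx, hιx, Commute, SemiconjBy, ← map_mul, ← map_mul]
    simp
  have hz : mHat (qpolar F u a, qpolar F v b) = s * ρ (slDiag (qpolar F 1 (1 / 2))) := by
    have h1 := hφ (w₁, 1)
    rw [hw₁, zpow_one, map_one, mul_one, hψ, normDiag_eq, hw₁, zpow_one] at h1
    rw [← h1, hs, hρx, ← map_mul]
    simp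
  obtain ⟨k, l, hkl, hk, hl⟩ := exists_hasCocharacter_of_mHat ψ.algebraic_right
    (fun n i j => by rw [hpow]; exact hC _ i j) hsρ hz
  replace hkl : HasCocharacter ρ k l := hkl
  have hsz : s = mHat (qpolar F u 0, qpolar F v 0) := by
    rw [hkl.slDiag, ← mul_inv_eq_iff_eq_mul, ← map_inv, ← map_mul] at hz
    rw [← hz, Prod.inv_mk, Prod.mk_mul_mk, qpolar_zpow, qpolar_zpow, qpolar_inv, qpolar_inv,
      qpolar_mul, qpolar_mul, hk, hl]
    exact congrArg mHat (Prod.ext (qpolar_eq (by simp) (by ring)) (qpolar_eq (by simp) (by ring)))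
  rw [hsz] at hsρ
  refine ⟨ρ, k, l, hkl, hk, hl, hsρ, fun i j hij => ?_⟩
  have h1 := torusWeights_eq_of_dUp hkl.algebraic hsρ hij
  have h2 := hkl.torusWeights_of_dUp hij (qpolar F 1 (1 / 2))
  have h3 : ∀ c : ℝ, torusWeights (qpolar F 1 c ^ m, qpolar F 1 c ^ n) i =
      torusWeights (qpolar F 1 c ^ m, qpolar F 1 c ^ n) j := fun c =>
    torusWeights_eq_of_dUp hkl.algebraic (fun x => by rw [← hι.slDiag]; exact hιρ _ x) hij
  -- The infinitesimal Frobenius is the product of the unitary part and the contributions of both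
  -- factors SL₂; only the second of them scales the raising operator, by q.
  have e : (qpolar F u (a + m / 2), qpolar F v (b + n / 2)) =
      (qpolar F u 0, qpolar F v 0) * (qpolar F 1 (1 / 2) ^ k, qpolar F 1 (1 / 2) ^ l) *
        (qpolar F 1 (1 / 2) ^ m, qpolar F 1 (1 / 2) ^ n) := by
    simp only [Prod.mk_mul_mk, qpolar_zpow, qpolar_mul, hk, hl]
    refine Prod.ext (qpolar_eq (by simp) (by ring)) (qpolar_eq (by simp) (by ring))
  refine ⟨?_, ?_⟩
  · rw [e, torusWeights_mul, torusWeights_mul]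
    simp only [h1, h2, h3 (1 / 2)]
    rw [qpolar_pow]
    simp
    ring
  · have := h3 1
    simp only [qpolar_zpow] at this
    simpa using this

end

/-! ### Necessity of the conditions -/

noncomputable section

variable {F : Type*} [NontriviallyNormedField F] [IsUltrametricDist F] [LocallyCompactSpace F]
  {ρ ι : SpecialLinearGroup (Fin 2) ℂ →* G2} {k l : ℤ} {θ₃ : Circle} {hθ₃ : IsPrimitiveRoot θ₃ 3}

namespace HasCocharacter

/-- With a single raising entry, the diagonal relations make the cocharacter a multiple of the
coroot of γ̂₁ + 2γ̂₂, which is (2, 1). The next result does the same for 2γ̂₁ + 3γ̂₂ with coroot (1,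
1). -/
theorem eq_two_mul_of_dUp (h : HasCocharacter ρ k l)
    (hE : ∀ p ∈ rootPositions, p ≠ (1, 4) → dUp ρ p.1 p.2 = 0) : k = 2 * l := by
  simp [rootPositions] at hE
  have h0 := h.commutator_zero_zero
  have h1 := h.commutator_one_one
  simp [hE] at h0 h1
  have h2 : (k : ℂ) = 2 * l := by
    rw [← h0, ← h1]
    split_ifs <;> ring
  exact_mod_cast h2

theorem eq_of_dUp (h : HasCocharacter ρ k l)
    (hE : ∀ p ∈ rootPositions, p ≠ (0, 5) → dUp ρ p.1 p.2 = 0) : k = l := by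
  simp [rootPositions] at hE
  have h0 := h.commutator_zero_zero
  have h1 := h.commutator_one_one
  simp [hE] at h0 h1
  rw [h1] at h0
  exact_mod_cast h0.symm

theorem eq_zero_of_dUp (h : HasCocharacter ρ k l)
    (hE : ∀ p ∈ rootPositions, dUp ρ p.1 p.2 = 0) : k = 0 ∧ l = 0 := by
  have h1 := h.eq_two_mul_of_dUp fun p hp _ => hE p hp
  have h2 := h.eq_of_dUp fun p hp _ => hE p hp
  omega

end HasCocharacter

/-- Dictionary between positions in the derivation matrices and roots: the quotient of the two torus
weights at a position is the value of the corresponding root. -/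
theorem exists_mem_qRoots {z : ℂˣ × ℂˣ} {p : Fin 7 × Fin 7} (hp : p ∈ rootPositions)
    (h : torusWeights z p.1 = qpolar F 1 1 * torusWeights z p.2) :
    ∃ γ ∈ qRoots F z, (γ = (1, 2) → p = (1, 4)) ∧ (γ = (2, 3) → p = (0, 5)) := by
  have hq : ((qpolar F 1 1 : ℂˣ) : ℂ) = resCard F := by simp [qpolar]
  rw [hq] at h
  obtain ⟨x, y⟩ := z
  have hx := x.ne_zero
  have hy := y.ne_zero
  simp only [rootPositions, Finset.mem_insert, Finset.mem_singleton] at hp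
  obtain rfl | rfl | rfl | rfl | rfl | rfl | rfl | rfl | rfl | rfl | rfl | rfl := hp
  · exact ⟨(1, 0), ⟨by decide, by simp [torusWeights, rootValue] at h ⊢; field_simp at h ⊢; linear_combination h⟩, by decide, by decide⟩
  · exact ⟨(1, 3), ⟨by decide, by simp [torusWeights, rootValue] at h ⊢; field_simp at h ⊢; linear_combination h⟩, by decide, by decide⟩
  · exact ⟨(2, 3), ⟨by decide, by simp [torusWeights, rootValue] at h ⊢; field_simp at h ⊢; linear_combination h⟩, by decide, by decide⟩
  · exact ⟨(0, 1), ⟨by decide, by simp [torusWeights, rootValue] at h ⊢; field_simp at h ⊢; linear_combination h⟩, by decide, by decide⟩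
  · exact ⟨(1, 2), ⟨by decide, by simp [torusWeights, rootValue] at h ⊢; field_simp at h ⊢; linear_combination h⟩, by decide, by decide⟩
  · exact ⟨(1, 1), ⟨by decide, by simp [torusWeights, rootValue] at h ⊢; field_simp at h ⊢; linear_combination h⟩, by decide, by decide⟩
  · exact ⟨(-1, 0), ⟨by decide, by simp [torusWeights, rootValue] at h ⊢; field_simp at h ⊢; linear_combination h⟩, by decide, by decide⟩
  · exact ⟨(-1, -3), ⟨by decide, by simp [torusWeights, rootValue] at h ⊢; field_simp at h ⊢; linear_combination h⟩, by decide, by decide⟩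
  · exact ⟨(-2, -3), ⟨by decide, by simp [torusWeights, rootValue] at h ⊢; field_simp at h ⊢; linear_combination h⟩, by decide, by decide⟩
  · exact ⟨(0, -1), ⟨by decide, by simp [torusWeights, rootValue] at h ⊢; field_simp at h ⊢; linear_combination h⟩, by decide, by decide⟩
  · exact ⟨(-1, -2), ⟨by decide, by simp [torusWeights, rootValue] at h ⊢; field_simp at h ⊢; linear_combination h⟩, by decide, by decide⟩
  · exact ⟨(-1, -1), ⟨by decide, by simp [torusWeights, rootValue] at h ⊢; field_simp at h ⊢; linear_combination h⟩, by decide, by decide⟩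

/-- In the families 0, 1, 2 the prescribed set of roots with value q restricts the raising operator,
and with it the cocharacter, which gives equations for the exponents. The isolated members are
excluded by the cocharacter or by the unitary part. -/
theorem ParamIndex.arthurCondition_of_isArthurType {r : ParamIndex F}
    (h : (r.param θ₃ hθ₃).IsArthurType) : r.arthurCondition := by
  have hθ : θ₃ ≠ 1 := hθ₃.ne_one (by norm_num)
  have hq0 : ∀ {u v : Circle} {a b : ℝ}, (qpolar F u a : ℂ) = qpolar F v b → u = v ∧ a = b :=
    fun h => qpolar_inj.1 (Units.ext h)
  cases r with
  | i0 u₁ u₂ a₁ a₂ hR =>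
    obtain ⟨ρ, k, l, hρ, hk, hl, -, hE⟩ := h.exists_hasCocharacter (fun _ => rfl) hasCocharacter_one
    obtain ⟨rfl, rfl⟩ := hρ.eq_zero_of_dUp fun p hp => by
      by_contra hc
      obtain ⟨γ, h1, -⟩ := exists_mem_qRoots hp (hE _ _ hc).1
      simp [hR] at h1
    constructor
    · simpa using hk
    · simpa using hl
  | i1a u a hR =>
    obtain ⟨ρ, k, l, hρ, hk, hl, -, hE⟩ := h.exists_hasCocharacter (fun _ => rfl) hasCocharacter_one
    have hkl := hρ.eq_two_mul_of_dUp fun p hp hne => by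
      by_contra hc
      obtain ⟨γ, h1, h2, -⟩ := exists_mem_qRoots hp (hE _ _ hc).1
      simp only [Int.cast_zero, zero_div, add_zero, hR] at h1
      exact hne (h2 h1)
    have hkl' : (k : ℝ) = 2 * l := by exact_mod_cast hkl
    change a = 1 / 2
    linarith
  | i1b u a hR =>
    obtain ⟨ρ, k, l, hρ, hk, hl, -, hE⟩ := h.exists_hasCocharacter (u := 1) (a := 0)
      (v := u) (b := a - 1 / 2) (fun p => by rw [qpolar_one]; rfl) hasCocharacter_iota12
    obtain ⟨rfl, rfl⟩ := hρ.eq_zero_of_dUp fun p hp => by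
      by_contra hc
      -- The only root space available is that of γ̂₁ + 2γ̂₂, but this root is not trivial on its
      -- own coroot, so its root vectors do not commute with ι. Hence the second SL₂ is trivial; 2b
      -- works in the same way.
      obtain ⟨h0, h3⟩ := hE _ _ hc
      obtain ⟨γ, h1, h2, -⟩ := exists_mem_qRoots hp h0
      have e : (0 + (2 : ℤ) / 2 : ℝ) = 1 := by norm_num
      have e' : (a - 1 / 2 + (1 : ℤ) / 2 : ℝ) = a := by norm_num
      rw [e, e', hR] at h1
      rw [h2 h1] at h3
      have h4 : qpolar F 1 (-2) = 1 := by
        simpa [torusWeights, qpolar_inv, qpolar_mul] using h3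
      rw [← qpolar_one (F := F), qpolar_inj] at h4
      norm_num at h4
    change a = 1 / 2
    push_cast at hl
    linarith
  | i2a u a hR =>
    obtain ⟨ρ, k, l, hρ, hk, hl, -, hE⟩ := h.exists_hasCocharacter (fun _ => rfl) hasCocharacter_one
    have hkl := hρ.eq_of_dUp fun p hp hne => by
      by_contra hc
      obtain ⟨γ, h1, -, h2⟩ := exists_mem_qRoots hp (hE _ _ hc).1
      simp only [Int.cast_zero, zero_div, add_zero, hR] at h1
      exact hne (h2 h1)
    have hkl' : (k : ℝ) = l := by exact_mod_cast hkl
    change a = 1 / 2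
    linarith
  | i2b u a hR =>
    obtain ⟨ρ, k, l, hρ, hk, hl, -, hE⟩ := h.exists_hasCocharacter
      (fun p => rfl) hasCocharacter_iota23
    obtain ⟨rfl, rfl⟩ := hρ.eq_zero_of_dUp fun p hp => by
      by_contra hc
      obtain ⟨h0, h3⟩ := hE _ _ hc
      obtain ⟨γ, h1, -, h2⟩ := exists_mem_qRoots hp h0
      have e : (a - 1 / 2 + (1 : ℤ) / 2 : ℝ) = a := by norm_num
      have e' : (1 / 2 - a + (1 : ℤ) / 2 : ℝ) = 1 - a := by push_cast; ring
      rw [e, e', hR] at h1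
      rw [h2 h1] at h3
      have := hq0 (u := 1) (v := 1) (a := 1) (b := -1) (by simpa [torusWeights, qpolar_inv, qpolar_mul] using h3)
      norm_num at this
    change a = 1 / 2
    push_cast at hl
    linarith
  | i3a n =>
    obtain ⟨ρ, k, l, hρ, hk, -⟩ := h.exists_hasCocharacter (fun _ => rfl) hasCocharacter_one
    -- The exponent 1/3 would require the nonintegral weight 2/3.
    have : 3 * k = 2 := by
      have : (3 * k : ℝ) = 2 := by linarith
      exact_mod_cast this
    omega
  | i3b n =>
    obtain ⟨ρ, k, l, hρ, hk, -⟩ := h.exists_hasCocharacter (fun _ => rfl) hasCocharacter_iota10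
    have : 3 * k = 2 := by
      have : (3 * k : ℝ) = 2 := by linarith
      exact_mod_cast this
    omega
  | i5a =>
    obtain ⟨ρ, k, l, hρ, hk, hl, -⟩ := h.exists_hasCocharacter (fun _ => rfl) hasCocharacter_one
    have hk' : k = 4 := by norm_num at hk; exact_mod_cast hk
    have hl' : l = 2 := by norm_num at hl; exact_mod_cast hl
    -- The required cocharacter (4, 2) lies in the chamber but belongs to no homomorphism. The same
    -- holds for (3, 3), (6, 3) and (5, 5) in 5b, 7b and 7c.
    have := hρ.eq_of_chamber (by omega) (by omega)
    omega
  | i5b =>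
    obtain ⟨ρ, k, l, hρ, hk, hl, -⟩ := h.exists_hasCocharacter (fun _ => rfl) hasCocharacter_iota01
    have hk' : k = 3 := by norm_num at hk; exact_mod_cast hk
    have hl' : l = 3 := by norm_num at hl; exact_mod_cast hl
    have := hρ.eq_of_chamber (by omega) (by omega)
    omega
  | i6b =>
    obtain ⟨ρ, k, l, hρ, hk, hl, hc, -⟩ := h.exists_hasCocharacter (fun _ => rfl) hasCocharacter_iota10
    obtain rfl : k = 2 := by norm_num at hk; exact_mod_cast hk
    obtain rfl : l = 1 := by norm_num at hl; exact_mod_cast hl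
    -- The cocharacter (2, 1) forces a nonzero entry at γ̂₁ + 2γ̂₂, but this root has value θ₃ ≠ 1
    -- at the unitary part. In 6c a reflection leads to the same kind of contradiction.
    have := torusWeights_eq_of_dUp hρ.algebraic hc hρ.exists_conj_iota12.1
    have := hq0 (u := θ₃ ^ 2) (v := θ₃) (a := 0) (b := 0) (by
      simpa [torusWeights, qpolar_inv, ← Units.val_mul, qpolar_mul, sq] using this)
    exact hθ (by simpa [sq] using this.1)
  | i6c =>
    obtain ⟨ρ, k, l, hρ, hk, hl, hc, -⟩ := h.exists_hasCocharacter (fun _ => rfl) hasCocharacter_iota13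
    obtain rfl : k = 1 := by norm_num at hk; exact_mod_cast hk
    obtain rfl : l = 2 := by norm_num at hl; exact_mod_cast hl
    obtain ⟨ρ', h1, h2⟩ := hρ.exists_swap (qpolar F θ₃ 0, qpolar F (θ₃ ^ 2) 0)
    have := torusWeights_eq_of_dUp h1.algebraic (h2.commute hc) h1.exists_conj_iota12.1
    have := hq0 (u := θ₃) (v := θ₃ / θ₃ ^ 2) (a := 0) (b := 0) (by
      simpa [torusWeights, qpolar_inv, ← Units.val_mul, qpolar_mul, div_eq_mul_inv] using this)
    refine hθ ?_
    have h3 := this.1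
    rw [eq_div_iff_mul_eq', ← pow_succ', hθ₃.pow_eq_one] at h3
    exact h3.symm
  | i7b =>
    obtain ⟨ρ, k, l, hρ, hk, hl, -⟩ := h.exists_hasCocharacter (fun _ => rfl) hasCocharacter_iota10
    have hk' : k = 6 := by norm_num at hk; exact_mod_cast hk
    have hl' : l = 3 := by norm_num at hl; exact_mod_cast hl
    have := hρ.eq_of_chamber (by omega) (by omega)
    omega
  | i7c =>
    obtain ⟨ρ, k, l, hρ, hk, hl, -⟩ := h.exists_hasCocharacter (fun _ => rfl) hasCocharacter_iota01
    have hk' : k = 5 := by norm_num at hk; exact_mod_cast hk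
    have hl' : l = 5 := by norm_num at hl; exact_mod_cast hl
    have := hρ.eq_of_chamber (by omega) (by omega)
    omega
  | _ => trivial

theorem ParamIndex.isArthurType_param_iff {r : ParamIndex F} :
    (r.param θ₃ hθ₃).IsArthurType ↔ r.arthurCondition :=
  ⟨arthurCondition_of_isArthurType, isArthurType_param⟩

end

end G2Arthur

theorem proposition2 {F : Type*} [NontriviallyNormedField F] [IsUltrametricDist F]
    [LocallyCompactSpace F] (θ₃ : Circle) (hθ₃ : IsPrimitiveRoot θ₃ 3) :
    (∀ φ : G2Arthur.LanglandsParameter F, φ.IsUnramified →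
      ∃ r : G2Arthur.ParamIndex F, φ.IsConj (r.param θ₃ hθ₃)) ∧
    (∀ (φ : G2Arthur.LanglandsParameter F) (r : G2Arthur.ParamIndex F),
      φ.IsConj (r.param θ₃ hθ₃) → (φ.IsArthurType ↔ r.arthurCondition)) := by
  refine ⟨fun φ hφ => hφ.exists_isConj, fun φ r h => ?_⟩
  rw [← G2Arthur.ParamIndex.isArthurType_param_iff (hθ₃ := hθ₃)]
  exact ⟨fun hφ => hφ.of_isConj h, fun hr => hr.of_isConj h.symm⟩
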